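/- All logarithms are to base $2$. A tournament is a directed graph without loops in which any two distinct vertices $v,w$ are joined by exactly one of the edges $(v,w)$, $(w,v)$. A set of vertices is transitive if it contains no directed cycle (of length at least $3$), and a coloring of the vertices is proper if no directed cycle is monochromatic. A tournament $T$ is $H$-free if no set of vertices of $T$ induces a tournament isomorphic to $H$. Constellations. Let $\theta$ be a linear ordering of the vertices of a finite tournament $H$. The graph $B(H,\theta)$ of backward edges joins $v$ and $w$ whenever $w$ precedes $v$ in $\theta$ and $(v,w)$ is an edge of $H$. Call $\theta$ a star ordering if every connected component of $B(H,\theta)$ is a singleton or a star $K_{1,t}$ ($t\ge 1$) whose center precedes all its leaves or comes after all its leaves; if $t=1$, either vertex may be chosen as the center. Fix such choices. The interstellar graph has as its vertices the sets of leaves of the stars; two different ones $L_1,L_2$ are adjacent iff the first vertex of $L_1$ precedes the last vertex of $L_2$ and the first vertex of $L_2$ precedes the last vertex of $L_1$. For every connected component of this graph let $Z$ be the union of its leaf sets, and let its cluster consist of $Z$ and all vertices lying between two vertices of $Z$. The clusters, together with the nonempty sets of remaining vertices that lie before, after or between consecutive clusters, form a partition of $V(H)$. $H$ is a constellation if there are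 a star ordering and a choice of centers such that no part of this partition contains both the center and a leaf of the same star. Theorem. Let $H$ be a constellation with $h=|H|$ vertices and let $\epsilon(H)=2^{-2^{50h^2+1}}$. (1) For $n\ge 2$, every $n$-vertex $H$-free tournament has a proper coloring with at most $n^{1-\epsilon(H)}\log n$ colors. Every finite $H$-free tournament $T$ contains a transitive subtournament of order at least $|T|^{\epsilon(H)}$. (2) There is one algorithm with the following property. For every constellation $H$ there is a constant $C>0$ such that, for every $n$-vertex $H$-free tournament $T$, the algorithm, given $H$ and $T$ by adjacency lists, halts and outputs a proper coloring of $T$, which for $n\ge 2$ uses at most $n^{1-\epsilon(H)}\log n$ colors, together with its first color class, which is a transitive subtournament of order at least $n^{\epsilon(H)}$; for $n\ge 2$ it makes at most $e^{C(\log n)^2}$ steps. Here an algorithm is a program of a first-order functional language with recursion whose data are binary trees (numbers being encoded in unary and lists as nested pairs), and every elementary operation (reading a variable, forming a pair, taking a component of a pair, testing for the empty tree, binding a local variable, calling a function) costs one step. -/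

import Mathlib

/-! ### Tournaments, transitive sets, proper colorings -/

/-- A tournament on the vertex set `V`: for two distinct vertices exactly one of the two possible
edges is present, and there are no loops. -/
structure Tournament (V : Type*) where
  /-- `Adj v w` says that `(v, w)` is an edge, i.e. `v` is adjacent to `w`. -/
  Adj : V → V → Prop
  /-- There is no loop, and two opposite edges are never both present. -/
  asymm : ∀ v w, Adj v w → ¬ Adj w v
  /-- Two distinct vertices are joined by an edge. -/
  total : ∀ v w, v ≠ w → Adj v w ∨ Adj w v

namespace Tournament

variable {V W : Type*}

/-- `T` is `H`-free: no subset of the vertices of `T` induces a tournament isomorphic to `H`. -/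
def Free (T : Tournament V) (H : Tournament W) : Prop :=
  IsEmpty (H.Adj ↪r T.Adj)

/-- `v 0, …, v (k - 1)` are the vertices of a directed cycle of length `k ≥ 3`
(`finRotate k` is the map `i ↦ i + 1 mod k`). -/
def IsDirectedCycle (T : Tournament V) (k : ℕ) (v : Fin k → V) : Prop :=
  3 ≤ k ∧ Function.Injective v ∧ ∀ i, T.Adj (v i) (v (finRotate k i))

/-- A set of vertices is transitive if the subtournament it induces has no directed cycle. -/
def IsTransitive (T : Tournament V) (S : Set V) : Prop :=
  ∀ (k : ℕ) (v : Fin k → V), T.IsDirectedCycle k v → ¬ ∀ i, v i ∈ S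

/-- A coloring of the vertices is proper if no directed cycle is monochromatic. -/
def IsProperColoring {α : Type*} (T : Tournament V) (c : V → α) : Prop :=
  ∀ (k : ℕ) (v : Fin k → V), T.IsDirectedCycle k v → ¬ ∀ i j, c (v i) = c (v j)

/-! ### Star orderings

An ordering of the vertices is given by the bijection `θ` that sends every vertex to its position.
-/

section Ordering

variable [Fintype V]

/-- The graph of backward edges of `T` under the ordering `θ`. -/
def backwardGraph (T : Tournament V) (θ : V ≃ Fin (Fintype.card V)) : SimpleGraph V where
  Adj v w := (T.Adj v w ∧ θ w < θ v) ∨ (T.Adj w v ∧ θ v < θ w)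
  symm := ⟨fun _ _ h => h.symm⟩
  loopless := ⟨fun v h => by simp at h⟩

/-- The vertices `c` and `L` induce, in the graph of backward edges, a star with center `c` and
nonempty set of leaves `L`, and it is a left star (the center precedes all leaves) or a right
star (the center comes after all leaves). -/
def IsStar (T : Tournament V) (θ : V ≃ Fin (Fintype.card V)) (c : V) (L : Set V) : Prop :=
  c ∉ L ∧ L.Nonempty ∧
  (∀ l ∈ L, (T.backwardGraph θ).Adj c l) ∧
  (∀ l ∈ L, ∀ l' ∈ L, ¬ (T.backwardGraph θ).Adj l l') ∧
  ((∀ l ∈ L, θ c < θ l) ∨ (∀ l ∈ L, θ l < θ c))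

/-- The connected components of the graph of backward edges. -/
abbrev Component (T : Tournament V) (θ : V ≃ Fin (Fintype.card V)) : Type _ :=
  (T.backwardGraph θ).ConnectedComponent

/-- The non-singleton components of the graph of backward edges. Under a star ordering these are
the stars of `T`. -/
abbrev Star (T : Tournament V) (θ : V ≃ Fin (Fintype.card V)) : Type _ :=
  {K : T.Component θ // K.supp.Nontrivial}

/-- The leaves of the star `K` when its center is `ctr K`. -/
def leaves {T : Tournament V} {θ : V ≃ Fin (Fintype.card V)} (ctr : T.Star θ → V)
    (K : T.Star θ) : Set V :=
  K.1.supp \ {ctr K}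

/-- `θ` is a star ordering, and `ctr` gives for every star its center: every component of the
graph of backward edges is a singleton, or it is a (left or right) star. For a star with a single
edge either of the two vertices may be chosen as the center; `ctr` fixes these choices. -/
def IsStarOrdering (T : Tournament V) (θ : V ≃ Fin (Fintype.card V)) (ctr : T.Star θ → V) : Prop :=
  ∀ K : T.Star θ, ctr K ∈ K.1.supp ∧ T.IsStar θ (ctr K) (leaves ctr K)

/-! ### The interstellar graph and constellations -/

/-- `v` is the left point of `S`, the first vertex of `S` in the ordering. -/
def IsLeftPoint (θ : V ≃ Fin (Fintype.card V)) (S : Set V) (v : V) : Prop :=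
  v ∈ S ∧ ∀ w ∈ S, θ v ≤ θ w

/-- `v` is the right point of `S`, the last vertex of `S` in the ordering. -/
def IsRightPoint (θ : V ≃ Fin (Fintype.card V)) (S : Set V) (v : V) : Prop :=
  v ∈ S ∧ ∀ w ∈ S, θ w ≤ θ v

/-- The left point of `L₁` precedes the right point of `L₂`. -/
def LeftPrecedesRight (θ : V ≃ Fin (Fintype.card V)) (L₁ L₂ : Set V) : Prop :=
  ∃ a b, IsLeftPoint θ L₁ a ∧ IsRightPoint θ L₂ b ∧ θ a < θ b

/-- The interstellar graph. Its vertices are the sets of leaves of the stars; as these are nonempty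
and pairwise disjoint, they are represented by the stars themselves. -/
def interstellarGraph {T : Tournament V} {θ : V ≃ Fin (Fintype.card V)} (ctr : T.Star θ → V) :
    SimpleGraph (T.Star θ) where
  Adj K M := K ≠ M ∧ LeftPrecedesRight θ (leaves ctr K) (leaves ctr M) ∧
    LeftPrecedesRight θ (leaves ctr M) (leaves ctr K)
  symm := ⟨fun _ _ h => ⟨h.1.symm, h.2.2, h.2.1⟩⟩
  loopless := ⟨fun _ h => h.1 rfl⟩

/-- The set of the vertices that belong to `Z` or lie between two vertices of `Z`. -/
def hull (θ : V ≃ Fin (Fintype.card V)) (Z : Set V) : Set V :=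
  {v | v ∈ Z ∨ ∃ a ∈ Z, ∃ b ∈ Z, θ a < θ v ∧ θ v < θ b}

/-- For a connected component `C` of the interstellar graph, the hull of the union of the sets of
leaves that belong to `C`. -/
def cluster {T : Tournament V} {θ : V ≃ Fin (Fintype.card V)} (ctr : T.Star θ → V)
    (C : (interstellarGraph ctr).ConnectedComponent) : Set V :=
  hull θ (⋃ K ∈ C.supp, leaves ctr K)

/-- For a vertex `v` outside all clusters, the set of all vertices outside the clusters that lie in
the same gap as `v`: before, after or between two consecutive clusters. -/
def gap {T : Tournament V} {θ : V ≃ Fin (Fintype.card V)} (ctr : T.Star θ → V) (v : V) : Set V :=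
  {w | ∀ C, w ∉ cluster ctr C ∧
    ∀ u ∈ cluster ctr C, ¬ (θ v < θ u ∧ θ u < θ w) ∧ ¬ (θ w < θ u ∧ θ u < θ v)}

/-- The partition of the vertex set into the clusters and the nonempty gaps. -/
def starPartition {T : Tournament V} {θ : V ≃ Fin (Fintype.card V)} (ctr : T.Star θ → V) :
    Set (Set V) :=
  {P | (∃ C, P = cluster ctr C) ∨ ∃ v, (∀ C, v ∉ cluster ctr C) ∧ P = gap ctr v}

/-- `T` is a constellation: for some star ordering, no part of the partition contains both the
center and a leaf of the same star. -/
def IsConstellation (T : Tournament V) : Prop :=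
  ∃ (θ : V ≃ Fin (Fintype.card V)) (ctr : T.Star θ → V), T.IsStarOrdering θ ctr ∧
    ∀ P ∈ starPartition ctr, ∀ K : T.Star θ, ctr K ∈ P → ∀ l ∈ leaves ctr K, l ∉ P

end Ordering

end Tournament

/-- The coefficient `ε = 2 ^ (- 2 ^ (50 h² + 1))`. -/
noncomputable def ehCoeff (h : ℕ) : ℝ :=
  1 / (2 : ℝ) ^ (2 ^ (50 * h ^ 2 + 1))

/-! ### The model of computation

Programs of a first-order functional language over binary trees, with a unit cost for every
elementary operation. Trees are built from pointers to shared cells, so that each operation takes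
constant time on a pointer machine or a random access machine. -/

namespace Machine

/-- The data: binary trees. -/
inductive Data : Type
  | nil : Data
  | cons (a b : Data) : Data

/-- The left subtree; `nil` for the tree `nil`. -/
def Data.head : Data → Data
  | .nil => .nil
  | .cons a _ => a

/-- The right subtree; `nil` for the tree `nil`. -/
def Data.tail : Data → Data
  | .nil => .nil
  | .cons _ b => b

/-- Expressions. -/
inductive Expr : Type
  /-- the value of the local variable number `i` (counted from the innermost one) -/
  | var (i : ℕ) : Expr
  /-- the tree `nil` -/
  | nil : Expr
  /-- a new cell -/
  | cons (a b : Expr) : Expr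
  /-- the left subtree -/
  | head (a : Expr) : Expr
  /-- the right subtree -/
  | tail (a : Expr) : Expr
  /-- the value of `a` if `c` is not `nil`, and otherwise the value of `b` -/
  | ite (c a b : Expr) : Expr
  /-- the value of `b` after the value of `a` was assigned to a new local variable -/
  | letIn (a b : Expr) : Expr
  /-- the function number `f`, applied to the value of `a` -/
  | call (f : ℕ) (a : Expr) : Expr

/-- A program: finitely many functions of one argument, which may call each other recursively.
The body of a function has a single free variable, its argument. Function number `0` is the main
function. -/
abbrev Program : Type := List Expr

/-- `Eval P env e v t`: in the program `P`, with the values `env` of the local variables, the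
evaluation of `e` terminates with the value `v` after `t` steps. -/
inductive Eval (P : Program) : List Data → Expr → Data → ℕ → Prop
  | var (env : List Data) (i : ℕ) : Eval P env (.var i) (env.getD i .nil) 1
  | nil (env : List Data) : Eval P env .nil .nil 1
  | cons {env : List Data} {a b : Expr} {u v : Data} {s t : ℕ} :
      Eval P env a u s → Eval P env b v t → Eval P env (.cons a b) (.cons u v) (s + t + 1)
  | head {env : List Data} {a : Expr} {u : Data} {s : ℕ} :
      Eval P env a u s → Eval P env (.head a) u.head (s + 1)
  | tail {env : List Data} {a : Expr} {u : Data} {s : ℕ} :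
      Eval P env a u s → Eval P env (.tail a) u.tail (s + 1)
  | iteTrue {env : List Data} {c a b : Expr} {x y v : Data} {s t : ℕ} :
      Eval P env c (.cons x y) s → Eval P env a v t → Eval P env (.ite c a b) v (s + t + 1)
  | iteFalse {env : List Data} {c a b : Expr} {v : Data} {s t : ℕ} :
      Eval P env c .nil s → Eval P env b v t → Eval P env (.ite c a b) v (s + t + 1)
  | letIn {env : List Data} {a b : Expr} {u v : Data} {s t : ℕ} :
      Eval P env a u s → Eval P (u :: env) b v t → Eval P env (.letIn a b) v (s + t + 1)
  | call {env : List Data} {f : ℕ} {a body : Expr} {u v : Data} {s t : ℕ} :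
      P[f]? = some body → Eval P env a u s → Eval P [u] body v t →
      Eval P env (.call f a) v (s + t + 1)

/-- The program `P` halts on the given input, with the given output, after `t` steps. -/
def Program.Runs (P : Program) (input output : Data) (t : ℕ) : Prop :=
  ∃ main, P[0]? = some main ∧ Eval P [input] main output t

/-- Lists as data. -/
def encodeList : List Data → Data
  | [] => .nil
  | a :: l => .cons a (encodeList l)

/-- Natural numbers as data, in unary. -/
def encodeNat : ℕ → Data
  | 0 => .nil
  | n + 1 => .cons .nil (encodeNat n)

/-- Lists of elements of `Fin n` as data. -/
def encodeFins {n : ℕ} (l : List (Fin n)) : Data :=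
  encodeList (l.map fun i => encodeNat i)

/-- `adj` is a description of the tournament `T` by adjacency lists: `adj v` lists, in some order
and without repetition, the vertices that `v` is adjacent to. -/
def IsAdjacencyLists {n : ℕ} (T : Tournament (Fin n)) (adj : Fin n → List (Fin n)) : Prop :=
  ∀ v, (adj v).Nodup ∧ ∀ w, w ∈ adj v ↔ T.Adj v w

/-- Adjacency lists as data. -/
def encodeAdj {n : ℕ} (adj : Fin n → List (Fin n)) : Data :=
  encodeList (List.ofFn fun v => encodeFins (adj v))

/-- A coloring as data: the list of the colors of the vertices. -/
def encodeColoring {n k : ℕ} (c : Fin n → Fin k) : Data :=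
  encodeFins (List.ofFn c)

end Machine

/-! The algorithm starts on a vertex set X with half of X and the singletons. For a number of rounds
depending only on h, it enlarges this family by selecting vertices according to their degrees to
other sets, and by adding the transitive sets that it finds recursively. It returns a longest
transitive concatenation of two members. All members have at most |X|/2 vertices, so the recursion
has logarithmic depth.

Let n = |X|, and suppose that the output has τ < n^ε vertices. By induction every definable set A
contains a definable transitive set with |A|^ε vertices, and two definable transitive sets, one
complete to the other, have at most τ vertices together. These are the assumptions of
`DefinableFamily`. Under them H embeds into T (`DefinableFamily.rpow_le`), a contradiction.

An H-free tournament contains a long sequence of sets B of linear size in which almost all edges go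
forward (`exists_near_chain`). Every B contains a transitive tile of order about n^ε with typical
vertices (`exists_tiles`). A Ramsey argument shrinks the tiles by a constant factor and finds h of
them that are pairwise complete or pairwise rich (`ramsey_tiles`); rich means that no large
definable parts of two tiles are complete in the forward direction.

If the tiles are rich, every part of the constellation goes into its own tile
(`IsStarData.exists_hom_of_rich`). Leaves of one star share a tile and are ordered by its
transitivity; the center is in another tile, and richness supplies the backward edges. If the tiles
are complete, the leaves go into tiles and all other vertices into the sets B
(`IsStarData.exists_hom_of_complete`). Should a star not fit there, a fixed fraction of a tile and a
subset of some B of linear size are complete in the forward direction. A transitive set of order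
(cn)^ε in that subset is only O(ε)n^ε smaller than n^ε. For small ε the part of the tile outweighs
this loss, so the two sets together have more than τ vertices.

Removing the sets found one after the other gives the coloring (`one_add_rpow_le`). A level of the
recursion takes polynomial time apart from polynomially many recursive calls, and there are O(log n)
levels, whence the running time (`searchCost_le`). -/

/-! ### Degrees, near-complete pairs, definable sets -/

namespace Tournament

section Degrees

variable {V : Type*} (T : Tournament V)

/-- `x → y` if `b` is true, `y → x` otherwise. -/
def Dir (b : Bool) (x y : V) : Prop := bif b then T.Adj x y else T.Adj y x

instance [DecidableRel T.Adj] (b : Bool) (x y : V) : Decidable (T.Dir b x y) := by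
  unfold Dir; cases b <;> (simp only [cond_true, cond_false]; infer_instance)

@[simp] theorem dir_true (x y : V) : T.Dir true x y ↔ T.Adj x y := Iff.rfl

@[simp] theorem dir_false (x y : V) : T.Dir false x y ↔ T.Adj y x := Iff.rfl

theorem dir_not (b : Bool) (x y : V) : T.Dir (!b) x y ↔ T.Dir b y x := by
  cases b <;> simp

theorem irrefl (x : V) : ¬ T.Adj x x := fun h => T.asymm x x h h

theorem ne_of_adj {x y : V} (h : T.Adj x y) : x ≠ y := by
  rintro rfl; exact T.irrefl _ h

theorem adj_of_not_adj {x y : V} (hne : x ≠ y) (h : ¬ T.Adj x y) : T.Adj y x :=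
  (T.total x y hne).resolve_left h

theorem dir_total {b : Bool} {x y : V} (hne : x ≠ y) (h : ¬ T.Dir b x y) : T.Dir b y x := by
  cases b
  · exact T.adj_of_not_adj hne.symm h
  · exact T.adj_of_not_adj hne h

/-- Every vertex of `A` is adjacent to every vertex of `B`. -/
def Complete (A B : Finset V) : Prop := ∀ x ∈ A, ∀ y ∈ B, T.Adj x y

theorem Complete.mono {A B A' B' : Finset V} (h : T.Complete A B) (hA : A' ⊆ A) (hB : B' ⊆ B) :
    T.Complete A' B' := fun x hx y hy => h x (hA hx) y (hB hy)

/-- A transitive set of vertices, given by the positions of its vertices. -/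
def IsChain (A : Finset V) : Prop :=
  ∃ f : V → ℕ, Set.InjOn f A ∧ (∀ x ∈ A, f x < A.card) ∧
    ∀ x ∈ A, ∀ y ∈ A, (T.Adj x y ↔ f x < f y)

variable [DecidableRel T.Adj]

/-- The number of vertices `z ∈ Z` with `Dir b x z`. -/
def deg (b : Bool) (Z : Finset V) (x : V) : ℕ := (Z.filter (T.Dir b x)).card

/-- The number of vertices `z ∈ Z` without `Dir b x z`. -/
def codeg (b : Bool) (Z : Finset V) (x : V) : ℕ := (Z.filter fun z => ¬ T.Dir b x z).card

theorem deg_add_codeg (b : Bool) (Z : Finset V) (x : V) :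
    T.deg b Z x + T.codeg b Z x = Z.card :=
  Finset.card_filter_add_card_filter_not (T.Dir b x)

theorem codeg_mono {b : Bool} {Z Z' : Finset V} (h : Z ⊆ Z') (x : V) :
    T.codeg b Z x ≤ T.codeg b Z' x :=
  Finset.card_le_card (Finset.filter_subset_filter _ h)

theorem codeg_eq_zero {b : Bool} {Z : Finset V} {x : V} :
    T.codeg b Z x = 0 ↔ ∀ z ∈ Z, T.Dir b x z := by
  simp [codeg, Finset.filter_eq_empty_iff]

/-- Double counting of missing edges; seen from the other side, the direction is reversed. -/
theorem sum_codeg (b : Bool) (A B : Finset V) :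
    ∑ x ∈ A, T.codeg b B x = ∑ y ∈ B, T.codeg (!b) A y := by
  unfold codeg
  simp only [dir_not]
  exact Finset.sum_card_bipartiteAbove_eq_sum_card_bipartiteBelow (fun x y => ¬ T.Dir b x y)

/-- Markov's inequality for the number of missing edges. -/
theorem markov_codeg (b : Bool) (A B : Finset V) {μ l : ℝ}
    (h : (∑ x ∈ A, (T.codeg b B x : ℝ)) ≤ l * A.card * B.card) (hl : 0 ≤ l) :
    μ * ((A.filter fun x => μ * B.card < T.codeg b B x).card : ℝ) ≤ l * A.card := by
  rcases Nat.eq_zero_or_pos B.card with h0 | h0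
  · have : (A.filter fun x => μ * B.card < T.codeg b B x) = ∅ := by
      rw [Finset.filter_eq_empty_iff]
      intro x _
      have := T.deg_add_codeg b B x
      have h2 : T.codeg b B x = 0 := by omega
      simp [h0, h2]
    rw [this]; simp; positivity
  · have h1 : ((A.filter fun x => μ * B.card < T.codeg b B x).card : ℝ) * (μ * B.card) ≤
        ∑ x ∈ A, (T.codeg b B x : ℝ) := by
      calc _ = ∑ x ∈ A.filter (fun x => μ * B.card < T.codeg b B x), μ * (B.card : ℝ) := by
            rw [Finset.sum_const, nsmul_eq_mul]
        _ ≤ ∑ x ∈ A.filter (fun x => μ * B.card < T.codeg b B x), (T.codeg b B x : ℝ) :=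
            Finset.sum_le_sum fun x hx => (Finset.mem_filter.1 hx).2.le
        _ ≤ _ := Finset.sum_le_sum_of_subset_of_nonneg (Finset.filter_subset _ _)
            fun _ _ _ => Nat.cast_nonneg _
    have hB : (0 : ℝ) < B.card := by exact_mod_cast h0
    have h2 := h1.trans h
    have : (μ * ((A.filter fun x => μ * B.card < T.codeg b B x).card : ℝ)) * B.card ≤
      (l * A.card) * B.card := by linarith
    exact le_of_mul_le_mul_right this hB

/-- Markov's inequality, when the vertices of the other side have few missing edges. -/
theorem markov_codeg_of_forall (b : Bool) (A B : Finset V) {μ l : ℝ} (hl : 0 ≤ l)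
    (h : ∀ y ∈ B, (T.codeg (!b) A y : ℝ) ≤ l * A.card) :
    μ * ((A.filter fun x => μ * B.card < T.codeg b B x).card : ℝ) ≤ l * A.card := by
  apply T.markov_codeg b A B _ hl
  have := T.sum_codeg b A B
  calc (∑ x ∈ A, (T.codeg b B x : ℝ)) = ∑ y ∈ B, (T.codeg (!b) A y : ℝ) := by exact_mod_cast this
    _ ≤ ∑ y ∈ B, l * A.card := Finset.sum_le_sum h
    _ = _ := by rw [Finset.sum_const, nsmul_eq_mul]; ring

end Degrees

/-- Removing from `A` the vertices that violate one of few conditions, each rarely violated. -/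
theorem _root_.Finset.card_filter_forall_ge {V ι : Type*} (A : Finset V)
    (J : Finset ι) (p : ι → V → Prop) [∀ j, DecidablePred (p j)]
    [DecidablePred fun x => ∀ j ∈ J, p j x] {θ : ℝ}
    (h : ∀ j ∈ J, ((A.filter fun x => ¬ p j x).card : ℝ) ≤ θ) :
    (A.card : ℝ) - J.card * θ ≤ (A.filter fun x => ∀ j ∈ J, p j x).card := by
  classical
  have h1 : A ⊆ (A.filter fun x => ∀ j ∈ J, p j x) ∪ J.biUnion fun j => A.filter fun x => ¬ p j x := by
    intro x hx
    by_cases hp : ∀ j ∈ J, p j x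
    · exact Finset.mem_union_left _ (Finset.mem_filter.2 ⟨hx, hp⟩)
    · push Not at hp
      obtain ⟨j, hj, hpj⟩ := hp
      exact Finset.mem_union_right _ (Finset.mem_biUnion.2 ⟨j, hj, Finset.mem_filter.2 ⟨hx, hpj⟩⟩)
  have h2 := (Finset.card_le_card h1).trans (Finset.card_union_le _ _)
  have h3 : ((J.biUnion fun j => A.filter fun x => ¬ p j x).card : ℝ) ≤ J.card * θ := by
    calc ((J.biUnion fun j => A.filter fun x => ¬ p j x).card : ℝ) ≤
          ((∑ j ∈ J, (A.filter fun x => ¬ p j x).card : ℕ) : ℝ) := by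
            exact_mod_cast Finset.card_biUnion_le
      _ = ∑ j ∈ J, ((A.filter fun x => ¬ p j x).card : ℝ) := by push_cast; rfl
      _ ≤ ∑ j ∈ J, θ := Finset.sum_le_sum h
      _ = _ := by rw [Finset.sum_const, nsmul_eq_mul]
  have h4 : (A.card : ℝ) ≤ ((A.filter fun x => ∀ j ∈ J, p j x).card : ℝ) +
    (J.biUnion fun j => A.filter fun x => ¬ p j x).card := by exact_mod_cast h2
  linarith

section Definable

variable {V : Type*} (T : Tournament V) [DecidableRel T.Adj]

/-- The family `E` of sets, indexed by complexity, is closed under the selection of the vertices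
whose degree to a set of the family `D` is at least, or less than, a given number. -/
structure SelClosed (D E : ℕ → Finset V → Prop) : Prop where
  mono : ∀ r A, E r A → E (r + 1) A
  ge : ∀ r A Z b m, E r A → D r Z → E (r + 1) (A.filter fun x => m ≤ T.deg b Z x)
  lt : ∀ r A Z b m, E r A → D r Z → E (r + 1) (A.filter fun x => T.deg b Z x < m)

variable {T}

theorem SelClosed.mono_le {D E : ℕ → Finset V → Prop} (h : T.SelClosed D E) {r s : ℕ} (hrs : r ≤ s)
    {A : Finset V} (hA : E r A) : E s A := by
  induction hrs with
  | refl => exact hA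
  | step _ ih => exact h.mono _ _ ih

/-- An upper bound on the missing edges is the lower bound `Z.card - ⌊μ * Z.card⌋₊` on the degree,
so the typical vertices form a selection by degree. -/
theorem SelClosed.codeg_le {D E : ℕ → Finset V → Prop} (h : T.SelClosed D E) {r : ℕ}
    {A Z : Finset V} (b : Bool) {μ : ℝ} (hμ : 0 ≤ μ) (hA : E r A) (hZ : D r Z) :
    E (r + 1) (A.filter fun x => (T.codeg b Z x : ℝ) ≤ μ * Z.card) := by
  have := h.ge r A Z b (Z.card - ⌊μ * Z.card⌋₊) hA hZ
  convert this using 2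
  rename_i x _
  have h1 := T.deg_add_codeg b Z x
  rw [← Nat.le_floor_iff (by positivity)]
  omega

/-- Every condition costs one round; the sets `Z j` stay available in later rounds by monotonicity.
-/
theorem SelClosed.trim {D E : ℕ → Finset V → Prop} (h : T.SelClosed D E) (hD : T.SelClosed D D)
    {ι : Type*} {r : ℕ} {A : Finset V} (J : Finset ι) (b : ι → Bool) (Z : ι → Finset V)
    {μ : ι → ℝ} (hμ : ∀ j, 0 ≤ μ j) (hA : E r A) (hZ : ∀ j ∈ J, D r (Z j)) :
    E (r + J.card)
      (A.filter fun x => ∀ j ∈ J, (T.codeg (b j) (Z j) x : ℝ) ≤ μ j * (Z j).card) := by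
  classical
  induction J using Finset.induction_on with
  | empty => simpa using hA
  | insert j J hj ih =>
    have h1 := ih fun i hi => hZ i (Finset.mem_insert_of_mem hi)
    have h2 := h.codeg_le (b j) (hμ j) h1
      (hD.mono_le (Nat.le_add_right _ _) (hZ j (Finset.mem_insert_self _ _)))
    rw [Finset.card_insert_of_notMem hj, ← add_assoc]
    convert h2 using 1
    ext x
    simp only [Finset.mem_filter, Finset.forall_mem_insert]
    tauto

variable (T)

/-- The family of the sets that the algorithm can reach: `D` consists of the definable sets, and
`Tr` of the definable transitive sets, both indexed by complexity. -/
structure DefinableFamily (X : Finset V) (D Tr : ℕ → Finset V → Prop) (R τ : ℕ) (ε : ℝ) :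
    Prop where
  selD : T.SelClosed D D
  selTr : T.SelClosed D Tr
  ofTr : ∀ r A, Tr r A → D r A
  sub : ∀ r A, D r A → A ⊆ X
  single : ∀ x ∈ X, D 0 {x}
  chain : ∀ r A, Tr r A → T.IsChain A
  ext : ∀ r A, D r A → ∃ S ⊆ A, Tr (r + 1) S ∧ (A.card : ℝ) ^ ε ≤ S.card
  bound : ∀ A B, Tr R A → Tr R B → T.Complete A B → A.card + B.card ≤ τ

end Definable

end Tournament

/-! ### Near-complete chains in `H`-free tournaments -/

namespace Tournament

theorem _root_.Finset.exists_card_le_mul_card_filter {V ι : Type*} (A : Finset V)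
    (J : Finset ι) (p : ι → V → Prop) [∀ j, DecidablePred (p j)] (hJ : J.Nonempty)
    (h : ∀ x ∈ A, ∃ j ∈ J, p j x) :
    ∃ j ∈ J, A.card ≤ J.card * (A.filter (p j)).card := by
  classical
  by_contra! hcon
  have h1 : A.card ≤ ∑ j ∈ J, (A.filter (p j)).card := by
    refine (Finset.card_le_card ?_).trans Finset.card_biUnion_le
    intro x hx
    obtain ⟨j, hj, hp⟩ := h x hx
    exact Finset.mem_biUnion.2 ⟨j, hj, Finset.mem_filter.2 ⟨hx, hp⟩⟩
  have h2 : ∑ j ∈ J, J.card * (A.filter (p j)).card < ∑ _j ∈ J, A.card :=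
    Finset.sum_lt_sum_of_nonempty hJ hcon
  rw [← Finset.mul_sum, Finset.sum_const, smul_eq_mul] at h2
  exact absurd h1 (not_le.2 (lt_of_mul_lt_mul_left h2 (Nat.zero_le _)))

variable {V : Type*} {T : Tournament V}

/-- Two distinct vertices of a tournament are joined by exactly one edge, so a map that preserves
edges is injective and also reflects them. Hence all embeddings below only have to preserve edges.
-/
theorem Free.false_of_hom {W : Type*} {H : Tournament W} (hT : T.Free H) (φ : W → V)
    (h : ∀ i j, H.Adj i j → T.Adj (φ i) (φ j)) : False := by
  have hinj : Function.Injective φ := by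
    intro i j hij
    by_contra hne
    rcases H.total i j hne with h1 | h1
    · exact T.ne_of_adj (h _ _ h1) hij
    · exact T.ne_of_adj (h _ _ h1) hij.symm
  refine hT.false ⟨⟨φ, hinj⟩, ?_⟩
  intro i j
  refine ⟨fun hij => ?_, h i j⟩
  by_contra hn
  have hne : i ≠ j := by rintro rfl; exact T.irrefl _ hij
  exact T.asymm _ _ hij (h _ _ (H.adj_of_not_adj hne hn))

variable [DecidableRel T.Adj]

theorem deg_singleton (b : Bool) (v y : V) :
    1 ≤ T.deg b {v} y ↔ T.Dir b y v := by
  unfold deg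
  rw [Finset.filter_singleton]
  split_ifs with h <;> simp [h]

/-- The neighborhood of a vertex is a selection by the degree to a singleton. -/
theorem SelClosed.dir {X : Finset V} {D E : ℕ → Finset V → Prop} (h : T.SelClosed D E)
    (hD : T.SelClosed D D) (hs : ∀ x ∈ X, D 0 {x}) {r : ℕ} {A : Finset V} (hA : E r A) (b : Bool)
    {v : V} (hv : v ∈ X) : E (r + 1) (A.filter (T.Dir b v)) := by
  have := h.ge r A {v} (!b) 1 hA (hD.mono_le (Nat.zero_le _) (hs v hv))
  simpa only [deg_singleton, dir_not] using this

/-- The additional `1` accounts for `x` itself, which may belong to `Z` and has no edge to itself in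
either direction. -/
theorem codeg_not_le (b : Bool) (Z : Finset V) (x : V) : T.codeg (!b) Z x ≤ T.deg b Z x + 1 := by
  classical
  have h : (Z.filter fun z => ¬ T.Dir (!b) x z) ⊆ insert x (Z.filter (T.Dir b x)) := by
    intro z hz
    rw [Finset.mem_filter] at hz
    by_cases hxz : x = z
    · simp [hxz]
    · refine Finset.mem_insert_of_mem (Finset.mem_filter.2 ⟨hz.1, ?_⟩)
      rw [dir_not] at hz
      exact T.dir_total (Ne.symm hxz) hz.2
  exact (Finset.card_le_card h).trans (Finset.card_insert_le _ _)

/-- An `H`-free tournament has a near-complete pair of linear size. -/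
theorem exists_near_pair {h : ℕ} (hh : 0 < h) {H : Tournament (Fin h)} (hfree : T.Free H)
    {X : Finset V} {D : ℕ → Finset V → Prop} (hD : T.SelClosed D D) (hs : ∀ x ∈ X, D 0 {x})
    {r : ℕ} {Y : Finset V} (hYX : Y ⊆ X) (hY : D r Y) {l : ℝ} (hl : 0 < l) (hl1 : l ≤ 1)
    (hbig : 1 ≤ l ^ (h + 1) * Y.card) :
    ∃ A B, A ⊆ Y ∧ B ⊆ Y ∧ D (r + (h + 1)) A ∧ D (r + (h + 1)) B ∧
      l ^ h * Y.card ≤ h * A.card ∧ l ^ h * Y.card ≤ h * B.card ∧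
      (∑ x ∈ A, (T.codeg true B x : ℝ)) ≤ 2 * l * A.card * B.card := by
  classical
  by_contra hcon
  -- Without such a pair `H` embeds greedily: the first `k` vertices are placed by `φ`, and `Z j`
  -- contains the candidates for a later vertex `j` that have the right edges to all vertices placed
  -- so far.
  have key : ∀ k ≤ h, ∃ (φ : Fin h → V) (Z : Fin h → Finset V),
      (∀ j : Fin h, k ≤ j → Z j ⊆ Y ∧ D (r + k) (Z j) ∧ l ^ k * Y.card ≤ (Z j).card ∧
        ∀ i : Fin h, i < k → ∀ y ∈ Z j, T.Dir (decide (H.Adj i j)) (φ i) y) ∧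
      ∀ i j : Fin h, i < k → j < k → H.Adj i j → T.Adj (φ i) (φ j) := by
    intro k
    induction k with
    | zero =>
      intro _
      have hne : Y.Nonempty := by
        rw [← Finset.card_pos, Nat.pos_iff_ne_zero]
        intro h0
        rw [h0] at hbig; simp at hbig; linarith
      exact ⟨fun _ => hne.choose, fun _ => Y, fun j _ => ⟨subset_rfl, hY, by simp, by simp⟩,
        by simp⟩
    | succ k ih =>
      intro hk
      obtain ⟨φ, Z, hZ, hφ⟩ := ih (by omega)
      set i : Fin h := ⟨k, hk⟩ with hi
      obtain ⟨hiY, hiD, hic, hiφ⟩ := hZ i le_rfl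
      have hcard : ∀ j : Fin h, k ≤ j → 1 ≤ l * (Z j).card := by
        intro j hj
        have h1 := (hZ j hj).2.2.1
        have h2 : l ^ (h + 1) ≤ l ^ (k + 1) := pow_le_pow_of_le_one hl.le hl1 (by omega)
        calc (1 : ℝ) ≤ l ^ (h + 1) * Y.card := hbig
          _ ≤ l ^ (k + 1) * Y.card := by gcongr
          _ = l * (l ^ k * Y.card) := by ring
          _ ≤ _ := by gcongr
      -- Either some candidate for `i` leaves the fraction `l` of every later candidate set, or
      -- every candidate fails for some `j`.
      by_cases hv : ∃ v ∈ Z i, ∀ j : Fin h, k < j →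
          l * (Z j).card ≤ T.deg (decide (H.Adj i j)) (Z j) v
      · obtain ⟨v, hvi, hvj⟩ := hv
        have hvX : v ∈ X := hYX (hiY hvi)
        refine ⟨Function.update φ i v,
          fun j => (Z j).filter (T.Dir (decide (H.Adj i j)) v), ?_, ?_⟩
        · intro j hj
          obtain ⟨hjY, hjD, hjc, hjφ⟩ := hZ j (by omega)
          refine ⟨(Finset.filter_subset _ _).trans hjY, ?_, ?_, ?_⟩
          · exact hD.dir hD hs hjD _ hvX
          · have := hvj j (by omega)
            calc l ^ (k + 1) * Y.card = l * (l ^ k * Y.card) := by ring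
              _ ≤ l * (Z j).card := by gcongr
              _ ≤ _ := this
          · intro i' hi' y hy
            rw [Finset.mem_filter] at hy
            by_cases hii : i' = i
            · subst hii; simpa using hy.2
            · rw [Function.update_of_ne hii]
              refine hjφ i' ?_ y hy.1
              have : (i' : ℕ) ≠ k := fun h' => hii (Fin.ext h')
              omega
        · have hlt : ∀ a : Fin h, a < k + 1 → a ≠ i → (a : ℕ) < k := by
            intro a ha hai
            have : (a : ℕ) ≠ k := fun h' => hai (Fin.ext h')
            omega
          intro a b ha hb hab
          by_cases hai : a = i
          · subst hai
            have hbi : b ≠ i := fun h' => H.irrefl _ (h' ▸ hab)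
            have h1 := hiφ b (hlt b hb hbi) v hvi
            have h2 : ¬ H.Adj b i := H.asymm _ _ hab
            rw [Function.update_self, Function.update_of_ne hbi]
            simpa [h2] using h1
          · rw [Function.update_of_ne hai]
            by_cases hbi : b = i
            · subst hbi
              have h1 := hiφ a (hlt a ha hai) v hvi
              rw [Function.update_self]
              simpa [hab] using h1
            · rw [Function.update_of_ne hbi]
              exact hφ a b (hlt a ha hai) (hlt b hb hbi) hab
      · exfalso
        push Not at hv
        have hne : (Z i).Nonempty := by
          rw [← Finset.card_pos, Nat.pos_iff_ne_zero]
          intro h0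
          have := hcard i le_rfl
          rw [h0] at this; simp at this; linarith
        -- A single `j` is responsible for at least the fraction `1 / h` of `Z i`. The ceiling turns
        -- the real threshold into a selection by degree.
        obtain ⟨j, hj, hjA⟩ := Finset.exists_card_le_mul_card_filter (Z i)
          (Finset.univ.filter fun j : Fin h => k < j)
          (fun j v => T.deg (decide (H.Adj i j)) (Z j) v < ⌈l * (Z j).card⌉₊)
          (by
            obtain ⟨v, hv'⟩ := hne
            obtain ⟨j, hj, -⟩ := hv v hv'
            exact ⟨j, by simp [hj]⟩)
          (by
            intro v hv'
            obtain ⟨j, hj, h1⟩ := hv v hv'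
            exact ⟨j, by simp [hj], Nat.lt_ceil.2 h1⟩)
        have hkj : k < (j : ℕ) := (Finset.mem_filter.1 hj).2
        obtain ⟨hjY, hjD, hjc, -⟩ := hZ j hkj.le
        set b := decide (H.Adj i j) with hb
        set A := (Z i).filter fun v => T.deg b (Z j) v < ⌈l * (Z j).card⌉₊ with hA
        have hAD : D (r + (h + 1)) A :=
          hD.mono_le (by omega) (hD.lt _ _ (Z j) b _ hiD hjD)
        have hBD : D (r + (h + 1)) (Z j) := hD.mono_le (by omega) hjD
        have hpow : l ^ h * Y.card ≤ l ^ k * Y.card := by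
          have : l ^ h ≤ l ^ k := pow_le_pow_of_le_one hl.le hl1 (by omega)
          gcongr
        have hcA : l ^ h * Y.card ≤ h * A.card := by
          have h1 : (Z i).card ≤ h * A.card := hjA.trans (Nat.mul_le_mul_right _
            ((Finset.card_le_univ _).trans (by simp)))
          have h2 : ((Z i).card : ℝ) ≤ h * A.card := by exact_mod_cast h1
          linarith
        have hcB : l ^ h * Y.card ≤ h * (Z j).card := by
          have : (1 : ℝ) ≤ h := by exact_mod_cast hh
          nlinarith [Nat.cast_nonneg (α := ℝ) (Z j).card]
        -- The error `1` of `codeg_not_le` is absorbed by `1 ≤ l * (Z j).card`; this explains the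
        -- factor `2`.
        have hcod : ∀ v ∈ A, (T.codeg (!b) (Z j) v : ℝ) ≤ 2 * l * (Z j).card := by
          intro v hv'
          have h1 := Nat.lt_ceil.1 (Finset.mem_filter.1 hv').2
          have h2 : (T.codeg (!b) (Z j) v : ℝ) ≤ T.deg b (Z j) v + 1 := by
            exact_mod_cast codeg_not_le b (Z j) v
          linarith [hcard j hkj.le]
        have hsum : (∑ v ∈ A, (T.codeg (!b) (Z j) v : ℝ)) ≤ 2 * l * A.card * (Z j).card := by
          calc _ ≤ ∑ v ∈ A, 2 * l * ((Z j).card : ℝ) := Finset.sum_le_sum hcod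
            _ = _ := by rw [Finset.sum_const, nsmul_eq_mul]; ring
        apply hcon
        have hAY : A ⊆ Y := (Finset.filter_subset _ _).trans hiY
        -- The direction that is rare from `A` to `Z j` determines which of the two sets comes first
        -- in the pair.
        cases hbb : b with
        | false =>
          rw [hbb] at hsum
          exact ⟨A, Z j, hAY, hjY, hAD, hBD, hcA, hcB, hsum⟩
        | true =>
          rw [hbb] at hsum
          refine ⟨Z j, A, hjY, hAY, hBD, hAD, hcB, hcA, ?_⟩
          have h1 : (∑ x ∈ Z j, (T.codeg true A x : ℝ)) = ∑ v ∈ A, (T.codeg (!true) (Z j) v : ℝ) := by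
            exact_mod_cast T.sum_codeg true (Z j) A
          rw [h1]; linarith
  obtain ⟨φ, Z, -, hφ⟩ := key h le_rfl
  exact hfree.false_of_hom φ fun i j hij => hφ i j i.2 j.2 hij

/-- An `H`-free tournament contains long near-complete chains of sets of linear size. -/
theorem exists_near_chain {h : ℕ} (hh : 0 < h) {H : Tournament (Fin h)} (hfree : T.Free H)
    {X : Finset V} {D : ℕ → Finset V → Prop} (hD : T.SelClosed D D) (hs : ∀ x ∈ X, D 0 {x})
    (a m : ℕ) : ∀ {r : ℕ} {Y : Finset V}, Y ⊆ X → D r Y →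
      (1 : ℝ) ≤ (1 / 2) ^ ((a + 2) * (2 * h + 2) ^ m) * Y.card →
    ∃ B : ℕ → Finset V, (∀ i ≤ m, B i ⊆ Y ∧ D (r + m * (h + 1)) (B i) ∧
        (1 / 2 : ℝ) ^ ((a + 2) * (2 * h + 2) ^ m) * Y.card ≤ (B i).card) ∧
      ∀ i j, i < j → j ≤ m →
        (∑ x ∈ B i, (T.codeg true (B j) x : ℝ)) ≤ (1 / 2) ^ a * (B i).card * (B j).card := by
  induction m with
  | zero =>
    intro r Y _ hY _
    refine ⟨fun _ => Y, fun i _ => ⟨subset_rfl, by simpa using hY, ?_⟩, by omega⟩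
    have : (1 / 2 : ℝ) ^ ((a + 2) * (2 * h + 2) ^ 0) ≤ 1 :=
      pow_le_one₀ (by norm_num) (by norm_num)
    nlinarith [Nat.cast_nonneg (α := ℝ) Y.card]
  | succ m ih =>
    intro r Y hYX hY hbig
    set K := a + 2 with hK
    set E := K * (2 * h + 2) ^ m with hE
    have hE1 : K * (2 * h + 2) ^ (m + 1) = (2 * h + 2) * E := by rw [hE, pow_succ]; ring
    have hKE : K ≤ E := Nat.le_mul_of_pos_right _ (by positivity)
    rw [hE1] at hbig ⊢
    -- The rest of the chain consists of subsets of `B` with at least the fraction `2 ^ (-E)` of its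
    -- vertices. The density `2 * l` of missing edges from `A` to `B` thus grows to at most `2 ^
    -- (-a)` for these subsets.
    set l : ℝ := (1 / 2) ^ (a + E + 1) with hl
    have hY0 : (0 : ℝ) ≤ Y.card := Nat.cast_nonneg _
    have hpow : ∀ {p q : ℕ}, p ≤ q → (1 / 2 : ℝ) ^ q ≤ (1 / 2) ^ p := fun hpq =>
      pow_le_pow_of_le_one (by norm_num) (by norm_num) hpq
    obtain ⟨A, B, hAY, hBY, hA, hB, hcA, hcB, hAB⟩ := exists_near_pair hh hfree hD hs hYX hY
      (l := l) (by positivity) (pow_le_one₀ (by norm_num) (by norm_num)) (by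
        rw [hl, ← pow_mul]
        refine hbig.trans (mul_le_mul_of_nonneg_right (hpow ?_) hY0)
        nlinarith)
    -- The factor `h` in the size bounds of the near-complete pair is replaced by `2 ^ h`, to stay
    -- with powers of two.
    have hhalf : (h : ℝ) * (1 / 2) ^ h ≤ 1 := by
      have : (h : ℝ) ≤ 2 ^ h := by exact_mod_cast Nat.lt_two_pow_self.le
      rw [one_div, inv_pow]
      exact mul_inv_le_one_of_le₀ this (by positivity)
    have hsize : ∀ C : Finset V, l ^ h * Y.card ≤ h * C.card →
        (1 / 2 : ℝ) ^ (h * (K + E)) * Y.card ≤ C.card := by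
      intro C hC
      have h1 : (1 / 2 : ℝ) ^ (h * (K + E)) = (1 / 2) ^ h * l ^ h := by
        rw [hl, ← pow_mul, ← pow_add]; congr 1; rw [hK]; ring
      calc (1 / 2 : ℝ) ^ (h * (K + E)) * Y.card = (1 / 2) ^ h * (l ^ h * Y.card) := by
            rw [h1]; ring
        _ ≤ (1 / 2) ^ h * (h * C.card) := by gcongr
        _ = (h * (1 / 2) ^ h) * C.card := by ring
        _ ≤ 1 * C.card := by gcongr
        _ = _ := one_mul _
    have hsA := hsize A hcA
    have hsB := hsize B hcB
    have hEB : (1 / 2 : ℝ) ^ E * ((1 / 2 : ℝ) ^ (h * (K + E)) * Y.card) ≤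
        (1 / 2 : ℝ) ^ E * B.card := by gcongr
    rw [← mul_assoc, ← pow_add] at hEB
    have hle : (1 / 2 : ℝ) ^ ((2 * h + 2) * E) * Y.card ≤
        (1 / 2 : ℝ) ^ (E + h * (K + E)) * Y.card :=
      mul_le_mul_of_nonneg_right (hpow (by nlinarith)) hY0
    obtain ⟨C, hC, hCC⟩ := ih (hBY.trans hYX) hB (by linarith)
    refine ⟨fun i => if i = 0 then A else C (i - 1), ?_, ?_⟩
    · intro i hi
      rcases Nat.eq_zero_or_pos i with rfl | hi0
      · refine ⟨hAY, hD.mono_le ?_ hA, ?_⟩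
        · nlinarith
        · refine le_trans ?_ hsA
          exact mul_le_mul_of_nonneg_right (hpow (by nlinarith)) hY0
      · obtain ⟨h1, h2, h3⟩ := hC (i - 1) (by omega)
        simp only [hi0.ne', if_false]
        refine ⟨h1.trans hBY, hD.mono_le ?_ h2, by linarith⟩
        nlinarith
    · intro i j hij hj
      have hj0 : j ≠ 0 := by omega
      rcases Nat.eq_zero_or_pos i with rfl | hi0
      · simp only [hj0, if_true, if_false]
        obtain ⟨h1, h2, h3⟩ := hC (j - 1) (by omega)
        calc (∑ x ∈ A, (T.codeg true (C (j - 1)) x : ℝ)) ≤ ∑ x ∈ A, (T.codeg true B x : ℝ) :=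
              Finset.sum_le_sum fun x _ => by exact_mod_cast T.codeg_mono h1 x
          _ ≤ 2 * l * A.card * B.card := hAB
          _ = (1 / 2) ^ a * A.card * ((1 / 2) ^ E * B.card) := by
              rw [hl, pow_add, pow_add]; ring
          _ ≤ _ := by gcongr
      · simp only [hj0, hi0.ne', if_false]
        exact hCC (i - 1) (j - 1) (by omega) (by omega)

end Tournament

/-! ### Transitive tiles -/

namespace Tournament

variable {V : Type*} {T : Tournament V} [DecidableRel T.Adj]

/-- From a near-complete chain of sets one can choose large transitive subsets all of whose vertices
are typical, both for the sets of the chain and for the subsets chosen earlier. -/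
theorem exists_tiles {X : Finset V} {D Tr : ℕ → Finset V → Prop} {R τ : ℕ} {ε : ℝ}
    (hF : T.DefinableFamily X D Tr R τ ε) (hε : 0 ≤ ε) {m r : ℕ} {B : ℕ → Finset V} {l μ γ : ℝ}
    (hl : 0 ≤ l) (hμ : 0 < μ) (hγ : 0 < γ) (hlμ : 4 * m * l ≤ μ) (hμγ : 4 * m * μ ≤ γ)
    (hB : ∀ i < m, D r (B i))
    (hBB : ∀ i j, i < j → j < m →
        (∑ x ∈ B i, (T.codeg true (B j) x : ℝ)) ≤ l * (B i).card * (B j).card) :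
    ∃ S : ℕ → Finset V, ∀ i < m, S i ⊆ B i ∧ Tr (r + m * (2 * m + 1)) (S i) ∧
      (((B i).card : ℝ) / 2) ^ ε ≤ (S i).card ∧
      (∀ j < m, j ≠ i → ∀ x ∈ S i,
        (T.codeg (decide (i < j)) (B j) x : ℝ) ≤ μ * (B j).card) ∧
      ∀ i' < i, ∀ x ∈ S i, (T.codeg false (S i') x : ℝ) ≤ γ * (S i').card := by
  classical
  suffices key : ∀ k ≤ m, ∃ S : ℕ → Finset V, ∀ i < k, S i ⊆ B i ∧ Tr (r + k * (2 * m + 1)) (S i) ∧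
      (((B i).card : ℝ) / 2) ^ ε ≤ (S i).card ∧
      (∀ j < m, j ≠ i → ∀ x ∈ S i,
        (T.codeg (decide (i < j)) (B j) x : ℝ) ≤ μ * (B j).card) ∧
      ∀ i' < i, ∀ x ∈ S i, (T.codeg false (S i') x : ℝ) ≤ γ * (S i').card from key m le_rfl
  intro k
  induction k with
  | zero => exact fun _ => ⟨fun _ => ∅, by simp⟩
  | succ k ih =>
    intro hk
    obtain ⟨S, hS⟩ := ih (by omega)
    have hkm : k < m := by omega
    set r' := r + k * (2 * m + 1) with hr'
    have hBr : ∀ i < m, D r' (B i) := fun i hi => hF.selD.mono_le (Nat.le_add_right _ _) (hB i hi)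
    set N : ℝ := ((B k).card : ℝ) with hN
    have hN0 : 0 ≤ N := Nat.cast_nonneg _
    have hm1 : (1 : ℝ) ≤ m := by exact_mod_cast (by omega : 1 ≤ m)
    set p : ℕ → V → Prop :=
      fun j x => (T.codeg (decide (k < j)) (B j) x : ℝ) ≤ μ * (B j).card with hp
    set q : ℕ → V → Prop := fun i x => (T.codeg false (S i) x : ℝ) ≤ γ * (S i).card with hq
    set B₁ := (B k).filter fun x => ∀ j ∈ (Finset.range m).erase k, p j x with hB₁
    set B₂ := B₁.filter fun x => ∀ i ∈ Finset.range k, q i x with hB₂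
    have hD₁ : D (r' + m) B₁ := by
      have := hF.selD.trim hF.selD (μ := fun _ => μ) ((Finset.range m).erase k)
        (fun j => decide (k < j)) B
        (fun _ => hμ.le) (hBr k hkm) fun j hj => hBr j (by simp at hj; exact hj.2)
      refine hF.selD.mono_le ?_ this
      rw [Finset.card_erase_of_mem (by simpa using hkm), Finset.card_range]; omega
    have hD₂ : D (r' + m + k) B₂ := by
      have := hF.selD.trim hF.selD (μ := fun _ => γ) (Finset.range k) (fun _ => false) S
        (fun _ => hγ.le) hD₁
        fun j hj => hF.selD.mono_le (Nat.le_add_right _ _)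
          (hF.ofTr _ _ (hS j (by simpa using hj)).2.1)
      rwa [Finset.card_range] at this
    -- By Markov's inequality, every other set of the chain excludes at most `(l / μ) * N ≤ N / (4 *
    -- m)` vertices.
    have hc₁ : N - m * (N / (4 * m)) ≤ B₁.card := by
      have h1 := Finset.card_filter_forall_ge (B k) ((Finset.range m).erase k) p
        (θ := N / (4 * m)) (by
          intro j hj
          simp only [Finset.mem_erase, Finset.mem_range] at hj
          have h2 : (∑ x ∈ B k, (T.codeg (decide (k < j)) (B j) x : ℝ)) ≤
              l * (B k).card * (B j).card := by
            rcases lt_or_gt_of_ne hj.1 with h | h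
            · have h3 : (∑ x ∈ B k, (T.codeg false (B j) x : ℝ)) =
                  ∑ x ∈ B j, (T.codeg true (B k) x : ℝ) := by
                exact_mod_cast T.sum_codeg false (B k) (B j)
              have h4 := hBB j k h hkm
              simp only [not_lt.2 h.le, decide_false]
              rw [h3]; linarith
            · simpa [h] using hBB k j h hj.2
          have h3 := T.markov_codeg (μ := μ) _ _ _ h2 hl
          simp only [hp, not_le]
          rw [le_div_iff₀ (by positivity)]
          have h4 : 4 * m * l * N ≤ μ * N := mul_le_mul_of_nonneg_right hlμ hN0
          have h5 := mul_le_mul_of_nonneg_left h3 (by positivity : (0 : ℝ) ≤ 4 * m)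
          refine le_of_mul_le_mul_left ?_ hμ
          linarith)
      have h2 : (((Finset.range m).erase k).card : ℝ) ≤ m := by
        exact_mod_cast (Finset.card_erase_le).trans (by simp)
      have h3 : (((Finset.range m).erase k).card : ℝ) * (N / (4 * m)) ≤ m * (N / (4 * m)) := by
        gcongr
      linarith
    -- The vertices of the earlier tiles miss few vertices of `B k`. Counting the same missing edges
    -- from `B k`, every earlier tile excludes at most `(μ / γ) * N ≤ N / (4 * m)` vertices.
    have hc₂ : (B₁.card : ℝ) - m * (N / (4 * m)) ≤ B₂.card := by
      have h1 := Finset.card_filter_forall_ge B₁ (Finset.range k) q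
        (θ := N / (4 * m)) (by
          intro i hi
          rw [Finset.mem_range] at hi
          have h3 := T.markov_codeg_of_forall (μ := γ) false (B k) (S i) hμ.le (by
            intro y hy
            have := (hS i hi).2.2.2.1 k hkm (by omega) y hy
            simpa [hi] using this)
          have h6 : ((B₁.filter fun x => ¬ q i x).card : ℝ) ≤
              ((B k).filter fun x => γ * (S i).card < T.codeg false (S i) x).card := by
            norm_cast
            apply Finset.card_le_card
            simp only [hq, not_le]
            exact Finset.filter_subset_filter _ (Finset.filter_subset _ _)
          rw [le_div_iff₀ (by positivity)]
          have h4 : 4 * m * μ * N ≤ γ * N := mul_le_mul_of_nonneg_right hμγ hN0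
          have h5 := mul_le_mul_of_nonneg_left h3 (by positivity : (0 : ℝ) ≤ 4 * m)
          have h7 := mul_le_mul_of_nonneg_left h6 (by positivity : (0 : ℝ) ≤ 4 * m * γ)
          refine le_of_mul_le_mul_left ?_ hγ
          linarith)
      have h2 : ((Finset.range k).card : ℝ) ≤ m := by simpa using hkm.le
      have h3 : ((Finset.range k).card : ℝ) * (N / (4 * m)) ≤ m * (N / (4 * m)) := by
        gcongr
      linarith
    have hmN : (m : ℝ) * (N / (4 * m)) = N / 4 := by field_simp
    -- At least half of `B k` is left. Two trimmings with at most `m` conditions each and this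
    -- extraction take at most `2 * m + 1` rounds.
    obtain ⟨A, hAB, hA, hAc⟩ := hF.ext _ _ hD₂
    have hlift : ∀ {s : ℕ} {C : Finset V}, s ≤ r + (k + 1) * (2 * m + 1) → Tr s C →
        Tr (r + (k + 1) * (2 * m + 1)) C := fun hs hC => hF.selTr.mono_le hs hC
    refine ⟨Function.update S k A, ?_⟩
    intro i hi
    rcases Nat.lt_succ_iff_lt_or_eq.1 hi with hik | rfl
    · obtain ⟨h1, h2, h3, h4, h5⟩ := hS i hik
      rw [Function.update_of_ne hik.ne]
      refine ⟨h1, hlift (by rw [hr']; gcongr; omega) h2, h3, h4, ?_⟩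
      intro i' hi'
      rw [Function.update_of_ne (by omega)]
      exact h5 i' hi'
    · rw [Function.update_self]
      refine ⟨hAB.trans ((Finset.filter_subset _ _).trans (Finset.filter_subset _ _)),
        hlift (by rw [hr', add_mul]; omega) hA, ?_, ?_, ?_⟩
      · refine le_trans ?_ hAc
        apply Real.rpow_le_rpow (by positivity) _ hε
        rw [hmN] at hc₁ hc₂
        linarith
      · intro j hj hji x hx
        have := (Finset.mem_filter.1 (Finset.mem_filter.1 (hAB hx)).1).2
        exact this j (by simp [hj, hji])
      · intro i' hi' x hx
        rw [Function.update_of_ne (by omega)]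
        have := (Finset.mem_filter.1 (hAB hx)).2
        exact this i' (by simpa using hi')

end Tournament

/-! ### A Ramsey theorem for transitive tiles -/

namespace Tournament

variable {V : Type*} (T : Tournament V)

/-- No two definable transitive subsets of `A` and `B` that contain at least the fraction `κ` of the
vertices are complete to each other. -/
def Rich (Tr : ℕ → Finset V → Prop) (κ : ℝ) (r : ℕ) (A B : Finset V) : Prop :=
  ∀ W ⊆ A, ∀ U ⊆ B, Tr r W → Tr r U → κ * A.card ≤ W.card → κ * B.card ≤ U.card →
    ¬ T.Complete W U

variable {T}

/-- In the Ramsey argument the first set of a rich pair is final, and only the second one is shrunk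
later. The smaller constant and the larger round number at the start pay for this. -/
theorem Rich.mono {Tr : ℕ → Finset V → Prop} (hTr : ∀ r s A, r ≤ s → Tr r A → Tr s A)
    {κ κ₁ c : ℝ} {r s : ℕ} {A B B' : Finset V}
    (h : T.Rich Tr κ₁ s A B) (hB : B' ⊆ B) (hrs : r ≤ s) (hκ : 0 ≤ κ) (hκκ : κ₁ ≤ κ)
    (hc : c * B.card ≤ B'.card) (hκc : κ₁ ≤ κ * c) : T.Rich Tr κ r A B' := by
  intro W hW U hU hWr hUr hWc hUc
  refine h W hW U (hU.trans hB) (hTr _ _ _ hrs hWr) (hTr _ _ _ hrs hUr) ?_ ?_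
  · exact le_trans (mul_le_mul_of_nonneg_right hκκ (Nat.cast_nonneg _)) hWc
  · calc κ₁ * (B.card : ℝ) ≤ κ * c * B.card :=
          mul_le_mul_of_nonneg_right hκc (Nat.cast_nonneg _)
      _ = κ * (c * B.card) := by ring
      _ ≤ κ * B'.card := by gcongr
      _ ≤ _ := hUc

/-- A set `A` either has a subset that is complete to subsets of many of the sets `S j`, or a
subset that is rich to many of them. -/
theorem exists_complete_or_rich {Tr : ℕ → Finset V → Prop}
    (hTr : ∀ r s A, r ≤ s → Tr r A → Tr s A) {κ : ℝ} (hκ : 0 ≤ κ) (hκ1 : κ ≤ 1) (d n : ℕ)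
    (S : ℕ → Finset V) :
    ∀ (t r : ℕ) (A : Finset V) (J : Finset ℕ), Tr r A → (∀ j ∈ J, Tr r (S j)) →
      t + n ≤ J.card + 1 →
      ∃ r₁ ≤ r + t * d, r ≤ r₁ ∧ ∃ A' ⊆ A, Tr r₁ A' ∧ κ ^ t * A.card ≤ A'.card ∧
        ((∃ J' ⊆ J, J'.card = t ∧ ∃ U : ℕ → Finset V, ∀ j ∈ J', U j ⊆ S j ∧ Tr r₁ (U j) ∧
            κ * (S j).card ≤ (U j).card ∧ T.Complete A' (U j)) ∨
          ∃ J' ⊆ J, J'.card = n ∧ ∀ j ∈ J', T.Rich Tr κ (r₁ + d) A' (S j)) := by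
  intro t
  induction t with
  | zero =>
    intro r A J hA _ _
    exact ⟨r, by simp, le_rfl, A, subset_rfl, hA, by simp, Or.inl ⟨∅, by simp, by simp,
      fun _ => ∅, by simp⟩⟩
  | succ t ih =>
    intro r A J hA hS hJ
    by_cases hall : ∀ j ∈ J, T.Rich Tr κ (r + d) A (S j)
    · obtain ⟨J', hJ', hc⟩ := Finset.exists_subset_card_eq (show n ≤ J.card by omega)
      refine ⟨r, by simp, le_rfl, A, subset_rfl, hA, ?_, Or.inr ⟨J', hJ', hc,
        fun j hj => hall j (hJ' hj)⟩⟩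
      exact mul_le_of_le_one_left (Nat.cast_nonneg _) (pow_le_one₀ hκ hκ1)
    -- A failure of richness for `j` provides subsets that are complete: `A` shrinks to `W`, `U` is
    -- kept for `j`, and `j` is removed from `J`. After `t` failures the remaining part of `A` is
    -- complete to `t` sets.
    · simp only [Rich] at hall
      push Not at hall
      obtain ⟨j, hj, W, hWA, U, hUS, hW, hU, hWc, hUc, hWU⟩ := hall
      have hJc := Finset.card_erase_of_mem hj
      obtain ⟨r₁, hr₁, hrr, A', hA', hA'r, hA'c, hor⟩ := ih (r + d) W (J.erase j) hW
        (fun i hi => hTr _ _ _ (Nat.le_add_right _ _) (hS i (Finset.mem_of_mem_erase hi)))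
        (by omega)
      refine ⟨r₁, ?_, by omega, A', hA'.trans hWA, hA'r, ?_, ?_⟩
      · rw [add_mul]; omega
      · calc κ ^ (t + 1) * (A.card : ℝ) = κ ^ t * (κ * A.card) := by ring
          _ ≤ κ ^ t * W.card := by gcongr
          _ ≤ _ := hA'c
      · rcases hor with ⟨J', hJ', hJ'c, U', hU'⟩ | ⟨J', hJ', hJ'c, hR⟩
        · left
          have hjJ : j ∉ J' := fun h => (Finset.mem_erase.1 (hJ' h)).1 rfl
          refine ⟨insert j J', ?_, by rw [Finset.card_insert_of_notMem hjJ, hJ'c],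
            Function.update U' j U, ?_⟩
          · exact Finset.insert_subset hj (hJ'.trans (Finset.erase_subset _ _))
          · intro i hi
            by_cases hij : i = j
            · subst hij
              rw [Function.update_self]
              exact ⟨hUS, hTr _ _ _ hrr hU, hUc, hWU.mono T hA' subset_rfl⟩
            · rw [Function.update_of_ne hij]
              exact hU' i ((Finset.mem_insert.1 hi).resolve_left hij)
        · exact Or.inr ⟨J', hJ'.trans (Finset.erase_subset _ _), hJ'c, hR⟩

/-- The recursion for the loss in `ramsey_tiles`: with `X = 2 ^ (q + 1) ^ 2` for the smaller case,
up to `2 ^ q` failures of richness cost the exponent `X + 1` each, and the smaller case costs `X`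
more. The same count bounds the rounds, in units of `d`. -/
theorem exponent_bound (q : ℕ) :
    (2 ^ (q + 1) ^ 2 + 1) * 2 ^ q + 2 ^ (q + 1) ^ 2 ≤ 2 ^ (q + 2) ^ 2 := by
  have h1 : (2 : ℕ) ^ (q + 2) ^ 2 = 2 ^ (q + 1) ^ 2 * (2 ^ q * 2 ^ (q + 3)) := by
    rw [← pow_add, ← pow_add]; congr 1; ring
  have h2 : 2 ^ (q + 3) = 8 * 2 ^ q := by rw [pow_add]; ring
  rw [h1, h2]
  have h3 : 1 ≤ 2 ^ q := Nat.one_le_two_pow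
  have h4 : 1 ≤ 2 ^ (q + 1) ^ 2 := Nat.one_le_two_pow
  generalize 2 ^ (q + 1) ^ 2 = x at *
  generalize 2 ^ q = y at *
  nlinarith [Nat.mul_le_mul h4 h3, Nat.mul_le_mul (Nat.mul_le_mul h4 h3) h3]

/-- Among `2 ^ (p + k)` transitive sets one finds, after passing to large definable subsets, either
`p` sets that are pairwise complete, or `k` sets that are pairwise rich. -/
theorem ramsey_tiles {Tr : ℕ → Finset V → Prop}
    (hTr : ∀ r s A, r ≤ s → Tr r A → Tr s A) {κ : ℝ} (hκ : 0 < κ) (hκ1 : κ ≤ 1) (d : ℕ)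
    (q : ℕ) : ∀ (p k : ℕ), p + k = q → ∀ (r : ℕ) (I : Finset ℕ) (S : ℕ → Finset V),
      2 ^ q ≤ I.card → (∀ i ∈ I, Tr r (S i)) →
      ∃ r' ≤ r + d * 2 ^ (q + 1) ^ 2, r ≤ r' ∧ ∃ S' : ℕ → Finset V,
        (∀ i ∈ I, S' i ⊆ S i ∧ Tr r' (S' i) ∧
          κ ^ 2 ^ (q + 1) ^ 2 * (S i).card ≤ (S' i).card) ∧
        ((∃ J ⊆ I, J.card = p ∧ ∀ i ∈ J, ∀ j ∈ J, i < j → T.Complete (S' i) (S' j)) ∨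
          ∃ J ⊆ I, J.card = k ∧ ∀ i ∈ J, ∀ j ∈ J, i < j → T.Rich Tr κ (r' + d) (S' i) (S' j)) := by
  classical
  have hpow : ∀ {a b : ℕ}, a ≤ b → κ ^ b ≤ κ ^ a := fun h => pow_le_pow_of_le_one hκ.le hκ1 h
  have htriv : ∀ (r n : ℕ) (I : Finset ℕ) (S : ℕ → Finset V), (∀ i ∈ I, Tr r (S i)) →
      ∀ i ∈ I, S i ⊆ S i ∧ Tr r (S i) ∧ κ ^ n * (S i).card ≤ (S i).card := fun r n I S hS i hi =>
    ⟨subset_rfl, hS i hi, mul_le_of_le_one_left (Nat.cast_nonneg _) (pow_le_one₀ hκ.le hκ1)⟩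
  induction q with
  | zero =>
    intro p k hpk r I S _ hS
    exact ⟨r, by simp, le_rfl, S, htriv r _ I S hS, Or.inl ⟨∅, by simp, by simp; omega, by simp⟩⟩
  | succ q ih =>
    intro p k hpk r I S hI hS
    rcases Nat.eq_zero_or_pos p with rfl | hp
    · exact ⟨r, by simp, le_rfl, S, htriv r _ I S hS, Or.inl ⟨∅, by simp, by simp, by simp⟩⟩
    rcases Nat.eq_zero_or_pos k with rfl | hk
    · exact ⟨r, by simp, le_rfl, S, htriv r _ I S hS, Or.inr ⟨∅, by simp, by simp, by simp⟩⟩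
    set X := 2 ^ (q + 1) ^ 2 with hX
    -- Richness is required with a smaller constant, since the second sets still lose the factor `κ
    -- ^ X` in the induction; richness with the constant `κ` survives.
    set κ₁ := κ * κ ^ X with hκ₁
    have hκ₁' : κ₁ = κ ^ (X + 1) := by rw [hκ₁, pow_succ, mul_comm]
    have hκ₁0 : 0 ≤ κ₁ := by positivity
    have hκ₁κ : κ₁ ≤ κ := mul_le_of_le_one_right hκ.le (pow_le_one₀ hκ.le hκ1)
    have hexp := exponent_bound q
    rw [← hX] at hexp
    set X' := 2 ^ (q + 1 + 1) ^ 2 with hX'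
    have hexp' : (X + 1) * 2 ^ q + X ≤ X' := hexp
    have h2q : 1 ≤ 2 ^ q := Nat.one_le_two_pow
    have hIne : I.Nonempty := by
      rw [← Finset.card_pos]; exact lt_of_lt_of_le (by positivity) hI
    -- The first tile is compared with the later ones, so that completeness and richness always
    -- concern forward edges.
    set i₀ := I.min' hIne with hi₀
    have hi₀I : i₀ ∈ I := Finset.min'_mem _ _
    have hlt : ∀ j ∈ I.erase i₀, i₀ < j := fun j hj =>
      lt_of_le_of_ne (Finset.min'_le _ _ (Finset.mem_of_mem_erase hj))
        (Finset.ne_of_mem_erase hj).symm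
    obtain ⟨r₁, hr₁, hrr, A, hAS, hA, hAc, hor⟩ := exists_complete_or_rich (T := T) hTr hκ₁0
      (hκ₁κ.trans hκ1) (d * X + d) (2 ^ q) S (2 ^ q) r (S i₀) (I.erase i₀) (hS _ hi₀I)
      (fun j hj => hS j (Finset.mem_of_mem_erase hj)) (by
        rw [Finset.card_erase_of_mem hi₀I]; rw [pow_succ] at hI; omega)
    have hA' : κ ^ X' * (S i₀).card ≤ A.card := by
      refine le_trans (mul_le_mul_of_nonneg_right ?_ (Nat.cast_nonneg _)) hAc
      rw [hκ₁', ← pow_mul]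
      exact hpow (le_trans (Nat.le_add_right _ _) hexp')
    have hr₂ : ∀ r₂ ≤ r₁ + d * X, r₂ ≤ r + d * X' := by
      intro r₂ hr₂
      have : d * ((X + 1) * 2 ^ q + X) ≤ d * X' := Nat.mul_le_mul_left _ hexp'
      have h3 : 2 ^ q * (d * X + d) = d * ((X + 1) * 2 ^ q) := by ring
      rw [mul_add] at this
      omega
    -- In the complete case `i₀` extends a family of `p - 1` complete tiles, in the rich case a
    -- family of `k - 1` rich tiles.
    rcases hor with ⟨J, hJ, hJc, U, hU⟩ | ⟨J, hJ, hJc, hR⟩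
    · obtain ⟨r', hr', hrr', S', hS', hor'⟩ := ih (p - 1) k (by omega) r₁ J U hJc.ge
        fun j hj => (hU j hj).2.1
      have hi₀J : i₀ ∉ J := fun h => (Finset.mem_erase.1 (hJ h)).1 rfl
      set S'' : ℕ → Finset V := fun i => if i = i₀ then A else if i ∈ J then S' i else S i with hS''
      have hS''J : ∀ i ∈ J, S'' i = S' i := fun i hi => by
        have : i ≠ i₀ := fun h => hi₀J (h ▸ hi)
        simp [hS'', this, hi]
      have hS''0 : S'' i₀ = A := by simp [hS'']
      refine ⟨r', hr₂ _ hr', hrr.trans hrr', S'', ?_, ?_⟩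
      · intro i hi
        by_cases h0 : i = i₀
        · subst h0
          rw [hS''0]
          exact ⟨hAS, hTr _ _ _ hrr' hA, hA'⟩
        · by_cases hiJ : i ∈ J
          · rw [hS''J i hiJ]
            obtain ⟨h1, h2, h3⟩ := hS' i hiJ
            obtain ⟨h4, -, h5, -⟩ := hU i hiJ
            refine ⟨h1.trans h4, h2, ?_⟩
            calc κ ^ X' * ((S i).card : ℝ) ≤ κ ^ (X + (X + 1)) * (S i).card :=
                  mul_le_mul_of_nonneg_right (hpow (by nlinarith)) (Nat.cast_nonneg _)
              _ = κ ^ X * (κ₁ * (S i).card) := by rw [hκ₁', pow_add]; ring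
              _ ≤ κ ^ X * (U i).card := by gcongr
              _ ≤ _ := h3
          · simp only [hS'', h0, hiJ, if_false]
            exact htriv r' _ {i} S (fun j hj => by
              rw [Finset.mem_singleton] at hj; subst hj
              exact hTr _ _ _ (hrr.trans hrr') (hS _ hi)) i (by simp)
      · have hJI : J ⊆ I := hJ.trans (Finset.erase_subset _ _)
        rcases hor' with ⟨K, hK, hKc, hC⟩ | ⟨K, hK, hKc, hC⟩
        · left
          have hi₀K : i₀ ∉ K := fun h => hi₀J (hK h)
          refine ⟨insert i₀ K, Finset.insert_subset hi₀I (hK.trans hJI),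
            by rw [Finset.card_insert_of_notMem hi₀K]; omega, ?_⟩
          intro i hi j hj hij
          rw [Finset.mem_insert] at hi hj
          rcases hj with rfl | hj
          · rcases hi with rfl | hi
            · exact absurd hij (lt_irrefl _)
            · exact absurd hij (hlt i (hJ (hK hi))).le.not_gt
          · rw [hS''J j (hK hj)]
            rcases hi with rfl | hi
            · rw [hS''0]
              exact (hU j (hK hj)).2.2.2.mono T subset_rfl (hS' j (hK hj)).1
            · rw [hS''J i (hK hi)]
              exact hC i hi j hj hij
        · right
          refine ⟨K, hK.trans hJI, hKc, ?_⟩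
          intro i hi j hj hij
          rw [hS''J i (hK hi), hS''J j (hK hj)]
          exact hC i hi j hj hij
    · obtain ⟨r', hr', hrr', S', hS', hor'⟩ := ih p (k - 1) (by omega) r₁ J S hJc.ge
        fun j hj => hTr _ _ _ hrr (hS j (Finset.mem_of_mem_erase (hJ hj)))
      have hi₀J : i₀ ∉ J := fun h => (Finset.mem_erase.1 (hJ h)).1 rfl
      set S'' : ℕ → Finset V := fun i => if i = i₀ then A else if i ∈ J then S' i else S i with hS''
      have hS''J : ∀ i ∈ J, S'' i = S' i := fun i hi => by
        have : i ≠ i₀ := fun h => hi₀J (h ▸ hi)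
        simp [hS'', this, hi]
      have hS''0 : S'' i₀ = A := by simp [hS'']
      refine ⟨r', hr₂ _ hr', hrr.trans hrr', S'', ?_, ?_⟩
      · intro i hi
        by_cases h0 : i = i₀
        · subst h0
          rw [hS''0]
          exact ⟨hAS, hTr _ _ _ hrr' hA, hA'⟩
        · by_cases hiJ : i ∈ J
          · rw [hS''J i hiJ]
            obtain ⟨h1, h2, h3⟩ := hS' i hiJ
            refine ⟨h1, h2, le_trans ?_ h3⟩
            exact mul_le_mul_of_nonneg_right (hpow (by nlinarith)) (Nat.cast_nonneg _)
          · simp only [hS'', h0, hiJ, if_false]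
            exact htriv r' _ {i} S (fun j hj => by
              rw [Finset.mem_singleton] at hj; subst hj
              exact hTr _ _ _ (hrr.trans hrr') (hS _ hi)) i (by simp)
      · have hJI : J ⊆ I := hJ.trans (Finset.erase_subset _ _)
        rcases hor' with ⟨K, hK, hKc, hC⟩ | ⟨K, hK, hKc, hC⟩
        · left
          refine ⟨K, hK.trans hJI, hKc, ?_⟩
          intro i hi j hj hij
          rw [hS''J i (hK hi), hS''J j (hK hj)]
          exact hC i hi j hj hij
        · right
          have hi₀K : i₀ ∉ K := fun h => hi₀J (hK h)
          refine ⟨insert i₀ K, Finset.insert_subset hi₀I (hK.trans hJI),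
            by rw [Finset.card_insert_of_notMem hi₀K]; omega, ?_⟩
          intro i hi j hj hij
          rw [Finset.mem_insert] at hi hj
          rcases hj with rfl | hj
          · rcases hi with rfl | hi
            · exact absurd hij (lt_irrefl _)
            · exact absurd hij (hlt i (hJ (hK hi))).le.not_gt
          · rw [hS''J j (hK hj)]
            rcases hi with rfl | hi
            · rw [hS''0]
              exact (hR j (hK hj)).mono hTr (hS' j (hK hj)).1 (by omega) hκ.le hκ₁κ
                (hS' j (hK hj)).2.2 le_rfl
            · rw [hS''J i (hK hi)]
              exact hC i hi j hj hij

end Tournament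

/-! ### Embedding stars greedily -/

namespace Tournament

/-- The backward edges of `G`, under the natural ordering of its vertices, form stars: `ctr` sends
every leaf to the center of its star. The vertices are split into consecutive parts in such a
way that the leaves of a star are in the same part, and its center is in another one. -/
structure IsStarData {h : ℕ} (G : Tournament (Fin h)) (ctr : Fin h → Option (Fin h))
    (part : Fin h → Fin h) : Prop where
  back : ∀ i j, i < j → (G.Adj j i ↔ ctr i = some j ∨ ctr j = some i)
  center : ∀ i c, ctr i = some c → ctr c = none
  mono : Monotone part
  part_ne : ∀ i c, ctr i = some c → part i ≠ part c
  part_eq : ∀ i j c, ctr i = some c → ctr j = some c → part i = part j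

variable {V : Type*} {T : Tournament V} [DecidableRel T.Adj]

theorem card_le_card_filter_add_codeg (b : Bool) (Z : Finset V) (x : V) :
    Z.card ≤ (Z.filter (T.Dir b x)).card + T.codeg b Z x := (T.deg_add_codeg b Z x).ge

theorem deg_lt_one {b : Bool} {Z : Finset V} {x : V} :
    T.deg b Z x < 1 ↔ ∀ z ∈ Z, ¬ T.Dir b x z := by
  rw [Nat.lt_one_iff]
  simp [deg, Finset.filter_eq_empty_iff]

theorem card_le_deg {b : Bool} {Z : Finset V} {x : V} :
    Z.card ≤ T.deg b Z x ↔ ∀ z ∈ Z, T.Dir b x z := by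
  rw [← codeg_eq_zero, ← T.deg_add_codeg b Z x]
  omega

/-- If no edge of one direction leads from `W` to `Z`, then all but at most one vertex of `Z` have
all edges of this direction to `W`. -/
theorem card_le_card_filter_add_one (b : Bool) {W Z : Finset V}
    (h : ∀ x ∈ W, T.deg b Z x < 1) :
    Z.card ≤ (Z.filter fun a => W.card ≤ T.deg b W a).card + 1 := by
  classical
  simp only [deg_lt_one] at h
  rw [← Finset.card_filter_add_card_filter_not (s := Z) (fun a => W.card ≤ T.deg b W a)]
  apply Nat.add_le_add_left
  have hmem : ∀ a ∈ Z.filter (fun a => ¬ W.card ≤ T.deg b W a), a ∈ Z ∧ a ∈ W := by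
    intro a ha
    rw [Finset.mem_filter, card_le_deg] at ha
    refine ⟨ha.1, ?_⟩
    have h2 := ha.2
    push Not at h2
    obtain ⟨x, hx, hax⟩ := h2
    by_contra haW
    have hne : a ≠ x := fun h' => haW (h' ▸ hx)
    exact h x hx a ha.1 (T.dir_total hne hax)
  rw [Finset.card_le_one]
  intro a ha a' ha'
  by_contra hne
  by_cases hd : T.Dir b a a'
  · exact h a (hmem a ha).2 a' (hmem a' ha').1 hd
  · exact h a' (hmem a' ha').2 a (hmem a ha).1 (T.dir_total hne hd)

theorem IsStarData.adj_iff_lt {h : ℕ} {G : Tournament (Fin h)} {ctr : Fin h → Option (Fin h)}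
    {part : Fin h → Fin h} (hG : G.IsStarData ctr part) {u v : Fin h} (hne : u ≠ v)
    (h1 : ctr u ≠ some v) (h2 : ctr v ≠ some u) : G.Adj u v ↔ u < v := by
  rcases lt_or_gt_of_ne hne with hlt | hlt
  · refine ⟨fun _ => hlt, fun _ => G.adj_of_not_adj hne.symm fun h => ?_⟩
    exact ((hG.back u v hlt).1 h).elim h1 h2
  · refine ⟨fun h => ?_, fun h => absurd h hlt.not_gt⟩
    exact (((hG.back v u hlt).1 h).elim h2 h1).elim

/-- The greedy embedding of a tournament whose backward edges form stars, star by star. Here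
`Big t v Z` expresses that `Z` is a large set of candidates for the vertex `v`, when `t` vertices
have been embedded. -/
theorem IsStarData.exists_hom {h : ℕ} {G : Tournament (Fin h)} {ctr : Fin h → Option (Fin h)}
    {part : Fin h → Fin h} (hG : G.IsStarData ctr part) [Nonempty V] (Q : Fin h → Finset V)
    (Big : ℕ → Fin h → Finset V → Prop) (hQ : ∀ t v Z, Big t v Z → Z ⊆ Q v)
    (hne : ∀ t ≤ h, ∀ v Z, Big t v Z → Z.Nonempty) (h0 : ∀ v, Big 0 v (Q v))
    (hrestr : ∀ t v w x Z, v ≠ w → x ∈ Q v → Big t w Z →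
      Big (t + 1) w (Z.filter (T.Dir (decide (v < w)) x)))
    (hsame : ∀ l l' c, ctr l = some c → ctr l' = some c → l < l' → T.Complete (Q l) (Q l'))
    (hstar : ∀ t ≤ h, ∀ c l Zc Zl, ctr l = some c → Big t c Zc → Big t l Zl →
      Zc.card ≤ h * (Zc.filter fun b => T.deg (decide (l < c)) Zl b < 1).card → False) :
    ∃ φ : Fin h → V, ∀ i j, G.Adj i j → T.Adj (φ i) (φ j) := by
  classical
  let star : Fin h → Finset (Fin h) := fun c => Finset.univ.filter fun v => v = c ∨ ctr v = some c
  have hstarmem : ∀ c v, v ∈ star c ↔ v = c ∨ ctr v = some c := by simp [star]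
  -- a good choice for one star
  have choose_star : ∀ t ≤ h, ∀ c (Z : Fin h → Finset V), ctr c = none →
      (∀ v ∈ star c, Big t v (Z v)) → ∃ ψ : Fin h → V, (∀ v ∈ star c, ψ v ∈ Z v) ∧
        ∀ l, ctr l = some c → T.Dir (decide (l < c)) (ψ c) (ψ l) := by
    intro t ht c Z hc hZ
    have hcc : c ∈ star c := (hstarmem _ _).2 (Or.inl rfl)
    -- It suffices to find a center with a suitable neighbor for every leaf: the leaves can then be
    -- chosen independently, because `hsame` takes care of the edges between them.
    have : ∃ b ∈ Z c, ∀ l, ctr l = some c → ∃ x ∈ Z l, T.Dir (decide (l < c)) b x := by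
      by_contra hcon
      push Not at hcon
      have hbad : ∀ b ∈ Z c, ∃ l ∈ Finset.univ.filter (fun l => ctr l = some c),
          T.deg (decide (l < c)) (Z l) b < 1 := by
        intro b hb
        obtain ⟨l, hl, hx⟩ := hcon b hb
        exact ⟨l, by simpa using hl, deg_lt_one.2 hx⟩
      obtain ⟨b, hb⟩ := hne t ht c _ (hZ c hcc)
      obtain ⟨l, hl, hlc⟩ := Finset.exists_card_le_mul_card_filter (Z c) _ _
        (by obtain ⟨l, hl, -⟩ := hbad b hb; exact ⟨l, hl⟩) hbad
      rw [Finset.mem_filter] at hl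
      refine hstar t ht c l (Z c) (Z l) hl.2 (hZ c hcc) (hZ l ((hstarmem _ _).2 (Or.inr hl.2))) ?_
      exact hlc.trans (Nat.mul_le_mul_right _ ((Finset.card_le_univ _).trans (by simp)))
    obtain ⟨b, hb, hx⟩ := this
    choose! x hx hbx using hx
    refine ⟨Function.update x c b, ?_, ?_⟩
    · intro v hv
      by_cases hvc : v = c
      · subst hvc; simpa using hb
      · rw [Function.update_of_ne hvc]
        exact hx v (((hstarmem _ _).1 hv).resolve_left hvc)
    · intro l hl
      have hlc : l ≠ c := by rintro rfl; rw [hc] at hl; exact absurd hl (by simp)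
      rw [Function.update_self, Function.update_of_ne hlc]
      exact hbx l hl
  -- restricting the candidates
  have restrict : ∀ (E : Finset (Fin h)) (ψ : Fin h → V) t w Z, (∀ u ∈ E, ψ u ∈ Q u) → w ∉ E →
      Big t w Z → Big (t + E.card) w (Z.filter fun y => ∀ u ∈ E, T.Dir (decide (u < w)) (ψ u) y) := by
    intro E ψ t w Z hE hw hZ
    induction E using Finset.induction_on with
    | empty => simpa using hZ
    | insert u E hu ih =>
      have h1 := ih (fun v hv => hE v (Finset.mem_insert_of_mem hv))
        fun hv => hw (Finset.mem_insert_of_mem hv)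
      have h2 := hrestr _ u w (ψ u) _ (fun h' => hw (h' ▸ Finset.mem_insert_self _ _))
        (hE u (Finset.mem_insert_self _ _)) h1
      rw [Finset.card_insert_of_notMem hu, ← add_assoc]
      convert h2 using 1
      ext y
      simp only [Finset.mem_filter, Finset.forall_mem_insert]
      tauto
  -- Whole stars are embedded one by one, `C` being the set of their centers. The sets `Z v` contain
  -- the candidates compatible with everything embedded so far.
  have key : ∀ C : Finset (Fin h), (∀ c ∈ C, ctr c = none) →
      ∃ (φ : Fin h → V) (Z : Fin h → Finset V),
        (∀ v ∉ C.biUnion star, Big (C.biUnion star).card v (Z v) ∧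
          ∀ u ∈ C.biUnion star, ∀ y ∈ Z v, T.Dir (decide (u < v)) (φ u) y) ∧
        ∀ u ∈ C.biUnion star, ∀ v ∈ C.biUnion star, G.Adj u v → T.Adj (φ u) (φ v) := by
    intro C
    induction C using Finset.induction_on with
    | empty => exact fun _ => ⟨fun _ => Classical.arbitrary V, Q, by simpa using h0, by simp⟩
    | insert c C hcC ih =>
      intro hC
      obtain ⟨φ, Z, hZ, hφ⟩ := ih fun a ha => hC a (Finset.mem_insert_of_mem ha)
      have hc := hC c (Finset.mem_insert_self _ _)
      set P := C.biUnion star with hP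
      have hmemP : ∀ v, v ∈ P ↔ v ∈ C ∨ ∃ a ∈ C, ctr v = some a := by
        intro v
        simp only [hP, Finset.mem_biUnion, hstarmem]
        constructor
        · rintro ⟨a, ha, rfl | h'⟩
          · exact Or.inl ha
          · exact Or.inr ⟨a, ha, h'⟩
        · rintro (h' | ⟨a, ha, h'⟩)
          · exact ⟨v, h', Or.inl rfl⟩
          · exact ⟨a, ha, Or.inr h'⟩
      have hdisj : ∀ v ∈ star c, v ∉ P := by
        intro v hv hvP
        rw [hmemP] at hvP
        rcases (hstarmem _ _).1 hv with rfl | hv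
        · rcases hvP with h' | ⟨a, ha, h'⟩
          · exact hcC h'
          · rw [hc] at h'; exact absurd h' (by simp)
        · rcases hvP with h' | ⟨a, ha, h'⟩
          · have := hC v (Finset.mem_insert_of_mem h')
            rw [hv] at this; exact absurd this (by simp)
          · rw [hv, Option.some.injEq] at h'
            exact hcC (h' ▸ ha)
      have hPh : P.card ≤ h := (Finset.card_le_univ _).trans (by simp)
      obtain ⟨ψ, hψZ, hψ⟩ := choose_star P.card hPh c Z hc fun v hv => (hZ v (hdisj v hv)).1
      have hψQ : ∀ u ∈ star c, ψ u ∈ Q u := fun u hu =>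
        hQ _ _ _ (hZ u (hdisj u hu)).1 (hψZ u hu)
      have hbi : (insert c C).biUnion star = P ∪ star c := by
        rw [Finset.biUnion_insert, Finset.union_comm]
      have hcard : (P ∪ star c).card = P.card + (star c).card :=
        Finset.card_union_of_disjoint (Finset.disjoint_left.2 fun v hv hv' => hdisj v hv' hv)
      rw [hbi, hcard]
      refine ⟨fun v => if v ∈ star c then ψ v else φ v,
        fun v => (Z v).filter fun y => ∀ u ∈ star c, T.Dir (decide (u < v)) (ψ u) y, ?_, ?_⟩
      · intro v hv
        rw [Finset.mem_union, not_or] at hv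
        refine ⟨restrict _ ψ _ v _ hψQ hv.2 (hZ v hv.1).1, ?_⟩
        intro u hu y hy
        rw [Finset.mem_filter] at hy
        by_cases hus : u ∈ star c
        · simpa only [hus, if_true] using hy.2 u hus
        · simp only [hus, if_false]
          exact (hZ v hv.1).2 u ((Finset.mem_union.1 hu).resolve_right hus) y hy.1
      -- Edges between different stars go forward, and restricting the candidates has already
      -- guaranteed this for the images.
      · have hcross : ∀ u ∈ P, ∀ v ∈ star c, T.Dir (decide (u < v)) (φ u) (ψ v) ∧ u ≠ v ∧
            (G.Adj u v ↔ u < v) ∧ (G.Adj v u ↔ v < u) := by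
          intro u hu v hv
          have hvP := hdisj v hv
          have hne : u ≠ v := fun h' => hvP (h' ▸ hu)
          have h1 : ctr u ≠ some v := by
            intro h'
            rcases (hmemP u).1 hu with h'' | ⟨a, ha, h''⟩
            · rw [hC u (Finset.mem_insert_of_mem h'')] at h'; exact absurd h' (by simp)
            · rw [h', Option.some.injEq] at h''
              exact hvP ((hmemP v).2 (Or.inl (h'' ▸ ha)))
          have h2 : ctr v ≠ some u := by
            intro h'
            rcases (hstarmem _ _).1 hv with rfl | h''
            · rw [hc] at h'; exact absurd h' (by simp)
            · rw [h'', Option.some.injEq] at h'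
              subst h'
              exact hdisj c ((hstarmem _ _).2 (Or.inl rfl)) hu
          exact ⟨(hZ v hvP).2 u hu _ (hψZ v hv), hne, hG.adj_iff_lt hne h1 h2,
            hG.adj_iff_lt hne.symm h2 h1⟩
        intro u hu v hv huv
        have huv' : u ≠ v := G.ne_of_adj huv
        by_cases hus : u ∈ star c <;> by_cases hvs : v ∈ star c
        · simp only [hus, hvs, if_true]
          rcases (hstarmem _ _).1 hus with rfl | hul
          · have hvl := ((hstarmem _ _).1 hvs).resolve_left huv'.symm
            have hlt : v < u := by
              rcases lt_or_gt_of_ne huv' with h' | h'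
              · exact absurd huv (G.asymm _ _ ((hG.back u v h').2 (Or.inr hvl)))
              · exact h'
            simpa [hlt] using hψ v hvl
          · rcases (hstarmem _ _).1 hvs with rfl | hvl
            · have hlt : ¬ u < v := fun h' =>
                G.asymm _ _ huv ((hG.back u v h').2 (Or.inl hul))
              simpa [hlt] using hψ u hul
            · have h1 : ctr u ≠ some v := by
                rw [hul]; intro h'
                rw [Option.some.injEq] at h'; subst h'
                rw [hc] at hvl; exact absurd hvl (by simp)
              have h2 : ctr v ≠ some u := by
                rw [hvl]; intro h'
                rw [Option.some.injEq] at h'; subst h'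
                rw [hc] at hul; exact absurd hul (by simp)
              have hlt := (hG.adj_iff_lt huv' h1 h2).1 huv
              exact hsame u v c hul hvl hlt _ (hψQ u hus) _ (hψQ v hvs)
        · have hvP := (Finset.mem_union.1 hv).resolve_right hvs
          obtain ⟨h1, -, -, h4⟩ := hcross v hvP u hus
          simp only [hus, hvs, if_true, if_false]
          have h6 : ¬ v < u := fun h' => G.asymm _ _ huv ((hcross v hvP u hus).2.2.1.2 h')
          simpa [h6] using h1
        · have huP := (Finset.mem_union.1 hu).resolve_right hus
          obtain ⟨h1, -, h3, -⟩ := hcross u huP v hvs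
          simp only [hus, hvs, if_true, if_false]
          simpa [h3.1 huv] using h1
        · simp only [hus, hvs, if_false]
          exact hφ u ((Finset.mem_union.1 hu).resolve_right hus) v
            ((Finset.mem_union.1 hv).resolve_right hvs) huv
  obtain ⟨φ, Z, -, hφ⟩ := key (Finset.univ.filter fun c => ctr c = none) (by simp)
  refine ⟨φ, fun i j hij => ?_⟩
  -- Vertices on no backward edge count as centers of stars without leaves.
  have hall : ∀ v, v ∈ (Finset.univ.filter fun c => ctr c = none).biUnion star := by
    intro v
    rw [Finset.mem_biUnion]
    rcases hv : ctr v with _ | c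
    · exact ⟨v, by simpa using hv, (hstarmem _ _).2 (Or.inl rfl)⟩
    · exact ⟨c, by simpa using hG.center v c hv, (hstarmem _ _).2 (Or.inr hv)⟩
  exact hφ i (hall i) j (hall j) hij

end Tournament

/-! ### Embedding a constellation into rich or complete tiles -/

namespace Tournament

variable {V : Type*} {T : Tournament V} [DecidableRel T.Adj]

/-- In a transitive set the position of a vertex is its indegree. Hence intervals of positions are
selections by degree, and their sizes are known exactly. -/
theorem IsChain.card_piece {A : Finset V} (hA : T.IsChain A) {a b : ℕ} (hb : b ≤ A.card) :
    ((A.filter fun x => a ≤ T.deg false A x).filter fun x => T.deg false A x < b).card = b - a := by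
  classical
  obtain ⟨f, hinj, hlt, hadj⟩ := hA
  have himg : A.image f = Finset.range A.card := by
    apply Finset.eq_of_subset_of_card_le
    · intro i hi
      obtain ⟨x, hx, rfl⟩ := Finset.mem_image.1 hi
      exact Finset.mem_range.2 (hlt x hx)
    · rw [Finset.card_range, Finset.card_image_of_injOn hinj]
  have hsurj : ∀ i < A.card, ∃ x ∈ A, f x = i := fun i hi => by
    have : i ∈ A.image f := himg ▸ Finset.mem_range.2 hi
    simpa using this
  have hdeg : ∀ x ∈ A, T.deg false A x = f x := by
    intro x hx
    unfold deg
    rw [← Finset.card_range (f x), ← Finset.card_image_of_injOn (f := f)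
      (hinj.mono (by intro y hy; exact Finset.mem_of_mem_filter y hy))]
    congr 1
    ext i
    simp only [Finset.mem_image, Finset.mem_filter, dir_false, Finset.mem_range]
    constructor
    · rintro ⟨y, ⟨hy, hyx⟩, rfl⟩
      exact (hadj y hy x hx).1 hyx
    · intro hi
      obtain ⟨y, hy, rfl⟩ := hsurj i (hi.trans (hlt x hx))
      exact ⟨y, ⟨hy, (hadj y hy x hx).2 hi⟩, rfl⟩
  rw [← Nat.card_Ico, ← Finset.card_image_of_injOn (f := f)
    (hinj.mono (by intro y hy; exact Finset.mem_of_mem_filter y (Finset.mem_of_mem_filter y hy)))]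
  congr 1
  ext i
  simp only [Finset.mem_image, Finset.mem_filter, Finset.mem_Ico]
  constructor
  · rintro ⟨y, ⟨⟨hy, h1⟩, h2⟩, rfl⟩
    rw [hdeg y hy] at h1 h2
    exact ⟨h1, h2⟩
  · rintro ⟨h1, h2⟩
    obtain ⟨y, hy, rfl⟩ := hsurj i (h2.trans_le hb)
    exact ⟨y, ⟨⟨hy, by rwa [hdeg y hy]⟩, by rwa [hdeg y hy]⟩, rfl⟩

theorem IsChain.adj_of_deg_lt {A : Finset V} (hA : T.IsChain A) {x y : V} (hx : x ∈ A) (hy : y ∈ A)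
    (h : T.deg false A x < T.deg false A y) : T.Adj x y := by
  obtain ⟨f, hinj, hlt, hadj⟩ := hA
  rw [hadj x hx y hy]
  by_contra hn
  apply h.not_ge
  apply Finset.card_le_card
  intro z hz
  rw [Finset.mem_filter, dir_false] at hz ⊢
  refine ⟨hz.1, (hadj z hz.1 x hx).2 ?_⟩
  have := (hadj z hz.1 y hy).1 hz.2
  omega

/-- A tournament in which a constellation has been split into parts embeds into pairwise rich
tiles, one tile for every part. -/
theorem IsStarData.exists_hom_of_rich {h : ℕ} {G : Tournament (Fin h)}
    {ctr : Fin h → Option (Fin h)} {part : Fin h → Fin h} (hG : G.IsStarData ctr part)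
    (hh : 0 < h) [Nonempty V] {X : Finset V} {D Tr : ℕ → Finset V → Prop} {R τ : ℕ} {ε : ℝ}
    (hF : T.DefinableFamily X D Tr R τ ε) {r d : ℕ} {W : Fin h → Finset V} {κ γ : ℝ}
    (hd : 2 * h + 4 ≤ d) (hκ : 16 * (h : ℝ) ^ 2 * κ ≤ 1) (hγ : 0 ≤ γ)
    (hγ1 : 128 * (h : ℝ) ^ 4 * γ ≤ 1) (hW : ∀ p, Tr r (W p)) (hWc : ∀ p, 16 * h ≤ (W p).card)
    (hWγ : ∀ p q, p < q → ∀ y ∈ W q, (T.codeg false (W p) y : ℝ) ≤ γ * (W p).card)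
    (hrich : ∀ p q, p < q → T.Rich Tr κ (r + d) (W p) (W q)) :
    ∃ φ : Fin h → V, ∀ i j, G.Adj i j → T.Adj (φ i) (φ j) := by
  classical
  have h1 : (1 : ℝ) ≤ h := by exact_mod_cast hh
  set μ : ℝ := 1 / (16 * (h : ℝ) ^ 2) with hμ
  have hμ0 : 0 < μ := by positivity
  have hγμ : γ ≤ μ * (1 / (8 * (h : ℝ) ^ 2)) := by
    rw [hμ, div_mul_div_comm, le_div_iff₀ (by positivity)]
    nlinarith
  have hγμ' : γ ≤ μ := hγμ.trans (mul_le_of_le_one_right hμ0.le (by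
    rw [div_le_one (by positivity)]; nlinarith))
  have hWr : ∀ p, (16 * h : ℝ) ≤ (W p).card := fun p => by exact_mod_cast hWc p
  let later : Fin h → Finset (Fin h) := fun p => Finset.univ.filter fun q => p < q
  -- Every tile is cut into `h` consecutive pieces of equal size, and a vertex `v` uses piece number
  -- `v` of the tile of its part. Thus vertices of the same part are automatically joined by forward
  -- edges.
  let s : Fin h → ℕ := fun p => (W p).card / h
  let P : Fin h → Finset V := fun v =>
    ((W (part v)).filter fun x => v * s (part v) ≤ T.deg false (W (part v)) x).filter
      fun x => T.deg false (W (part v)) x < (v + 1) * s (part v)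
  -- Vertices of later tiles are typical for earlier tiles by `hWγ`; the converse has to be enforced
  -- by trimming.
  let Q : Fin h → Finset V := fun v => (P v).filter fun x => ∀ q ∈ later (part v),
    (T.codeg true (W q) x : ℝ) ≤ μ * (W q).card
  have hPW : ∀ v, P v ⊆ W (part v) := fun v =>
    (Finset.filter_subset _ _).trans (Finset.filter_subset _ _)
  have hQW : ∀ v, Q v ⊆ W (part v) := fun v => (Finset.filter_subset _ _).trans (hPW v)
  have hQpart : ∀ u v, u < v → part u = part v → T.Complete (Q u) (Q v) := by
    intro u v huv hp x hx y hy
    have hx' := (Finset.mem_filter.1 hx).1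
    have hy' := (Finset.mem_filter.1 hy).1
    simp only [P, Finset.mem_filter] at hx' hy'
    rw [hp] at hx'
    refine (hF.chain _ _ (hW (part v))).adj_of_deg_lt hx'.1.1 hy'.1.1 ?_
    have : ((u : ℕ) + 1) * s (part v) ≤ v * s (part v) := Nat.mul_le_mul_right _ huv
    omega
  have hQTr : ∀ v, Tr (r + h + 2) (Q v) := by
    intro v
    have h2 := hF.selTr.ge r _ (W (part v)) false (v * s (part v))
      (hW (part v)) (hF.ofTr _ _ (hW (part v)))
    have h3 := hF.selTr.lt (r + 1) _ (W (part v)) false ((v + 1) * s (part v)) h2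
      (hF.selD.mono _ _ (hF.ofTr _ _ (hW (part v))))
    have h4 := hF.selTr.trim hF.selD (μ := fun _ => μ) (later (part v)) (fun _ => true) W
      (fun _ => hμ0.le) h3 fun q _ => hF.selD.mono_le (by omega) (hF.ofTr _ _ (hW q))
    have h5 : (later (part v)).card ≤ h := (Finset.card_le_univ _).trans (by simp)
    have h6 := hF.selTr.mono_le (s := r + h + 2) (by omega) h4
    convert h6 using 2
  have hQc : ∀ v, ((W (part v)).card : ℝ) / (4 * h) ≤ (Q v).card := by
    intro v
    set w : ℝ := ((W (part v)).card : ℝ) with hw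
    have hsw : (s (part v)) * h ≤ (W (part v)).card := Nat.div_mul_le_self _ _
    have hvs : (v + 1) * s (part v) ≤ (W (part v)).card := by
      have : (v + 1) * s (part v) ≤ h * s (part v) := Nat.mul_le_mul_right _ v.2
      linarith
    have hPc : (P v).card = s (part v) := by
      have := (hF.chain _ _ (hW (part v))).card_piece (a := v * s (part v)) hvs
      simp only [P]
      rw [this, add_mul]; omega
    have hs : w / h - 1 ≤ s (part v) := (Nat.sub_one_lt_floor (w / h)).le.trans (by
      rw [hw, Nat.floor_div_eq_div])
    have h2 := Finset.card_filter_forall_ge (P v) (later (part v))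
      (fun q x => (T.codeg true (W q) x : ℝ) ≤ μ * (W q).card) (θ := w * (1 / (8 * (h : ℝ) ^ 2))) (by
        intro q hq
        have hq' : part v < q := (Finset.mem_filter.1 hq).2
        have h3 := T.markov_codeg_of_forall (μ := μ) true (W (part v)) (W q) hγ
          (fun y hy => by simpa using hWγ _ _ hq' y hy)
        simp only [not_le]
        have h4 : (((P v).filter fun x => μ * (W q).card < T.codeg true (W q) x).card : ℝ) ≤
            ((W (part v)).filter fun x => μ * (W q).card < T.codeg true (W q) x).card := by
          exact_mod_cast Finset.card_le_card (Finset.filter_subset_filter _ (hPW v))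
        refine le_of_mul_le_mul_left ?_ hμ0
        calc _ ≤ _ := mul_le_mul_of_nonneg_left h4 hμ0.le
          _ ≤ γ * w := h3
          _ ≤ μ * (1 / (8 * (h : ℝ) ^ 2)) * w := by gcongr
          _ = _ := by ring)
    rw [hPc] at h2
    have h3 : ((later (part v)).card : ℝ) ≤ h := by
      exact_mod_cast (Finset.card_le_univ _).trans (by simp)
    have h4 : ((later (part v)).card : ℝ) * (w * (1 / (8 * (h : ℝ) ^ 2))) ≤
        h * (w * (1 / (8 * (h : ℝ) ^ 2))) := by gcongr
    have h5 : (h : ℝ) * (w * (1 / (8 * (h : ℝ) ^ 2))) = (w / h) / 8 := by field_simp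
    have h6 : w / (4 * h) = (w / h) / 4 := by field_simp
    have h7 : 16 ≤ w / h := by rw [le_div_iff₀ (by positivity)]; exact hWr _
    rw [h6]
    have h8 : (s (part v) : ℝ) - (w / h) / 8 ≤ (Q v).card := by
      refine le_trans ?_ h2; linarith
    linarith
  -- Every embedded vertex costs a candidate set at most the fraction `μ` of its tile. As `h * μ = 1
  -- / (16 * h)`, at least `1 / (8 * h)` of the tile always remains.
  let Big : ℕ → Fin h → Finset V → Prop := fun t v Z => Z ⊆ Q v ∧ Tr (r + h + 2 + t) Z ∧
    ((W (part v)).card : ℝ) / (4 * h) - t * (μ * (W (part v)).card) ≤ Z.card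
  have hbigc : ∀ t ≤ h, ∀ v Z, Big t v Z → ((W (part v)).card : ℝ) / (8 * h) ≤ Z.card := by
    intro t ht v Z hZ
    refine le_trans ?_ hZ.2.2
    have ht' : (t : ℝ) ≤ h := by exact_mod_cast ht
    have h2 : (t : ℝ) * (μ * (W (part v)).card) ≤ h * (μ * (W (part v)).card) := by gcongr
    have h3 : (h : ℝ) * (μ * (W (part v)).card) = ((W (part v)).card : ℝ) / h / 16 := by
      rw [hμ]; field_simp
    have h4 : ((W (part v)).card : ℝ) / (4 * h) = ((W (part v)).card : ℝ) / h / 4 := by field_simp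
    have h5 : ((W (part v)).card : ℝ) / (8 * h) = ((W (part v)).card : ℝ) / h / 8 := by field_simp
    have h6 : 0 ≤ ((W (part v)).card : ℝ) / h := by positivity
    rw [h4, h5]; linarith
  have hbig2 : ∀ v, (2 : ℝ) ≤ ((W (part v)).card : ℝ) / (8 * h) := fun v => by
    rw [le_div_iff₀ (by positivity)]; linarith [hWr (part v)]
  refine hG.exists_hom Q Big (fun _ _ _ hZ => hZ.1) ?_ ?_ ?_ ?_ ?_
  · intro t ht v Z hZ
    rw [← Finset.card_pos]
    have := (hbig2 v).trans (hbigc t ht v Z hZ)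
    have : (0 : ℝ) < Z.card := by linarith
    exact_mod_cast this
  · intro v
    exact ⟨subset_rfl, hQTr v, by simpa using hQc v⟩
  · rintro t u v x Z huv hx ⟨hZQ, hZTr, hZc⟩
    have hxX : x ∈ X := hF.sub _ _ (hF.ofTr _ _ (hW _)) (hQW u hx)
    refine ⟨(Finset.filter_subset _ _).trans hZQ, ?_, ?_⟩
    · exact hF.selTr.dir hF.selD hF.single hZTr _ hxX
    · have hcod : (T.codeg (decide (u < v)) Z x : ℝ) ≤ μ * (W (part v)).card := by
        -- The three cases rest on the trimming in `Q`, on the order of the pieces within a tile,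
        -- and on `hWγ`.
        rcases lt_trichotomy (part u) (part v) with hp | hp | hp
        · have huv' : u < v := by
            by_contra hn
            exact absurd hp (hG.mono (not_lt.1 hn)).not_gt
          have h2 := (Finset.mem_filter.1 hx).2 (part v) (by simpa [later] using hp)
          simp only [huv', decide_true]
          refine le_trans ?_ h2
          exact_mod_cast T.codeg_mono (hZQ.trans (hQW v)) x
        · have : T.codeg (decide (u < v)) Z x = 0 := by
            rw [codeg_eq_zero]
            intro z hz
            rcases lt_or_gt_of_ne huv with h' | h'
            · simpa [h'] using hQpart u v h' hp x hx z (hZQ hz)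
            · simpa [h'.not_gt] using hQpart v u h' hp.symm z (hZQ hz) x hx
          rw [this, Nat.cast_zero]; positivity
        · have huv' : ¬ u < v := fun h' => absurd hp (hG.mono h'.le).not_gt
          have h2 := hWγ _ _ hp x (hQW u hx)
          simp only [huv', decide_false]
          calc (T.codeg false Z x : ℝ) ≤ T.codeg false (W (part v)) x := by
                exact_mod_cast T.codeg_mono (hZQ.trans (hQW v)) x
            _ ≤ _ := h2
            _ ≤ _ := by gcongr
      have h2 : (Z.card : ℝ) ≤ (Z.filter (T.Dir (decide (u < v)) x)).card +
          T.codeg (decide (u < v)) Z x := by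
        exact_mod_cast card_le_card_filter_add_codeg _ Z x
      push_cast
      linarith
  · intro l l' c hl hl' hlt
    exact hQpart l l' hlt (hG.part_eq l l' c hl hl')
  · intro t ht c l Zc Zl hl hZc hZl hcard
    -- If the star does not fit, a fraction of the candidates for the center has no backward edge to
    -- the candidates for one leaf. Then `W₀` and all but at most one of these leaf candidates are
    -- complete in the forward direction, contradicting richness.
    set b := decide (l < c) with hb
    set W₀ := Zc.filter fun x => T.deg b Zl x < 1 with hW₀
    set U := Zl.filter fun a => W₀.card ≤ T.deg b W₀ a with hU
    have hUc : Zl.card ≤ U.card + 1 :=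
      card_le_card_filter_add_one b fun x hx => (Finset.mem_filter.1 hx).2
    have hW₀Tr : Tr (r + h + 2 + t + 1) W₀ := hF.selTr.lt _ _ Zl b 1 hZc.2.1 (hF.ofTr _ _ hZl.2.1)
    have hUTr : Tr (r + h + 2 + t + 1 + 1) U := hF.selTr.ge _ _ W₀ b _ (hF.selTr.mono _ _ hZl.2.1)
      (hF.ofTr _ _ hW₀Tr)
    have hW₀Tr' : Tr (r + d) W₀ := hF.selTr.mono_le (by omega) hW₀Tr
    have hUTr' : Tr (r + d) U := hF.selTr.mono_le (by omega) hUTr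
    have hW₀W : W₀ ⊆ W (part c) := (Finset.filter_subset _ _).trans (hZc.1.trans (hQW c))
    have hUW : U ⊆ W (part l) := (Finset.filter_subset _ _).trans (hZl.1.trans (hQW l))
    have hκW : ∀ p, κ * (W p).card ≤ (W p).card / (16 * (h : ℝ) ^ 2) := fun p => by
      rw [le_div_iff₀ (by positivity)]
      nlinarith [hWr p]
    have hW₀c : κ * (W (part c)).card ≤ W₀.card := by
      refine (hκW _).trans ?_
      have h2 := hbigc t ht c Zc hZc
      have h3 : (Zc.card : ℝ) ≤ h * W₀.card := by exact_mod_cast hcard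
      have h4 : ((W (part c)).card : ℝ) / (8 * h) ≤ h * W₀.card := h2.trans h3
      rw [div_le_iff₀ (by positivity)] at h4 ⊢
      nlinarith [Nat.cast_nonneg (α := ℝ) W₀.card]
    have hUc' : κ * (W (part l)).card ≤ U.card := by
      refine (hκW _).trans ?_
      have h2 := hbigc t ht l Zl hZl
      have h3 : (Zl.card : ℝ) ≤ U.card + 1 := by exact_mod_cast hUc
      -- There are at least two candidates for a leaf, so losing one vertex costs at most half of
      -- them.
      have h4 := hbig2 l
      have h5 : ((W (part l)).card : ℝ) / (16 * (h : ℝ) ^ 2) ≤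
          ((W (part l)).card : ℝ) / (8 * h) / 2 := by
        rw [div_div]
        apply div_le_div_of_nonneg_left (by positivity) (by positivity)
        nlinarith
      linarith
    have hcomp : ∀ a ∈ U, ∀ x ∈ W₀, T.Dir b a x := fun a ha =>
      card_le_deg.1 (Finset.mem_filter.1 ha).2
    rcases lt_or_ge l c with hlc | hlc
    · have hp : part l < part c := lt_of_le_of_ne (hG.mono hlc.le) (hG.part_ne l c hl)
      refine hrich _ _ hp U hUW W₀ hW₀W hUTr' hW₀Tr' hUc' hW₀c ?_
      intro a ha x hx
      simpa [hb, hlc] using hcomp a ha x hx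
    · have hp : part c < part l := lt_of_le_of_ne (hG.mono hlc) (hG.part_ne l c hl).symm
      refine hrich _ _ hp W₀ hW₀W U hUW hW₀Tr' hUTr' hW₀c hUc' ?_
      intro x hx a ha
      simpa [hb, hlc.not_gt] using hcomp a ha x hx

variable {V : Type*} {T : Tournament V} [DecidableRel T.Adj]

set_option maxHeartbeats 1000000 in
/-- A tournament whose backward edges form stars embeds into pairwise complete transitive sets `W v`
(for the leaves) and linear sets `B v` (for the other vertices), when all large definable sets
contain large transitive sets. -/
theorem IsStarData.exists_hom_of_complete {h : ℕ} {G : Tournament (Fin h)}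
    {ctr : Fin h → Option (Fin h)} {part : Fin h → Fin h} (hG : G.IsStarData ctr part)
    (hh : 0 < h) [Nonempty V] {X : Finset V} {D Tr : ℕ → Finset V → Prop} {R τ : ℕ} {ε : ℝ}
    (hF : T.DefinableFamily X D Tr R τ ε) (hε : 0 ≤ ε) {r : ℕ} (hR : r + 3 * h + 2 ≤ R)
    {B W : Fin h → Finset V} {l μ₁ : ℝ} (hl : 0 ≤ l) (hμ₁ : 0 ≤ μ₁)
    (hl1 : 64 * (h : ℝ) ^ 3 * l ≤ 1) (hμ1 : 64 * (h : ℝ) ^ 3 * μ₁ ≤ 1)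
    (hB : ∀ v, D r (B v)) (hW : ∀ v, Tr r (W v)) (hWW : ∀ a b, a < b → T.Complete (W a) (W b))
    (hBB : ∀ a b, a < b →
      (∑ x ∈ B a, (T.codeg true (B b) x : ℝ)) ≤ l * (B a).card * (B b).card)
    (hWB : ∀ a c, c ≠ a → ∀ x ∈ W a, (T.codeg (decide (a < c)) (B c) x : ℝ) ≤ μ₁ * (B c).card)
    (hWc : ∀ v, 4 ≤ (W v).card) (hBc : ∀ v, 0 < (B v).card)
    (hτ : ∀ a c, (τ : ℝ) < (W a).card / 4 + (((B c).card : ℝ) / (4 * h)) ^ ε) :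
    ∃ φ : Fin h → V, ∀ i j, G.Adj i j → T.Adj (φ i) (φ j) := by
  classical
  have h1 : (1 : ℝ) ≤ h := by exact_mod_cast hh
  set μ : ℝ := 1 / (16 * (h : ℝ) ^ 2) with hμ
  have hμ0 : 0 < μ := by positivity
  have hlμ : l ≤ μ * (1 / (4 * h)) := by
    rw [hμ, div_mul_div_comm, le_div_iff₀ (by positivity)]; nlinarith
  have hμμ : μ₁ ≤ μ * (1 / (4 * h)) := by
    rw [hμ, div_mul_div_comm, le_div_iff₀ (by positivity)]; nlinarith
  have hμμ' : μ₁ ≤ μ := hμμ.trans (mul_le_of_le_one_right hμ0.le (by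
    rw [div_le_one (by positivity)]; nlinarith))
  have hWr : ∀ v, (4 : ℝ) ≤ (W v).card := fun v => by exact_mod_cast hWc v
  have hBr : ∀ v, (0 : ℝ) < (B v).card := fun v => by exact_mod_cast hBc v
  have hdec : ∀ {a v : Fin h}, a ≠ v → (!decide (v < a)) = decide (a < v) := by
    intro a v hav
    rcases lt_or_gt_of_ne hav with h' | h' <;> simp [h', h'.not_gt]
  let others : Fin h → Finset (Fin h) := fun v => Finset.univ.erase v
  have hothers : ∀ v, (others v).card ≤ h := fun v => (Finset.card_le_univ _).trans (by simp)
  let p₁ : Fin h → Fin h → V → Prop := fun v a x =>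
    (T.codeg (decide (v < a)) (W a) x : ℝ) ≤ μ * (W a).card
  let p₂ : Fin h → Fin h → V → Prop := fun v a x =>
    (T.codeg (decide (v < a)) (B a) x : ℝ) ≤ μ * (B a).card
  -- The sets `B v` are trimmed to vertices typical for all other tiles (`L₁`) and then for all
  -- other sets `B a` (`L`). Each trimming loses at most a quarter of `B v`.
  let L₁ : Fin h → Finset V := fun v => (B v).filter fun x => ∀ a ∈ others v, p₁ v a x
  let L : Fin h → Finset V := fun v => (L₁ v).filter fun x => ∀ a ∈ others v, p₂ v a x
  have hL₁B : ∀ v, L₁ v ⊆ B v := fun v => Finset.filter_subset _ _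
  have hLB : ∀ v, L v ⊆ B v := fun v => (Finset.filter_subset _ _).trans (hL₁B v)
  have hLD : ∀ v, D (r + 2 * h) (L v) := by
    intro v
    have h2 := hF.selD.trim hF.selD (μ := fun _ => μ) (others v) (fun a => decide (v < a)) W
      (fun _ => hμ0.le) (hB v) fun a _ => hF.ofTr _ _ (hW a)
    have h3 : D (r + (others v).card) (L₁ v) := by convert h2 using 2
    have h4 := hF.selD.trim hF.selD (μ := fun _ => μ) (others v) (fun a => decide (v < a)) B
      (fun _ => hμ0.le) h3 fun a _ => hF.selD.mono_le (Nat.le_add_right _ _) (hB a)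
    have h5 := hF.selD.mono_le (s := r + 2 * h) (by have := hothers v; omega) h4
    convert h5 using 2
  have htrim : ∀ v, ∀ θ : ℝ, 0 ≤ θ → ((others v).card : ℝ) * θ ≤ h * θ := fun v θ hθ =>
    mul_le_mul_of_nonneg_right (by exact_mod_cast hothers v) hθ
  have hLc : ∀ v, ((B v).card : ℝ) / 2 ≤ (L v).card := by
    intro v
    set w : ℝ := ((B v).card : ℝ) with hw
    have hθ : 0 ≤ w * (1 / (4 * h)) := by positivity
    have h2 := Finset.card_filter_forall_ge (B v) (others v) (p₁ v) (θ := w * (1 / (4 * h))) (by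
      intro a ha
      have hav : a ≠ v := Finset.ne_of_mem_erase ha
      have h3 := T.markov_codeg_of_forall (μ := μ) (decide (v < a)) (B v) (W a) hμ₁
        (fun y hy => by rw [hdec hav]; exact hWB a v hav.symm y hy)
      simp only [p₁, not_le]
      refine le_of_mul_le_mul_left ?_ hμ0
      calc _ ≤ μ₁ * w := h3
        _ ≤ μ * (1 / (4 * h)) * w := by gcongr
        _ = _ := by ring)
    have h3 := Finset.card_filter_forall_ge (L₁ v) (others v) (p₂ v) (θ := w * (1 / (4 * h))) (by
      intro a ha
      have hav : a ≠ v := Finset.ne_of_mem_erase ha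
      have h2 : (∑ x ∈ B v, (T.codeg (decide (v < a)) (B a) x : ℝ)) ≤
          l * (B v).card * (B a).card := by
        rcases lt_or_gt_of_ne hav with h' | h'
        · have h3 : (∑ x ∈ B v, (T.codeg false (B a) x : ℝ)) =
              ∑ x ∈ B a, (T.codeg true (B v) x : ℝ) := by
            exact_mod_cast T.sum_codeg false (B v) (B a)
          simp only [h'.not_gt, decide_false]
          rw [h3]; linarith [hBB a v h']
        · simpa [h'] using hBB v a h'
      have h3 := T.markov_codeg (μ := μ) _ _ _ h2 hl
      have h4 : (((L₁ v).filter fun x => ¬ p₂ v a x).card : ℝ) ≤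
          ((B v).filter fun x => μ * (B a).card < T.codeg (decide (v < a)) (B a) x).card := by
        norm_cast
        apply Finset.card_le_card
        simp only [p₂, not_le]
        exact Finset.filter_subset_filter _ (hL₁B v)
      refine le_of_mul_le_mul_left ?_ hμ0
      calc _ ≤ _ := mul_le_mul_of_nonneg_left h4 hμ0.le
        _ ≤ l * w := h3
        _ ≤ μ * (1 / (4 * h)) * w := by gcongr
        _ = _ := by ring)
    have h4 := htrim v _ hθ
    have h5 : (h : ℝ) * (w * (1 / (4 * h))) = w / 4 := by field_simp
    have h6 : w - w / 4 ≤ (L₁ v).card := by refine le_trans ?_ h2; linarith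
    have h7 : ((L₁ v).card : ℝ) - w / 4 ≤ (L v).card := by refine le_trans ?_ h3; linarith
    linarith
  -- Leaves are placed into the complete tiles, which puts the leaves of a star in the right order.
  -- Centers and isolated vertices are placed into the sets of linear size.
  let Q : Fin h → Finset V := fun v => if ctr v = none then L v else W v
  have hQL : ∀ {v}, ctr v = none → Q v = L v := fun hv => by simp [Q, hv]
  have hQW : ∀ {v}, ctr v ≠ none → Q v = W v := fun hv => by simp [Q, hv]
  let Big : ℕ → Fin h → Finset V → Prop := fun t v Z => Z ⊆ Q v ∧
    (ctr v = none → D (r + 2 * h + t) Z ∧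
      ((B v).card : ℝ) / 2 - t * (μ * (B v).card) ≤ Z.card) ∧
    (ctr v ≠ none → Tr (r + 2 * h + t) Z ∧ ((W v).card : ℝ) - t * (μ * (W v).card) ≤ Z.card)
  have htμ : ∀ t ≤ h, ∀ w : ℝ, 0 ≤ w → (t : ℝ) * (μ * w) ≤ w / 16 := by
    intro t ht w hw
    have ht' : (t : ℝ) ≤ h := by exact_mod_cast ht
    calc (t : ℝ) * (μ * w) ≤ h * (μ * w) := by gcongr
      _ = w / 16 * (1 / h) := by rw [hμ]; field_simp
      _ ≤ w / 16 * 1 := by gcongr; rw [div_le_one (by positivity)]; exact h1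
      _ = _ := mul_one _
  have hBigL : ∀ t ≤ h, ∀ v Z, Big t v Z → ctr v = none → ((B v).card : ℝ) / 4 ≤ Z.card := by
    intro t ht v Z hZ hv
    have := (hZ.2.1 hv).2
    linarith [htμ t ht _ (hBr v).le, hBr v]
  have hBigW : ∀ t ≤ h, ∀ v Z, Big t v Z → ctr v ≠ none → ((W v).card : ℝ) / 2 ≤ Z.card := by
    intro t ht v Z hZ hv
    have := (hZ.2.2 hv).2
    linarith [htμ t ht ((W v).card : ℝ) (by positivity), hWr v]
  refine hG.exists_hom Q Big (fun _ _ _ hZ => hZ.1) ?_ ?_ ?_ ?_ ?_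
  · intro t ht v Z hZ
    rw [← Finset.card_pos]
    have : (0 : ℝ) < Z.card := by
      by_cases hv : ctr v = none
      · linarith [hBigL t ht v Z hZ hv, hBr v]
      · linarith [hBigW t ht v Z hZ hv, hWr v]
    exact_mod_cast this
  · intro v
    refine ⟨subset_rfl, fun hv => ?_, fun hv => ?_⟩
    · rw [hQL hv]; exact ⟨hLD v, by simpa using hLc v⟩
    · rw [hQW hv]; exact ⟨hF.selTr.mono_le (by omega) (hW v), by simp⟩
  · rintro t u v x Z huv hx ⟨hZQ, hZL, hZW⟩
    have hxX : x ∈ X := by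
      by_cases hu : ctr u = none
      · rw [hQL hu] at hx; exact hF.sub _ _ (hB u) (hLB u hx)
      · rw [hQW hu] at hx; exact hF.sub _ _ (hF.ofTr _ _ (hW u)) hx
    have hsplit : (Z.card : ℝ) ≤ (Z.filter (T.Dir (decide (u < v)) x)).card +
        T.codeg (decide (u < v)) Z x := by
      exact_mod_cast card_le_card_filter_add_codeg _ Z x
    refine ⟨(Finset.filter_subset _ _).trans hZQ, fun hv => ?_, fun hv => ?_⟩
    · refine ⟨hF.selD.dir hF.selD hF.single (hZL hv).1 _ hxX, ?_⟩
      rw [hQL hv] at hZQ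
      have hmono : (T.codeg (decide (u < v)) Z x : ℝ) ≤ T.codeg (decide (u < v)) (B v) x := by
        exact_mod_cast T.codeg_mono (hZQ.trans (hLB v)) x
      have hcod : (T.codeg (decide (u < v)) (B v) x : ℝ) ≤ μ * (B v).card := by
        by_cases hu : ctr u = none
        · rw [hQL hu] at hx
          exact (Finset.mem_filter.1 hx).2 v (by simp [others, huv.symm])
        · rw [hQW hu] at hx
          exact (hWB u v huv.symm x hx).trans (by gcongr)
      have := (hZL hv).2
      push_cast
      linarith
    · refine ⟨hF.selTr.dir hF.selD hF.single (hZW hv).1 _ hxX, ?_⟩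
      rw [hQW hv] at hZQ
      have hmono : (T.codeg (decide (u < v)) Z x : ℝ) ≤ T.codeg (decide (u < v)) (W v) x := by
        exact_mod_cast T.codeg_mono hZQ x
      have hcod : (T.codeg (decide (u < v)) (W v) x : ℝ) ≤ μ * (W v).card := by
        by_cases hu : ctr u = none
        · rw [hQL hu] at hx
          exact (Finset.mem_filter.1 (Finset.mem_filter.1 hx).1).2 v (by simp [others, huv.symm])
        · rw [hQW hu] at hx
          have : T.codeg (decide (u < v)) (W v) x = 0 := by
            rw [codeg_eq_zero]
            intro z hz
            rcases lt_or_gt_of_ne huv with h' | h'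
            · simpa [h'] using hWW u v h' x hx z hz
            · simpa [h'.not_gt] using hWW v u h' z hz x hx
          rw [this, Nat.cast_zero]; positivity
      have := (hZW hv).2
      push_cast
      linarith
  · intro l l' c hl hl' hlt
    rw [hQW (by simp [hl]), hQW (by simp [hl'])]
    exact hWW l l' hlt
  · intro t ht c l Zc Zl hlc hZc hZl hcard
    have hc := hG.center l c hlc
    have hl' : ctr l ≠ none := by simp [hlc]
    set b := decide (l < c) with hb
    set W₀ := Zc.filter fun x => T.deg b Zl x < 1 with hW₀
    set U := Zl.filter fun a => W₀.card ≤ T.deg b W₀ a with hU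
    have hUc : (Zl.card : ℝ) ≤ U.card + 1 := by
      exact_mod_cast card_le_card_filter_add_one b fun x hx => (Finset.mem_filter.1 hx).2
    have hW₀D : D (r + 2 * h + t + 1) W₀ := hF.selD.lt _ _ Zl b 1 (hZc.2.1 hc).1
      (hF.ofTr _ _ (hZl.2.2 hl').1)
    have hUTr : Tr (r + 2 * h + t + 1 + 1) U := hF.selTr.ge _ _ W₀ b _
      (hF.selTr.mono _ _ (hZl.2.2 hl').1) hW₀D
    -- The set `W₀` of failing centers has linear size but need not be transitive; a large
    -- transitive subset of it is combined with `U`, which is most of a leaf's candidates, to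
    -- contradict `hF.bound` and `hτ`.
    obtain ⟨S, hSW, hS, hSc⟩ := hF.ext _ _ hW₀D
    have hUR : Tr R U := hF.selTr.mono_le (by omega) hUTr
    have hSR : Tr R S := hF.selTr.mono_le (by omega) hS
    have hcomp : ∀ a ∈ U, ∀ x ∈ S, T.Dir b a x := fun a ha x hx =>
      card_le_deg.1 (Finset.mem_filter.1 ha).2 x (hSW hx)
    have hle : U.card + S.card ≤ τ := by
      rcases lt_or_ge l c with hlt | hlt
      · refine hF.bound U S hUR hSR fun a ha x hx => ?_
        simpa [hb, hlt] using hcomp a ha x hx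
      · rw [add_comm]
        refine hF.bound S U hSR hUR fun x hx a ha => ?_
        simpa [hb, hlt.not_gt] using hcomp a ha x hx
    have hle' : (U.card : ℝ) + S.card ≤ τ := by exact_mod_cast hle
    have h2 := hBigL t ht c Zc hZc hc
    have h3 := hBigW t ht l Zl hZl hl'
    have h4 : (Zc.card : ℝ) ≤ h * W₀.card := by exact_mod_cast hcard
    have h5 : ((B c).card : ℝ) / (4 * h) ≤ W₀.card := by
      rw [div_le_iff₀ (by positivity)]; nlinarith
    have h6 := Real.rpow_le_rpow (by positivity) h5 hε
    have h7 := hτ l c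
    linarith [hWr l]

end Tournament

/-! ### A large transitive set in one round of the recursion -/

namespace Tournament

variable {V : Type*} {T : Tournament V} [DecidableRel T.Adj]

/-- The number `x` for which the Ramsey argument keeps the fraction `2 ^ (-x)` of every tile. -/
def lossExp (h : ℕ) : ℕ := (2 * h + 4) * 2 ^ (2 * h + 1) ^ 2

/-- The number `E` for which the sets of the near-complete chain have at least `2 ^ (-E) n`
elements. -/
def chainExp (h : ℕ) : ℕ := (lossExp h + 8 * h + 11 + 2) * (2 * h + 2) ^ 2 ^ (2 * h)

/-- The number of rounds in which the sets of the argument are definable. -/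
def roundBound (h : ℕ) : ℕ :=
  2 ^ (2 * h) * (h + 1) + 2 ^ (2 * h) * (2 * 2 ^ (2 * h) + 1) + lossExp h + 3 * h + 2

theorem natCast_le_two_pow (h : ℕ) : (h : ℝ) ≤ 2 ^ h := by
  exact_mod_cast Nat.lt_two_pow_self.le

theorem half_pow_mul_le_one {a b : ℕ} {c : ℝ} (hab : b ≤ a) (hc : c ≤ 2 ^ b) :
    c * (1 / 2 : ℝ) ^ a ≤ 1 := by
  rw [one_div, inv_pow, ← div_eq_mul_inv, div_le_one (by positivity)]
  exact hc.trans (pow_le_pow_right₀ (by norm_num) hab)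

theorem half_pow_mul_pow_le (m a b : ℕ) (hb : m + 2 + b ≤ a) :
    4 * ((2 ^ m : ℕ) : ℝ) * (1 / 2 : ℝ) ^ a ≤ (1 / 2) ^ b := by
  have h1 : (1 / 2 : ℝ) ^ a ≤ (1 / 2) ^ (m + 2 + b) :=
    pow_le_pow_of_le_one (by norm_num) (by norm_num) hb
  calc 4 * ((2 ^ m : ℕ) : ℝ) * (1 / 2 : ℝ) ^ a ≤ 4 * ((2 ^ m : ℕ) : ℝ) * (1 / 2) ^ (m + 2 + b) := by
        gcongr
    _ = (1 / 2) ^ b * (2 * (1 / 2)) ^ m := by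
        push_cast; rw [mul_pow, pow_add, pow_add]; ring
    _ = _ := by norm_num

/-- Since ln 2 < 1, this follows from the tangent line of the exponential function. -/
theorem one_sub_le_half_rpow {y : ℝ} (hy : 0 ≤ y) : 1 - y ≤ (1 / 2 : ℝ) ^ y := by
  rw [Real.rpow_def_of_pos (by norm_num)]
  have h1 : Real.log (1 / 2) = - Real.log 2 := by rw [one_div, Real.log_inv]
  have h2 : Real.log 2 < 1 := by linarith [Real.log_two_lt_d9]
  have h3 := Real.add_one_le_exp (Real.log (1 / 2) * y)
  rw [h1] at h3 ⊢
  nlinarith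

/-- The loss of a constant factor `2 ^ (-k)` in the size of a set. -/
theorem rpow_lower {ε : ℝ} (hε : 0 ≤ ε) (k : ℕ) {n b : ℝ} (hn : 0 ≤ n)
    (hb : (1 / 2 : ℝ) ^ k * n ≤ b) : (1 - ε * k) * n ^ ε ≤ b ^ ε := by
  have h1 : ((1 / 2 : ℝ) ^ k * n) ^ ε ≤ b ^ ε := Real.rpow_le_rpow (by positivity) hb hε
  rw [Real.mul_rpow (by positivity) hn, ← Real.rpow_natCast, ← Real.rpow_mul (by norm_num)] at h1
  refine le_trans ?_ h1
  have := one_sub_le_half_rpow (y := (k : ℝ) * ε) (by positivity)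
  have h2 : 0 ≤ n ^ ε := Real.rpow_nonneg hn _
  calc (1 - ε * k) * n ^ ε = (1 - k * ε) * n ^ ε := by ring
    _ ≤ _ := mul_le_mul_of_nonneg_right this h2

/-- The inductive step of the size estimate: if `τ` were smaller, the tiles would be so large
compared with `τ` that `G` embeds, whether they are rich or complete. The condition `hε1` says that
a constant fraction of a tile exceeds the loss from passing to sets of linear size. -/
theorem DefinableFamily.rpow_le {h : ℕ} {G : Tournament (Fin h)}
    {ctr : Fin h → Option (Fin h)} {part : Fin h → Fin h} (hG : G.IsStarData ctr part)
    (hh : 0 < h) (hfree : T.Free G)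
    {X : Finset V} {D Tr : ℕ → Finset V → Prop} {R τ : ℕ} {ε : ℝ}
    (hF : T.DefinableFamily X D Tr R τ ε) (hR : roundBound h ≤ R) (hε : 0 < ε)
    (hε1 : ε * (chainExp h + h + 4 : ℕ) * 2 ^ (lossExp h + 3) ≤ 1)
    {Y : Finset V} (hYX : Y ⊆ X) (hY : D 0 Y) {n : ℕ} (hYn : n ≤ 3 * Y.card)
    (hn : (2 : ℝ) ^ (lossExp h + h + 5) ≤ (n : ℝ) ^ ε) :
    (n : ℝ) ^ ε ≤ τ := by
  by_contra hcon
  push Not at hcon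
  set x := lossExp h with hx
  set a := x + 8 * h + 11 with ha
  set E := (a + 2) * (2 * h + 2) ^ 2 ^ (2 * h) with hE
  have hEE : chainExp h = E := rfl
  rw [hEE] at hε1
  set m := 2 ^ (2 * h) with hm
  have hn0 : (0 : ℝ) ≤ n := Nat.cast_nonneg n
  have hnε : 0 < (n : ℝ) ^ ε := lt_of_lt_of_le (by positivity) hn
  -- sizes
  have hεE : ε * (E + h + 4 : ℕ) ≤ 1 / 2 ^ (x + 3) := by
    rw [le_div_iff₀ (by positivity)]; exact hε1
  have h2x : (1 : ℝ) / 2 ^ (x + 3) ≤ 1 / 2 := by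
    apply div_le_div_of_nonneg_left (by norm_num) (by norm_num)
    calc (2 : ℝ) = 2 ^ 1 := by norm_num
      _ ≤ 2 ^ (x + 3) := pow_le_pow_right₀ (by norm_num) (by omega)
  have hYn' : (1 / 2 : ℝ) ^ 2 * n ≤ Y.card := by
    have : (n : ℝ) ≤ 3 * Y.card := by exact_mod_cast hYn
    have h0 : (0 : ℝ) ≤ Y.card := Nat.cast_nonneg _
    linarith
  -- The sets of the chain are nonempty: otherwise `2 ^ (-(E + 2)) * n < 1`, whereas `rpow_lower`
  -- and `4 ≤ n ^ ε` make its power with exponent `ε` larger than `1`.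
  have hbig : (1 : ℝ) ≤ (1 / 2) ^ E * Y.card := by
    have h1 : (1 / 2 : ℝ) ^ (E + 2) * n ≤ (1 / 2) ^ E * Y.card := by
      rw [pow_add, mul_assoc]; gcongr
    refine le_trans ?_ h1
    by_contra hlt
    push Not at hlt
    have h2 := rpow_lower hε.le (E + 2) hn0 le_rfl
    have h3 : ((1 / 2 : ℝ) ^ (E + 2) * n) ^ ε ≤ 1 :=
      Real.rpow_le_one (by positivity) hlt.le hε.le
    have h4 : ε * (E + 2 : ℕ) ≤ 1 / 2 := by
      refine le_trans ?_ (hεE.trans h2x)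
      exact mul_le_mul_of_nonneg_left (by exact_mod_cast (by omega : E + 2 ≤ E + h + 4)) hε.le
    have h5 : (4 : ℝ) ≤ (n : ℝ) ^ ε := by
      refine le_trans ?_ hn
      calc (4 : ℝ) = 2 ^ 2 := by norm_num
        _ ≤ _ := pow_le_pow_right₀ (by norm_num) (by omega)
    nlinarith
  have hYne : Y.Nonempty := by
    rw [← Finset.card_pos, Nat.pos_iff_ne_zero]
    intro h0
    rw [h0] at hbig; norm_num at hbig
  have : Nonempty V := ⟨hYne.choose⟩
  -- the chain and the tiles
  obtain ⟨B, hB, hBB⟩ := exists_near_chain hh hfree hF.selD hF.single a m hYX hY hbig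
  have hμl : 4 * (m : ℝ) * (1 / 2) ^ a ≤ (1 / 2) ^ (x + 6 * h + 9) :=
    half_pow_mul_pow_le _ _ _ (by omega)
  have hμγ : 4 * (m : ℝ) * (1 / 2) ^ (x + 6 * h + 9) ≤ (1 / 2) ^ (x + 4 * h + 7) :=
    half_pow_mul_pow_le _ _ _ (by omega)
  obtain ⟨S, hS⟩ := exists_tiles hF hε.le (m := m) (by positivity) (by positivity) (by positivity)
    hμl hμγ (fun i hi => (hB i hi.le).2.1) fun i j hij hj => hBB i j hij hj.le
  have hBn : ∀ i < m, (1 / 2 : ℝ) ^ (E + 2) * n ≤ (B i).card := fun i hi => by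
    refine le_trans ?_ (hB i hi.le).2.2
    rw [pow_add, mul_assoc]; gcongr
  have hSn : ∀ i < m, 1 / 2 * (n : ℝ) ^ ε ≤ (S i).card := fun i hi => by
    refine le_trans ?_ (hS i hi).2.2.1
    have h1 : (1 / 2 : ℝ) ^ (E + h + 4) * n ≤ (B i).card / 2 := by
      have h2 : (1 / 2 : ℝ) ^ (E + h + 4) ≤ (1 / 2) ^ (E + 2 + 1) :=
        pow_le_pow_of_le_one (by norm_num) (by norm_num) (by omega)
      calc (1 / 2 : ℝ) ^ (E + h + 4) * n ≤ (1 / 2) ^ (E + 2 + 1) * n := by gcongr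
        _ = (1 / 2) ^ (E + 2) * n / 2 := by ring
        _ ≤ _ := by linarith [hBn i hi]
    refine le_trans ?_ (rpow_lower hε.le _ hn0 h1)
    gcongr
    linarith
  -- the Ramsey argument
  have hTr : ∀ r s A, r ≤ s → Tr r A → Tr s A := fun r s A hrs h => hF.selTr.mono_le hrs h
  have hκ1 : (1 / 2 : ℝ) ^ (2 * h + 4) ≤ 1 := pow_le_one₀ (by norm_num) (by norm_num)
  -- The `2 ^ (2 * h)` tiles suffice for `h` of either kind.
  obtain ⟨r', hr', hrr', S', hS', hJ⟩ := ramsey_tiles hTr (κ := (1 / 2 : ℝ) ^ (2 * h + 4))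
    (by positivity) hκ1 (2 * h + 4) (2 * h) h h (by omega) (m * (h + 1) + m * (2 * m + 1))
    (Finset.range m) S (by simp [hm]) fun i hi => by
      have := (hS i (Finset.mem_range.1 hi)).2.1
      simpa using this
  have hfrac : ((1 / 2 : ℝ) ^ (2 * h + 4)) ^ 2 ^ (2 * h + 1) ^ 2 = (1 / 2) ^ x := by
    rw [← pow_mul]; rfl
  rw [hfrac] at hS'
  have hS'n : ∀ i < m, 1 / 2 ^ (x + 1) * (n : ℝ) ^ ε ≤ (S' i).card := fun i hi => by
    refine le_trans ?_ (hS' i (Finset.mem_range.2 hi)).2.2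
    calc 1 / 2 ^ (x + 1) * (n : ℝ) ^ ε = (1 / 2) ^ x * (1 / 2 * (n : ℝ) ^ ε) := by
          rw [one_div_pow, pow_succ]; field_simp
      _ ≤ _ := by gcongr; exact hSn i hi
  have hS'h : ∀ i < m, 16 * h ≤ (S' i).card := fun i hi => by
    have h1 : (16 * h : ℝ) ≤ (S' i).card := by
      refine le_trans ?_ (hS'n i hi)
      calc (16 * h : ℝ) ≤ 16 * 2 ^ h := by gcongr; exact natCast_le_two_pow h
        _ = 1 / 2 ^ (x + 1) * 2 ^ (x + h + 5) := by
          rw [div_mul_eq_mul_div, eq_div_iff (by positivity)]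
          ring
        _ ≤ _ := by gcongr
    exact_mod_cast h1
  have hh1 := natCast_le_two_pow h
  rcases hJ with ⟨J, hJm, hJc, hJ⟩ | ⟨J, hJm, hJc, hJ⟩
  · have hv : ∀ v : Fin h, J.orderEmbOfFin hJc v ∈ J := fun v => J.orderEmbOfFin_mem hJc v
    have hvm : ∀ v : Fin h, J.orderEmbOfFin hJc v < m := fun v => Finset.mem_range.1 (hJm (hv v))
    have h3 : (64 : ℝ) * h ^ 3 ≤ 2 ^ (6 + 3 * h) := by
      rw [pow_add, mul_comm 3 h, pow_mul]
      have : (h : ℝ) ^ 3 ≤ (2 ^ h) ^ 3 := by gcongr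
      linarith
    obtain ⟨φ, hφ⟩ := hG.exists_hom_of_complete hh hF hε.le (r := r') (R := R) (τ := τ)
      (B := fun v => B (J.orderEmbOfFin hJc v)) (W := fun v => S' (J.orderEmbOfFin hJc v))
      (l := (1 / 2) ^ a) (μ₁ := (1 / 2) ^ (x + 6 * h + 9)) (by
        have : roundBound h = m * (h + 1) + m * (2 * m + 1) + x + 3 * h + 2 := rfl
        have : (2 * h + 4) * 2 ^ (2 * h + 1) ^ 2 = x := rfl
        omega) (by positivity) (by positivity)
      (half_pow_mul_le_one (by omega) h3) (half_pow_mul_le_one (by omega) h3)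
      (fun v => hF.selD.mono_le (by omega) (hB _ (hvm v).le).2.1)
      (fun v => (hS' _ (hJm (hv v))).2.1)
      (fun u v huv => hJ _ (hv u) _ (hv v) ((J.orderEmbOfFin hJc).lt_iff_lt.2 huv))
      (fun u v huv => hBB _ _ ((J.orderEmbOfFin hJc).lt_iff_lt.2 huv) (hvm v).le)
      (fun u c hcu y hy => by
        have := (hS _ (hvm u)).2.2.2.1 _ (hvm c)
          (fun hcon => hcu ((J.orderEmbOfFin hJc).injective hcon)) y
          ((hS' _ (hJm (hv u))).1 hy)
        simpa only [(J.orderEmbOfFin hJc).lt_iff_lt] using this)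
      (fun v => by have := hS'h _ (hvm v); omega)
      (fun v => by
        have := (hB _ (hvm v).le).2.2
        have : (0 : ℝ) < (B (J.orderEmbOfFin hJc v)).card := by linarith
        exact_mod_cast this)
      -- The decisive inequality: a quarter of a tile contributes `2 ^ (-(x + 3)) * n ^ ε`, and a
      -- transitive subset of a linear set at least `(1 - ε * (E + h + 4)) * n ^ ε`. By `hεE` the
      -- sum is at least `n ^ ε`, hence more than `τ`.
      (fun u c => by
        refine hcon.trans_le ?_
        have h4 := hS'n _ (hvm u)
        have h5 : (1 - ε * (E + h + 4 : ℕ)) * (n : ℝ) ^ ε ≤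
            (((B (J.orderEmbOfFin hJc c)).card : ℝ) / (4 * h)) ^ ε := by
          apply rpow_lower hε.le _ hn0
          have hh0 : (0 : ℝ) < h := by exact_mod_cast hh
          rw [le_div_iff₀ (by positivity)]
          calc (1 / 2 : ℝ) ^ (E + h + 4) * n * (4 * h)
              ≤ (1 / 2 : ℝ) ^ (E + h + 4) * n * (4 * 2 ^ h) := by gcongr
            _ = (1 / 2) ^ (E + 2) * n * (2 * (1 / 2)) ^ h := by
                rw [mul_pow, pow_add, pow_add, pow_add]; ring
            _ = (1 / 2) ^ (E + 2) * n := by norm_num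
            _ ≤ _ := hBn _ (hvm c)
        have h6 : (1 / 2 ^ (x + 1) * (n : ℝ) ^ ε) / 4 = 1 / 2 ^ (x + 3) * (n : ℝ) ^ ε := by
          rw [pow_add, pow_add]; field_simp; norm_num
        have h7 := mul_le_mul_of_nonneg_right hεE hnε.le
        linarith)
    exact hfree.false_of_hom φ hφ
  · have hv : ∀ v : Fin h, J.orderEmbOfFin hJc v ∈ J := fun v => J.orderEmbOfFin_mem hJc v
    have hvm : ∀ v : Fin h, J.orderEmbOfFin hJc v < m := fun v => Finset.mem_range.1 (hJm (hv v))
    obtain ⟨φ, hφ⟩ := hG.exists_hom_of_rich hh hF (r := r') (d := 2 * h + 4)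
      (W := fun v => S' (J.orderEmbOfFin hJc v)) (κ := (1 / 2) ^ (2 * h + 4))
      (γ := (1 / 2) ^ (4 * h + 7)) le_rfl
      (half_pow_mul_le_one (b := 2 * h + 4) le_rfl (by
        have : (h : ℝ) ^ 2 ≤ (2 ^ h) ^ 2 := by gcongr
        rw [pow_add, mul_comm 2 h, pow_mul]; linarith)) (by positivity)
      (half_pow_mul_le_one (b := 4 * h + 7) le_rfl (by
        have : (h : ℝ) ^ 4 ≤ (2 ^ h) ^ 4 := by gcongr
        rw [pow_add, mul_comm 4 h, pow_mul]; linarith))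
      (fun v => (hS' _ (hJm (hv v))).2.1) (fun v => hS'h _ (hvm v))
      (fun p q hpq y hy => by
        have h1 := (hS _ (hvm q)).2.2.2.2 _ ((J.orderEmbOfFin hJc).lt_iff_lt.2 hpq) y
          ((hS' _ (hJm (hv q))).1 hy)
        have h2 := T.codeg_mono (b := false) (hS' _ (hJm (hv p))).1 y
        -- The set against which typicality is measured has shrunk by a factor of at most `2 ^ x`,
        -- so the fraction of missing edges grows by at most this factor.
        have h3 := (hS' _ (hJm (hv p))).2.2
        calc (T.codeg false (S' (J.orderEmbOfFin hJc p)) y : ℝ)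
            ≤ T.codeg false (S (J.orderEmbOfFin hJc p)) y := by exact_mod_cast h2
          _ ≤ (1 / 2) ^ (x + 4 * h + 7) * (S (J.orderEmbOfFin hJc p)).card := h1
          _ = (1 / 2) ^ (4 * h + 7) * ((1 / 2) ^ x * (S (J.orderEmbOfFin hJc p)).card) := by
              rw [← mul_assoc, ← pow_add]; congr 2; omega
          _ ≤ _ := by gcongr)
      (fun p q hpq => hJ _ (hv p) _ (hv q) ((J.orderEmbOfFin hJc).lt_iff_lt.2 hpq))
    exact hfree.false_of_hom φ hφ

end Tournament

/-! ### The star data of a constellation -/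

namespace Tournament

section Constellation

variable {W : Type*} [Fintype W] {H : Tournament W} {θ : W ≃ Fin (Fintype.card W)}
  {ctr : H.Star θ → W}

theorem star_eq_of_mem_leaves {K M : H.Star θ} {v : W} (hK : v ∈ K.1.supp) (hM : v ∈ M.1.supp) :
    K = M :=
  Subtype.ext (hK.symm.trans hM)

theorem leftPrecedesRight_of_lt {L M : Set W} {a b : W} (ha : a ∈ L) (hb : b ∈ M)
    (hab : θ a < θ b) : LeftPrecedesRight θ L M := by
  obtain ⟨u, hu, hu'⟩ := Set.exists_min_image L θ (Set.toFinite L) ⟨a, ha⟩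
  obtain ⟨v, hv, hv'⟩ := Set.exists_max_image M θ (Set.toFinite M) ⟨b, hb⟩
  exact ⟨u, v, ⟨hu, hu'⟩, ⟨hv, hv'⟩, (hu' a ha).trans_lt (hab.trans_le (hv' b hb))⟩

/-- Leaf sets whose spans overlap are adjacent in the interstellar graph. The weak inequalities are
strict for different stars, as these have no common vertex. -/
theorem connectedComponentMk_eq_of_le {K M : H.Star θ} {a b a' b' : W} (ha : a ∈ leaves ctr K)
    (hb : b ∈ leaves ctr K) (ha' : a' ∈ leaves ctr M) (hb' : b' ∈ leaves ctr M)
    (h1 : θ a ≤ θ b') (h2 : θ a' ≤ θ b) :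
    (interstellarGraph ctr).connectedComponentMk K =
      (interstellarGraph ctr).connectedComponentMk M := by
  by_cases hKM : K = M
  · rw [hKM]
  have hlt : ∀ {u v : W}, u ∈ leaves ctr K → v ∈ leaves ctr M → θ u ≠ θ v := fun hu hv huv =>
    hKM (star_eq_of_mem_leaves hu.1 (θ.injective huv ▸ hv.1))
  apply SimpleGraph.ConnectedComponent.sound
  apply SimpleGraph.Adj.reachable
  exact ⟨hKM, leftPrecedesRight_of_lt ha hb' (lt_of_le_of_ne h1 (hlt ha hb')),
    leftPrecedesRight_of_lt ha' hb (lt_of_le_of_ne h2 (hlt hb ha').symm)⟩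

/-- No set of leaves has elements on both sides of the place after position `p`. -/
def IsCut (ctr : H.Star θ → W) (p : ℕ) : Prop :=
  ∀ K : H.Star θ, ∀ a ∈ leaves ctr K, ∀ b ∈ leaves ctr K, ¬ ((θ a : ℕ) ≤ p ∧ p < θ b)

/-- There is a cut between a leaf of a star and its center. -/
theorem exists_isCut (hc : ∀ P ∈ starPartition ctr, ∀ K : H.Star θ, ctr K ∈ P →
      ∀ l ∈ leaves ctr K, l ∉ P) {K : H.Star θ} {l : W} (hl : l ∈ leaves ctr K)
    {p q : ℕ} (hpq : p ≤ q) (h : (p = θ l ∧ q = θ (ctr K)) ∨ (p = θ (ctr K) ∧ q = θ l)) :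
    ∃ i, p ≤ i ∧ i < q ∧ IsCut ctr i := by
  classical
  by_contra hcon
  push Not at hcon
  set C := (interstellarGraph ctr).connectedComponentMk K with hC
  have hspan : ∀ i, p ≤ i → i < q → ∃ M, ∃ a ∈ leaves ctr M, ∃ b ∈ leaves ctr M,
      (θ a : ℕ) ≤ i ∧ i < θ b := fun i h1 h2 => by
    have := hcon i h1 h2
    unfold IsCut at this
    push Not at this
    exact this
  have hne : p ≠ q := by
    intro hpq'
    have h1 : θ l = θ (ctr K) := by
      apply Fin.ext; omega
    exact hl.2 (θ.injective h1)
  -- Without a cut, every place between the leaf and the center is spanned by a leaf set. Spans at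
  -- consecutive places overlap, so walking from the leaf to the center never leaves the component
  -- `C`.
  have hreach : ∀ i, p ≤ i → i < q → ∃ M, (interstellarGraph ctr).connectedComponentMk M = C ∧
      ∃ a ∈ leaves ctr M, ∃ b ∈ leaves ctr M, (θ a : ℕ) ≤ i ∧ i < θ b := by
    rcases h with ⟨rfl, hq⟩ | ⟨hp, rfl⟩
    · intro i hi
      induction i, hi using Nat.le_induction with
      | base =>
        intro h2
        obtain ⟨M, a, ha, b, hb, h3, h4⟩ := hspan _ le_rfl h2
        exact ⟨M, connectedComponentMk_eq_of_le ha hb hl hl (by exact_mod_cast h3)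
          (by rw [Fin.le_def]; omega), a, ha, b, hb, h3, h4⟩
      | succ i hi ih =>
        intro h2
        obtain ⟨N, hN, a', ha', b', hb', h3', h4'⟩ := ih (by omega)
        obtain ⟨M, a, ha, b, hb, h3, h4⟩ := hspan (i + 1) (by omega) h2
        exact ⟨M, (connectedComponentMk_eq_of_le ha hb ha' hb' (by rw [Fin.le_def]; omega)
          (by rw [Fin.le_def]; omega)).trans hN, a, ha, b, hb, h3, h4⟩
    · have : ∀ j i : ℕ, i + j + 1 = θ l → p ≤ i →
          ∃ M, (interstellarGraph ctr).connectedComponentMk M = C ∧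
            ∃ a ∈ leaves ctr M, ∃ b ∈ leaves ctr M, (θ a : ℕ) ≤ i ∧ i < θ b := by
        intro j
        induction j with
        | zero =>
          intro i hi hp
          obtain ⟨M, a, ha, b, hb, h3, h4⟩ := hspan i hp (by omega)
          exact ⟨M, connectedComponentMk_eq_of_le ha hb hl hl (by rw [Fin.le_def]; omega)
            (by rw [Fin.le_def]; omega), a, ha, b, hb, h3, h4⟩
        | succ j ih =>
          intro i hi hp
          obtain ⟨N, hN, a', ha', b', hb', h3', h4'⟩ := ih (i + 1) (by omega) (by omega)
          obtain ⟨M, a, ha, b, hb, h3, h4⟩ := hspan i hp (by omega)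
          exact ⟨M, (connectedComponentMk_eq_of_le ha hb ha' hb' (by rw [Fin.le_def]; omega)
            (by rw [Fin.le_def]; omega)).trans hN, a, ha, b, hb, h3, h4⟩
      intro i h1 h2
      exact this ((θ l : ℕ) - i - 1) i (by omega) h1
  have hmem : ∀ {M : H.Star θ} {a : W}, (interstellarGraph ctr).connectedComponentMk M = C →
      a ∈ leaves ctr M → a ∈ ⋃ K ∈ C.supp, leaves ctr K := fun {M a} hM ha =>
    Set.mem_biUnion (show M ∈ C.supp from hM) ha
  have hlC : l ∈ cluster ctr C := Or.inl (hmem rfl hl)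
  -- The span at the place next to the center encloses the center. Hence the cluster that contains
  -- the leaf contains the center too, which a constellation forbids.
  have hcC : ctr K ∈ cluster ctr C := by
    have key : ∀ M, (interstellarGraph ctr).connectedComponentMk M = C →
        ∀ a ∈ leaves ctr M, ∀ b ∈ leaves ctr M, θ a ≤ θ (ctr K) → θ (ctr K) ≤ θ b →
        ctr K ∈ cluster ctr C := by
      intro M hM a ha b hb h1 h2
      rcases h1.eq_or_lt with h1 | h1
      · rw [← θ.injective h1]; exact Or.inl (hmem hM ha)
      rcases h2.eq_or_lt with h2 | h2
      · rw [θ.injective h2]; exact Or.inl (hmem hM hb)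
      exact Or.inr ⟨a, hmem hM ha, b, hmem hM hb, h1, h2⟩
    rcases h with ⟨hp, hq⟩ | ⟨hp, hq⟩
    · obtain ⟨M, hM, a, ha, b, hb, h3, h4⟩ := hreach (q - 1) (by omega) (by omega)
      exact key M hM a ha b hb (by rw [Fin.le_def]; omega) (by rw [Fin.le_def]; omega)
    · obtain ⟨M, hM, a, ha, b, hb, h3, h4⟩ := hreach p (by omega) (by omega)
      exact key M hM a ha b hb (by rw [Fin.le_def]; omega) (by rw [Fin.le_def]; omega)
  exact hc _ (Or.inl ⟨C, rfl⟩) K hcC l hl hlC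

/-- The parts are the intervals between consecutive cuts. A cut never separates two leaves of a
star, and by `exists_isCut` some cut separates each leaf from its center. -/
theorem IsConstellation.exists_isStarData (hH : H.IsConstellation) :
    ∃ (G : Tournament (Fin (Fintype.card W))) (ctr : Fin (Fintype.card W) → Option _)
      (part : Fin (Fintype.card W) → Fin (Fintype.card W)) (θ : W ≃ Fin (Fintype.card W)),
      G.IsStarData ctr part ∧ ∀ v w, G.Adj (θ v) (θ w) ↔ H.Adj v w := by
  classical
  obtain ⟨θ, ctr, hθ, hc⟩ := hH
  let G : Tournament (Fin (Fintype.card W)) :=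
    { Adj := fun i j => H.Adj (θ.symm i) (θ.symm j)
      asymm := fun i j => H.asymm _ _
      total := fun i j hij => H.total _ _ fun h => hij (θ.symm.injective h) }
  let center : Fin (Fintype.card W) → Option (Fin (Fintype.card W)) := fun i =>
    if h : ∃ K, θ.symm i ∈ leaves ctr K then some (θ (ctr h.choose)) else none
  have hcenter : ∀ i c, center i = some c ↔ ∃ K, θ.symm i ∈ leaves ctr K ∧ c = θ (ctr K) := by
    intro i c
    by_cases h : ∃ K, θ.symm i ∈ leaves ctr K
    · have h1 : center i = some (θ (ctr h.choose)) := dif_pos h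
      rw [h1, Option.some_inj]
      constructor
      · rintro rfl; exact ⟨_, h.choose_spec, rfl⟩
      · rintro ⟨K, hK, rfl⟩
        rw [star_eq_of_mem_leaves h.choose_spec.1 hK.1]
    · have h1 : center i = none := dif_neg h
      rw [h1]
      constructor
      · intro h2; cases h2
      · rintro ⟨K, hK, -⟩; exact absurd ⟨K, hK⟩ h
  -- The number of cuts before a position serves as the index of its part.
  let num : ℕ → ℕ := fun i => ((Finset.range i).filter fun p => IsCut ctr p).card
  have hnum : ∀ i, num i ≤ i := fun i => (Finset.card_filter_le _ _).trans (by simp)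
  have hmono : Monotone num := fun i j hij =>
    Finset.card_le_card (Finset.filter_subset_filter _ (Finset.range_subset_range.2 hij))
  have hlt : ∀ {i j p}, i ≤ p → p < j → IsCut ctr p → num i < num j := by
    intro i j p h1 h2 h3
    apply Finset.card_lt_card
    refine ⟨Finset.filter_subset_filter _ (Finset.range_subset_range.2 (by omega)), fun h => ?_⟩
    have := h (Finset.mem_filter.2 ⟨Finset.mem_range.2 h2, h3⟩)
    simp at this; omega
  have heq : ∀ {i j}, i ≤ j → (∀ p, i ≤ p → p < j → ¬ IsCut ctr p) → num i = num j := by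
    intro i j hij h
    apply le_antisymm (hmono hij)
    apply Finset.card_le_card
    intro p hp
    rw [Finset.mem_filter, Finset.mem_range] at hp ⊢
    refine ⟨?_, hp.2⟩
    by_contra hcon
    exact h p (by omega) hp.1 hp.2
  refine ⟨G, center, fun i => ⟨num i, (hnum i).trans_lt i.2⟩, θ, ⟨?_, ?_, ?_, ?_, ?_⟩, ?_⟩
  · intro i j hij
    rw [hcenter, hcenter]
    have hadj : G.Adj j i ↔ (H.backwardGraph θ).Adj (θ.symm i) (θ.symm j) := by
      constructor
      · intro h
        exact Or.inr ⟨h, by simpa using hij⟩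
      · rintro (⟨-, h⟩ | ⟨h, -⟩)
        · exact absurd hij (by simpa using h.le)
        · exact h
    rw [hadj]
    constructor
    · intro h
      set v := θ.symm i
      set w := θ.symm j
      set K₀ := (H.backwardGraph θ).connectedComponentMk v
      have hv : v ∈ K₀.supp := rfl
      have hw : w ∈ K₀.supp := SimpleGraph.ConnectedComponent.sound h.reachable.symm
      let K : H.Star θ := ⟨K₀, v, hv, w, hw, h.ne⟩
      by_cases hvc : v = ctr K
      · right
        refine ⟨K, ⟨hw, fun hwc => h.ne (hvc.trans hwc.symm)⟩, ?_⟩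
        rw [← hvc, Equiv.apply_symm_apply]
      by_cases hwc : w = ctr K
      · left
        refine ⟨K, ⟨hv, hvc⟩, ?_⟩
        rw [← hwc, Equiv.apply_symm_apply]
      exact absurd h ((hθ K).2.2.2.2.1 v ⟨hv, hvc⟩ w ⟨hw, hwc⟩)
    · rintro (⟨K, hK, rfl⟩ | ⟨K, hK, rfl⟩)
      · rw [Equiv.symm_apply_apply]
        exact ((hθ K).2.2.2.1 _ hK).symm
      · rw [Equiv.symm_apply_apply]
        exact (hθ K).2.2.2.1 _ hK
  · intro i c hi
    obtain ⟨K, -, rfl⟩ := (hcenter _ _).1 hi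
    rw [Option.eq_none_iff_forall_ne_some]
    intro c' hc'
    obtain ⟨M, hM, -⟩ := (hcenter _ _).1 hc'
    rw [Equiv.symm_apply_apply] at hM
    have := star_eq_of_mem_leaves (hθ K).1 hM.1
    subst this
    exact hM.2 rfl
  · intro i j hij
    exact hmono hij
  · intro i c hi hic
    obtain ⟨K, hK, rfl⟩ := (hcenter _ _).1 hi
    rw [Fin.mk.injEq] at hic
    rcases le_total (i : ℕ) (θ (ctr K)) with h | h
    · obtain ⟨p, h1, h2, h3⟩ := exists_isCut hc hK h (Or.inl (by simp))
      exact (hlt h1 h2 h3).ne hic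
    · obtain ⟨p, h1, h2, h3⟩ := exists_isCut hc hK h (Or.inr (by simp))
      exact (hlt h1 h2 h3).ne hic.symm
  · intro i j c hi hj
    obtain ⟨K, hK, rfl⟩ := (hcenter _ _).1 hi
    obtain ⟨M, hM, hKM⟩ := (hcenter _ _).1 hj
    have := star_eq_of_mem_leaves (hθ K).1 (θ.injective hKM ▸ (hθ M).1)
    subst this
    rw [Fin.mk.injEq]
    rcases le_total i j with h | h
    · exact heq h fun p h1 h2 h3 => h3 K _ hK _ hM (by simp; omega)
    · exact (heq h fun p h1 h2 h3 => h3 K _ hM _ hK (by simp; omega)).symm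
  · intro v w
    change H.Adj _ _ ↔ _
    simp

end Constellation

end Tournament

/-! ### Numerical estimates -/

namespace Tournament

theorem lossExp_le {h : ℕ} (hh : 0 < h) : lossExp h ≤ 2 ^ (13 * h ^ 2) := by
  have h1 : 2 * h + 4 ≤ 2 ^ (h + 3) := by
    have := Nat.lt_two_pow_self (n := h)
    rw [pow_add]; omega
  calc lossExp h ≤ 2 ^ (h + 3) * 2 ^ (2 * h + 1) ^ 2 := Nat.mul_le_mul_right _ h1
    _ = 2 ^ (h + 3 + (2 * h + 1) ^ 2) := (pow_add _ _ _).symm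
    _ ≤ _ := Nat.pow_le_pow_right (by norm_num) (by nlinarith)

theorem two_mul_le_two_pow {h : ℕ} (hh : 0 < h) : 2 * h ≤ 2 ^ h := by
  obtain ⟨k, rfl⟩ : ∃ k, h = k + 1 := ⟨h - 1, by omega⟩
  have := Nat.lt_two_pow_self (n := k)
  rw [pow_succ]; omega

theorem chainExp_le {h : ℕ} (hh : 0 < h) :
    chainExp h + h + 4 ≤ 2 ^ (3 * 2 ^ (13 * h ^ 2)) := by
  set A := 2 ^ (13 * h ^ 2) with hA
  have h1 := lossExp_le hh
  have h0 : 26 * h ≤ A := by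
    calc 26 * h ≤ 2 ^ 5 * 2 ^ h := Nat.mul_le_mul (by norm_num) Nat.lt_two_pow_self.le
      _ = 2 ^ (5 + h) := (pow_add _ _ _).symm
      _ ≤ A := Nat.pow_le_pow_right (by norm_num) (by nlinarith)
  have h2 : (2 * h + 2) ^ 2 ^ (2 * h) ≤ 2 ^ A := by
    have h3 : 2 * h + 2 ≤ 2 ^ (2 * h) := by
      calc 2 * h + 2 ≤ 2 * (2 * h) := by omega
        _ ≤ _ := two_mul_le_two_pow (by omega)
    calc (2 * h + 2) ^ 2 ^ (2 * h) ≤ (2 ^ (2 * h)) ^ 2 ^ (2 * h) := Nat.pow_le_pow_left h3 _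
      _ = 2 ^ (2 * h * 2 ^ (2 * h)) := (pow_mul _ _ _).symm
      _ ≤ 2 ^ A := by
        apply Nat.pow_le_pow_right (by norm_num)
        calc 2 * h * 2 ^ (2 * h) ≤ 2 ^ (2 * h) * 2 ^ (2 * h) :=
              Nat.mul_le_mul_right _ Nat.lt_two_pow_self.le
          _ = 2 ^ (2 * h + 2 * h) := (pow_add _ _ _).symm
          _ ≤ A := Nat.pow_le_pow_right (by norm_num) (by nlinarith)
  have h3 : lossExp h + 8 * h + 11 + 2 ≤ 2 * A := by omega
  have h4 : A < 2 ^ A := Nat.lt_two_pow_self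
  have h5 : 0 < 2 ^ A := by positivity
  calc chainExp h + h + 4 ≤ 2 * A * 2 ^ A + 2 * A := by
        have := Nat.mul_le_mul h3 h2
        unfold chainExp; omega
    _ ≤ 4 * A * 2 ^ A := by nlinarith
    _ ≤ 2 ^ A * 2 ^ A * 2 ^ A := by
        apply Nat.mul_le_mul_right
        have : 4 ≤ 2 ^ A := by omega
        exact Nat.mul_le_mul this h4.le
    _ = _ := by ring

theorem ehCoeff_pos (h : ℕ) : 0 < ehCoeff h := by unfold ehCoeff; positivity

theorem ehCoeff_mul_le {h : ℕ} {b : ℝ} {k : ℕ} (hb : b ≤ 2 ^ k) (hk : k ≤ 2 ^ (50 * h ^ 2 + 1)) :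
    ehCoeff h * b ≤ 1 := by
  rw [ehCoeff, div_mul_eq_mul_div, one_mul, div_le_one (by positivity)]
  exact hb.trans (pow_le_pow_right₀ (by norm_num) hk)

theorem eight_mul_le {h : ℕ} (hh : 0 < h) : 8 * 2 ^ (13 * h ^ 2) ≤ 2 ^ (50 * h ^ 2 + 1) := by
  calc 8 * 2 ^ (13 * h ^ 2) = 2 ^ (3 + 13 * h ^ 2) := by rw [pow_add]; norm_num
    _ ≤ _ := Nat.pow_le_pow_right (by norm_num) (by nlinarith)

/-- With `A = 2 ^ (13 * h ^ 2)` the two factors are at most `2 ^ (3 * A)` and `2 ^ (A + 3)`; the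
definition of `ehCoeff` leaves room for `2 ^ (8 * A)`. -/
theorem ehCoeff_mul_chainExp {h : ℕ} (hh : 0 < h) :
    ehCoeff h * (chainExp h + h + 4 : ℕ) * 2 ^ (lossExp h + 3) ≤ 1 := by
  rw [mul_assoc]
  have h1 := lossExp_le hh
  have h2 := chainExp_le hh
  have h3 := eight_mul_le hh
  set A := 2 ^ (13 * h ^ 2) with hA
  have h4 : 1 ≤ A := Nat.one_le_two_pow
  apply ehCoeff_mul_le (k := 3 * A + (A + 3))
  · rw [pow_add _ (3 * A)]
    refine mul_le_mul (by exact_mod_cast h2) ?_ (by positivity) (by positivity)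
    exact pow_le_pow_right₀ (by norm_num) (by omega)
  · omega

theorem ehCoeff_mul_three {h : ℕ} (hh : 0 < h) :
    ehCoeff h * (3 * 2 ^ (lossExp h + h + 5) : ℕ) ≤ 1 := by
  have h1 := lossExp_le hh
  have h3 := eight_mul_le hh
  have h4 : h < 2 ^ (13 * h ^ 2) :=
    Nat.lt_two_pow_self.trans_le (Nat.pow_le_pow_right (by norm_num) (by nlinarith))
  apply ehCoeff_mul_le (k := 2 + (lossExp h + h + 5))
  · rw [pow_add _ 2]; push_cast
    exact mul_le_mul_of_nonneg_right (by norm_num) (by positivity)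
  · omega

/-- Needed for `1 / (1 - ε) ≤ 4 / 3` in the count of the colors. -/
theorem ehCoeff_le_half {h : ℕ} : ehCoeff h ≤ 1 / 4 := by
  unfold ehCoeff
  apply div_le_div_of_nonneg_left (by norm_num) (by norm_num)
  calc (4 : ℝ) = 2 ^ 2 := by norm_num
    _ ≤ _ := pow_le_pow_right₀ (by norm_num) (by
      calc 2 = 2 ^ 1 := by norm_num
        _ ≤ _ := Nat.pow_le_pow_right (by norm_num) (by omega))

/-- The fourfold exponential is a number of rounds that the program can easily produce in unary, by
doubling a list repeatedly. -/
theorem roundBound_le {h : ℕ} (hh : 0 < h) : roundBound h ≤ 2 ^ 2 ^ 2 ^ 2 ^ h := by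
  have h1 := lossExp_le hh
  set A := 2 ^ (13 * h ^ 2) with hA
  have h4 : h < 2 ^ h := Nat.lt_two_pow_self
  have h5 : 2 ^ h ≤ 2 ^ (2 * h) := Nat.pow_le_pow_right (by norm_num) (by omega)
  have h6 : 8 * (2 ^ (2 * h) * 2 ^ (2 * h)) ≤ A := by
    rw [show 8 = 2 ^ 3 by norm_num, ← pow_add, ← pow_add]
    exact Nat.pow_le_pow_right (by norm_num) (by nlinarith)
  have h7 : roundBound h ≤ 8 * A := by
    unfold roundBound
    set m := 2 ^ (2 * h)
    have : m * (h + 1) ≤ m * m := Nat.mul_le_mul_left _ (by omega)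
    have : m * (2 * m + 1) = 2 * (m * m) + m := by ring
    nlinarith
  refine h7.trans ?_
  calc 8 * A = 2 ^ (3 + 13 * h ^ 2) := by rw [pow_add, ← hA]; norm_num
    _ ≤ 2 ^ (4 * (2 * h) ^ 2) := Nat.pow_le_pow_right (by norm_num) (by nlinarith)
    _ ≤ _ := by
      apply Nat.pow_le_pow_right (by norm_num)
      calc 4 * (2 * h) ^ 2 ≤ 4 * (2 ^ h) ^ 2 := by gcongr; exact two_mul_le_two_pow hh
        _ = 2 ^ (2 * (h + 1)) := by rw [← pow_mul, show 2 * (h + 1) = 2 + h * 2 by ring, pow_add]; norm_num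
        _ ≤ 2 ^ (2 ^ (2 ^ h)) := by
          apply Nat.pow_le_pow_right (by norm_num)
          calc 2 * (h + 1) ≤ 2 ^ (h + 1) := two_mul_le_two_pow (by omega)
            _ ≤ _ := Nat.pow_le_pow_right (by norm_num) (by omega)

end Tournament

/-! ### The recursive search for a large transitive set -/

namespace Tournament

theorem nodup_of_pairwise {V : Type*} {T : Tournament V} {S : List V} (hS : S.Pairwise T.Adj) :
    S.Nodup :=
  hS.imp fun h => T.ne_of_adj h

/-- A longest list. -/
def longest {V : Type*} : List (List V) → List V
  | [] => []
  | x :: l => if (longest l).length ≤ x.length then x else longest l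

theorem longest_mem {V : Type*} {l : List (List V)} (hl : l ≠ []) : longest l ∈ l := by
  induction l with
  | nil => exact absurd rfl hl
  | cons x l ih =>
    unfold longest
    split_ifs with h
    · exact List.mem_cons_self
    · refine List.mem_cons_of_mem _ (ih ?_)
      rintro rfl
      simp [longest] at h

theorem length_le_longest {V : Type*} {l : List (List V)} {x : List V} (hx : x ∈ l) :
    x.length ≤ (longest l).length := by
  induction l with
  | nil => cases hx
  | cons y l ih =>
    unfold longest
    rcases List.mem_cons.1 hx with rfl | hx
    · split_ifs with h
      · exact le_rfl
      · omega
    · have := ih hx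
      split_ifs with h
      · omega
      · exact this

section Search

variable {V : Type*} (T : Tournament V) [DecidableRel T.Adj]

/-- The elements `z` of `Z` with `Dir b y z`. -/
def nbrs (b : Bool) (y : V) (Z : List V) : List V := Z.filter fun z => T.Dir b y z

/-- The elements of `Y` that have at least (for `c = true`) or less than (for `c = false`) `m`
neighbors in `Z`. -/
def sel (b c : Bool) (Y Z : List V) (m : ℕ) : List V :=
  Y.filter fun y => decide (m ≤ (T.nbrs b y Z).length) == c

/-- The four selections with a given threshold. -/
def sels (Y Z : List V) (m : ℕ) : List (List V) :=
  [T.sel true true Y Z m, T.sel true false Y Z m, T.sel false true Y Z m, T.sel false false Y Z m]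

/-- The selections from `Y` by degrees to `Z`. -/
def selAll (Y Z : List V) : List (List V) := Z.tails.flatMap fun s => T.sels Y Z s.length

/-- One round: apply `F` and all selections. -/
def step (F : List V → List V) (fam : List (List V)) : List (List V) :=
  fam ++ (fam.map F ++ fam.flatMap fun Y => fam.flatMap fun Z => T.selAll Y Z)

/-- The initial family: half of the vertices, and the singletons. -/
def start {V : Type*} (X : List V) : List (List V) := X.take (X.length / 2) :: X.map fun x => [x]

/-- The ordered transitive sets among the concatenations of two members of the family. -/
def cands (fam : List (List V)) : List (List V) :=
  fam.flatMap fun Y => fam.flatMap fun Z => if (Y ++ Z).Pairwise T.Adj then [Y ++ Z] else []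

/-- The recursive search, in `R` rounds on every level, with recursion depth at most `d`. -/
def search (R : ℕ) : ℕ → List V → List V
  | 0, X => X
  | d + 1, X => if X.length ≤ 1 then X else
      longest (T.cands ((T.step (search R d))^[R] (start X)))

variable {T}

theorem mem_cands {fam : List (List V)} {S : List V} :
    S ∈ T.cands fam ↔ S.Pairwise T.Adj ∧ ∃ Y ∈ fam, ∃ Z ∈ fam, Y ++ Z = S := by
  simp only [cands, List.mem_flatMap]
  constructor
  · rintro ⟨Y, hY, Z, hZ, h⟩
    split_ifs at h with h1
    · rw [List.mem_singleton] at h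
      subst h
      exact ⟨h1, Y, hY, Z, hZ, rfl⟩
    · cases h
  · rintro ⟨h, Y, hY, Z, hZ, rfl⟩
    exact ⟨Y, hY, Z, hZ, by rw [if_pos h]; exact List.mem_singleton_self _⟩

theorem mem_step {F : List V → List V} {fam : List (List V)} {S : List V} :
    S ∈ T.step F fam ↔ S ∈ fam ∨ (∃ Y ∈ fam, F Y = S) ∨
      ∃ Y ∈ fam, ∃ Z ∈ fam, ∃ m ≤ Z.length, ∃ b c, S = T.sel b c Y Z m := by
  have h1 : ∀ Y Z, S ∈ T.selAll Y Z ↔ ∃ m ≤ Z.length, ∃ b c, S = T.sel b c Y Z m := by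
    intro Y Z
    simp only [selAll, List.mem_flatMap, List.mem_tails, sels, List.mem_cons, List.not_mem_nil,
      or_false, Bool.exists_bool]
    constructor
    · rintro ⟨s, hs, h⟩
      exact ⟨s.length, hs.length_le, by tauto⟩
    · rintro ⟨m, hm, h⟩
      refine ⟨Z.drop (Z.length - m), List.drop_suffix _ _, ?_⟩
      rw [List.length_drop, show Z.length - (Z.length - m) = m by omega]
      tauto
  simp only [step, List.mem_append, List.mem_map, List.mem_flatMap, h1]

variable (T) in
/-- The family of sets after `r` rounds. -/
def fam (R d : ℕ) (X : List V) (r : ℕ) : List (List V) := (T.step (T.search R d))^[r] (start X)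

theorem fam_succ (R d : ℕ) (X : List V) (r : ℕ) :
    T.fam R d X (r + 1) = T.step (T.search R d) (T.fam R d X r) :=
  Function.iterate_succ_apply' _ _ _

theorem fam_mono {R d r s : ℕ} {X Y : List V} (hrs : r ≤ s) (hY : Y ∈ T.fam R d X r) :
    Y ∈ T.fam R d X s := by
  induction hrs with
  | refl => exact hY
  | step _ ih => rw [fam_succ]; exact mem_step.2 (Or.inl ih)

theorem search_succ {R d : ℕ} {X : List V} (hX : 2 ≤ X.length) :
    T.search R (d + 1) X = longest (T.cands (T.fam R d X R)) := by
  rw [search, if_neg (by omega)]; rfl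

/-- No operation enlarges a set, so all members keep at most half of the size of `X`. This bounds
the recursion depth and makes the induction hypothesis applicable to every member. -/
theorem fam_sub {R d : ℕ} {X : List V} (hX : 2 ≤ X.length) (hd : X.length ≤ 2 ^ (d + 1))
    (ih : ∀ Y : List V, Y.length ≤ 2 ^ d →
      (T.search R d Y).Pairwise T.Adj ∧ T.search R d Y ⊆ Y) {r : ℕ} {Y : List V}
    (hY : Y ∈ T.fam R d X r) : Y ⊆ X ∧ Y.length ≤ X.length / 2 := by
  induction r generalizing Y with
  | zero =>
    change Y ∈ start X at hY
    rw [start, List.mem_cons, List.mem_map] at hY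
    rcases hY with rfl | ⟨x, hx, rfl⟩
    · exact ⟨List.take_subset _ _, List.length_take_le _ _⟩
    · refine ⟨by simpa using hx, ?_⟩
      rw [List.length_singleton]; omega
  | succ r ihr =>
    rw [fam_succ, mem_step] at hY
    rcases hY with hY | ⟨Z, hZ, rfl⟩ | ⟨Y', hY', Z, -, m, -, b, c, rfl⟩
    · exact ihr hY
    · obtain ⟨h1, h2⟩ := ihr hZ
      obtain ⟨h3, h4⟩ := ih Z (by rw [pow_succ] at hd; omega)
      exact ⟨fun x hx => h1 (h4 hx),
        ((nodup_of_pairwise h3).subperm h4).length_le.trans h2⟩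
    · obtain ⟨h1, h2⟩ := ihr hY'
      exact ⟨fun x hx => h1 (List.mem_of_mem_filter hx), (List.length_filter_le _ _).trans h2⟩

theorem mem_fam_singleton {R d : ℕ} {X : List V} (r : ℕ) {x : V} (hx : x ∈ X) :
    [x] ∈ T.fam R d X r :=
  fam_mono (Nat.zero_le r) (List.mem_cons_of_mem _ (List.mem_map.2 ⟨x, hx, rfl⟩))

theorem mem_fam_half {R d : ℕ} {X : List V} (r : ℕ) : X.take (X.length / 2) ∈ T.fam R d X r :=
  fam_mono (Nat.zero_le r) List.mem_cons_self

theorem mem_fam_search {R d r : ℕ} {X Y : List V} (hY : Y ∈ T.fam R d X r) :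
    T.search R d Y ∈ T.fam R d X (r + 1) := by
  rw [fam_succ]; exact mem_step.2 (Or.inr (Or.inl ⟨Y, hY, rfl⟩))

theorem mem_fam_sel {R d r m : ℕ} {X Y Z : List V} {b c : Bool} (hY : Y ∈ T.fam R d X r)
    (hZ : Z ∈ T.fam R d X r) (hm : m ≤ Z.length) : T.sel b c Y Z m ∈ T.fam R d X (r + 1) := by
  rw [fam_succ]; exact mem_step.2 (Or.inr (Or.inr ⟨Y, hY, Z, hZ, m, hm, b, c, rfl⟩))

/-- The search tries all concatenations of two members; this is the source of the field `bound` of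
`DefinableFamily`. -/
theorem le_length_search {R d : ℕ} {X Y Z : List V} (hX : 2 ≤ X.length)
    (hY : Y ∈ T.fam R d X R) (hZ : Z ∈ T.fam R d X R) (hYp : Y.Pairwise T.Adj)
    (hZp : Z.Pairwise T.Adj) (hYZ : ∀ y ∈ Y, ∀ z ∈ Z, T.Adj y z) :
    Y.length + Z.length ≤ (T.search R (d + 1) X).length := by
  rw [search_succ hX, ← List.length_append]
  exact length_le_longest (mem_cands.2 ⟨List.pairwise_append.2 ⟨hYp, hZp, hYZ⟩, Y, hY, Z, hZ, rfl⟩)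

theorem two_le_length_search {R d : ℕ} {X : List V} (hX : 2 ≤ X.length) (hXn : X.Nodup) :
    2 ≤ (T.search R (d + 1) X).length := by
  obtain ⟨x, y, l, rfl⟩ : ∃ x y l, X = x :: y :: l := by
    match X, hX with
    | x :: y :: l, _ => exact ⟨x, y, l, rfl⟩
  have hxy : x ≠ y := by
    rintro rfl
    simp at hXn
  have hx : [x] ∈ T.fam R d (x :: y :: l) R := mem_fam_singleton R (by simp)
  have hy : [y] ∈ T.fam R d (x :: y :: l) R := mem_fam_singleton R (by simp)
  rcases T.total x y hxy with h | h
  · exact le_length_search hX hx hy (List.pairwise_singleton _ _) (List.pairwise_singleton _ _)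
      (by simpa using h)
  · exact le_length_search hX hy hx (List.pairwise_singleton _ _) (List.pairwise_singleton _ _)
      (by simpa using h)

theorem search_of_length_le_one {R d : ℕ} {X : List V} (hX : X.length ≤ 1) :
    T.search R d X = X := by
  cases d with
  | zero => rfl
  | succ d => rw [search, if_pos hX]

theorem search_spec (R : ℕ) : ∀ (d : ℕ) (X : List V), X.length ≤ 2 ^ d →
    (T.search R d X).Pairwise T.Adj ∧ T.search R d X ⊆ X := by
  have hone : ∀ (d : ℕ) (X : List V), X.length ≤ 1 →
      (T.search R d X).Pairwise T.Adj ∧ T.search R d X ⊆ X := by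
    intro d X hX
    rw [search_of_length_le_one hX]
    refine ⟨?_, List.Subset.refl _⟩
    match X, hX with
    | [], _ => exact List.Pairwise.nil
    | [x], _ => exact List.pairwise_singleton _ _
  intro d
  induction d with
  | zero => exact fun X hX => hone 0 X (by simpa using hX)
  | succ d ih =>
    intro X hX
    rcases Nat.lt_or_ge X.length 2 with h | h
    · exact hone _ X (by omega)
    rw [search_succ h]
    by_cases hne : T.cands (T.fam R d X R) = []
    · rw [hne]
      exact ⟨List.Pairwise.nil, List.nil_subset _⟩
    obtain ⟨h1, Y, hY, Z, hZ, h2⟩ := mem_cands.1 (longest_mem hne)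
    refine ⟨h1, ?_⟩
    rw [← h2]
    exact List.append_subset.2 ⟨(fam_sub h hX ih hY).1, (fam_sub h hX ih hZ).1⟩

theorem length_search_le {R d : ℕ} {X : List V} (hX : X.length ≤ 2 ^ d) :
    (T.search R d X).length ≤ X.length :=
  ((nodup_of_pairwise (search_spec R d X hX).1).subperm (search_spec R d X hX).2).length_le

end Search

theorem isChain_of_pairwise {V : Type*} {T : Tournament V} [DecidableEq V] {S : List V} (hS : S.Pairwise T.Adj) :
    T.IsChain S.toFinset := by
  have hn := nodup_of_pairwise hS
  have hadj : ∀ x ∈ S, ∀ y ∈ S, S.idxOf x < S.idxOf y → T.Adj x y := by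
    intro x hx y hy h
    have := List.pairwise_iff_getElem.1 hS _ _ (List.idxOf_lt_length_iff.2 hx)
      (List.idxOf_lt_length_iff.2 hy) h
    simpa using this
  have hinj : ∀ x ∈ S, ∀ y ∈ S, S.idxOf x = S.idxOf y → x = y := by
    intro x hx y hy h
    exact (List.idxOf_inj hx).1 h
  refine ⟨fun x => S.idxOf x, ?_, ?_, ?_⟩
  · intro x hx y hy h
    simp only [List.coe_toFinset, Set.mem_ofPred_eq] at hx hy
    exact hinj x hx y hy h
  · intro x hx
    rw [List.toFinset_card_of_nodup hn]
    exact List.idxOf_lt_length_iff.2 (List.mem_toFinset.1 hx)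
  · intro x hx y hy
    rw [List.mem_toFinset] at hx hy
    refine ⟨fun h => ?_, hadj x hx y hy⟩
    by_contra hcon
    rcases (not_lt.1 hcon).eq_or_lt with h1 | h1
    · rw [hinj _ hy _ hx h1] at h
      exact T.irrefl _ h
    · exact T.asymm _ _ h (hadj y hy x hx h1)

/-! ### The size of the transitive set found by the search. -/

section Search

variable {V : Type*} {T : Tournament V} [DecidableRel T.Adj]

theorem deg_toFinset [DecidableEq V] {b : Bool} {Z : List V} (hZ : Z.Nodup) (y : V) :
    T.deg b Z.toFinset y = (T.nbrs b y Z).length := by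
  unfold deg nbrs
  rw [← List.toFinset_card_of_nodup (hZ.filter _), List.toFinset_filter]
  congr 1
  ext z
  simp

/-- Both families that are needed, lists without repetition and ordered transitive lists, are given
by a property `P` that passes to sublists. -/
theorem selClosed_fam [DecidableEq V] {R d : ℕ} {X : List V} (P : List V → Prop)
    (hP : ∀ S S', S'.Sublist S → P S → P S') :
    T.SelClosed (fun r A => ∃ Y ∈ T.fam R d X r, Y.Nodup ∧ Y.toFinset = A)
      (fun r A => ∃ Y ∈ T.fam R d X r, P Y ∧ Y.toFinset = A) := by
  have hmono : ∀ r A, (∃ Y ∈ T.fam R d X r, P Y ∧ Y.toFinset = A) →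
      ∃ Y ∈ T.fam R d X (r + 1), P Y ∧ Y.toFinset = A := by
    rintro r A ⟨Y, hY, hYP, rfl⟩
    exact ⟨Y, fam_mono (Nat.le_succ _) hY, hYP, rfl⟩
  have hsel : ∀ {r Y Z} (b c : Bool) (m : ℕ), Y ∈ T.fam R d X r → Z ∈ T.fam R d X r → P Y →
      m ≤ Z.length → ∃ Y' ∈ T.fam R d X (r + 1), P Y' ∧
        Y'.toFinset = Y.toFinset.filter fun y => decide (m ≤ (T.nbrs b y Z).length) = c := by
    intro r Y Z b c m hY hZ hYP hm
    refine ⟨_, mem_fam_sel (b := b) (c := c) hY hZ hm, hP _ _ List.filter_sublist hYP, ?_⟩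
    rw [sel, List.toFinset_filter]
    ext z
    simp
  refine ⟨hmono, ?_, ?_⟩
  · rintro r A Z' b m ⟨Y, hY, hYP, rfl⟩ ⟨Z, hZ, hZn, rfl⟩
    simp only [deg_toFinset hZn]
    by_cases hm : m ≤ Z.length
    · simpa using hsel b true m hY hZ hYP hm
    -- Thresholds above `Z.length` are not tried. Here no vertex qualifies, and the empty set arises
    -- as the set of vertices of degree less than `0`.
    · obtain ⟨Y', h1, h2, h3⟩ := hsel b false 0 hY hZ hYP (Nat.zero_le _)
      refine ⟨Y', h1, h2, h3.trans ?_⟩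
      ext y
      have := List.length_filter_le (fun z => decide (T.Dir b y z)) Z
      simp only [Nat.zero_le, decide_true, Bool.true_eq_false, Finset.mem_filter, and_false,
        List.mem_toFinset, false_iff, not_and]
      intro _ h
      unfold nbrs at h
      omega
  · rintro r A Z' b m ⟨Y, hY, hYP, rfl⟩ ⟨Z, hZ, hZn, rfl⟩
    simp only [deg_toFinset hZn]
    by_cases hm : m ≤ Z.length
    · simpa using hsel b false m hY hZ hYP hm
    · obtain ⟨Y', h1, h2, h3⟩ := hmono r _ ⟨Y, hY, hYP, rfl⟩
      refine ⟨Y', h1, h2, h3.trans ?_⟩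
      ext y
      have := List.length_filter_le (fun z => decide (T.Dir b y z)) Z
      simp only [Finset.mem_filter, List.mem_toFinset]
      refine ⟨fun h => ⟨h, ?_⟩, fun h => h.1⟩
      unfold nbrs
      omega

/-- The field `ext` is the induction hypothesis of the recursion, and `τ` is the length of the
output. -/
theorem definableFamily_fam [DecidableEq V] {R d : ℕ} {X : List V} {ε : ℝ} (hX : 2 ≤ X.length)
    (hd : X.length ≤ 2 ^ (d + 1))
    (ih : ∀ Y : List V, Y.Nodup → Y.length ≤ 2 ^ d →
      (Y.length : ℝ) ^ ε ≤ (T.search R d Y).length) :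
    T.DefinableFamily X.toFinset
      (fun r A => ∃ Y ∈ T.fam R d X r, Y.Nodup ∧ Y.toFinset = A)
      (fun r A => ∃ Y ∈ T.fam R d X r, Y.Pairwise T.Adj ∧ Y.toFinset = A) R
      (T.search R (d + 1) X).length ε where
  selD := selClosed_fam _ fun _ _ h h' => h'.sublist h
  selTr := selClosed_fam _ fun _ _ h h' => h'.sublist h
  ofTr := by
    rintro r A ⟨Y, hY, hp, rfl⟩
    exact ⟨Y, hY, nodup_of_pairwise hp, rfl⟩
  sub := by
    rintro r A ⟨Y, hY, -, rfl⟩ x hx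
    rw [List.mem_toFinset] at hx ⊢
    exact (fam_sub hX hd (search_spec R d) hY).1 hx
  single := by
    intro x hx
    exact ⟨[x], mem_fam_singleton 0 (List.mem_toFinset.1 hx), List.nodup_singleton x, by simp⟩
  chain := by
    rintro r A ⟨Y, hY, hp, rfl⟩
    exact isChain_of_pairwise hp
  ext := by
    rintro r A ⟨Y, hY, hn, rfl⟩
    have hYd : Y.length ≤ 2 ^ d := by
      have := (fam_sub hX hd (search_spec R d) hY).2
      rw [pow_succ] at hd; omega
    have hs := search_spec (T := T) R d Y hYd
    refine ⟨(T.search R d Y).toFinset, fun x hx => ?_, ⟨_, mem_fam_search hY, hs.1, rfl⟩, ?_⟩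
    · rw [List.mem_toFinset] at hx ⊢; exact hs.2 hx
    · rw [List.toFinset_card_of_nodup hn, List.toFinset_card_of_nodup (nodup_of_pairwise hs.1)]
      exact ih Y hn hYd
  bound := by
    rintro A B ⟨Y, hY, hYp, rfl⟩ ⟨Z, hZ, hZp, rfl⟩ h
    rw [List.toFinset_card_of_nodup (nodup_of_pairwise hYp),
      List.toFinset_card_of_nodup (nodup_of_pairwise hZp)]
    exact le_length_search hX hY hZ hYp hZp fun y hy z hz =>
      h y (List.mem_toFinset.2 hy) z (List.mem_toFinset.2 hz)

/-- The classical logarithmic bound, for sizes that the main argument does not reach: take a vertex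
`v` of the first half, search in its larger neighborhood there, and add `v` at the appropriate end.
This needs two rounds. -/
theorem log_le_length_search {R : ℕ} (hR : 2 ≤ R) : ∀ (j d : ℕ) (X : List V), X.Nodup →
    X.length ≤ 2 ^ d → 8 ^ j ≤ X.length → j + 1 ≤ (T.search R d X).length := by
  intro j
  induction j with
  | zero =>
    intro d X hXn hd hX
    rcases Nat.lt_or_ge X.length 2 with h | h
    · rw [search_of_length_le_one (by omega)]; simpa using hX
    · obtain ⟨d, rfl⟩ : ∃ d', d = d' + 1 := ⟨d - 1, by rcases d with _ | d <;> simp_all; omega⟩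
      have := two_le_length_search (T := T) (R := R) (d := d) h hXn
      omega
  | succ j ih =>
    intro d X hXn hd hX
    have h8 : 1 ≤ 8 ^ j := Nat.one_le_pow _ _ (by norm_num)
    rw [pow_succ] at hX
    obtain ⟨d, rfl⟩ : ∃ d', d = d' + 1 := ⟨d - 1, by
      rcases d with _ | d
      · simp only [pow_zero] at hd; omega
      · simp⟩
    have hX2 : 2 ≤ X.length := by omega
    set Y := X.take (X.length / 2) with hY
    have hYl : Y.length = X.length / 2 := by rw [hY, List.length_take]; omega
    have hYn : Y.Nodup := hXn.sublist (List.take_sublist _ _)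
    have hYf : Y ∈ T.fam R d X 0 := mem_fam_half 0
    obtain ⟨v, l, hvl⟩ : ∃ v l, Y = v :: l := by
      match hY' : Y, hYl with
      | [], h => simp at h; omega
      | v :: l, _ => exact ⟨v, l, rfl⟩
    have hvX : v ∈ X := List.take_subset _ _ (hY ▸ hvl ▸ List.mem_cons_self)
    have hvf : [v] ∈ T.fam R d X 0 := mem_fam_singleton 0 hvX
    rw [hvl, List.length_cons] at hYl
    have hsel : ∀ b y, y ∈ T.sel b true Y [v] 1 ↔ y ∈ Y ∧ T.Dir b y v := by
      intro b y
      simp only [sel, nbrs, List.mem_filter, beq_true]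
      refine and_congr_right fun _ => ?_
      by_cases h : T.Dir b y v <;> simp [h]
    -- Half of `X` without `v` has at least `4 * 8 ^ j - 1` vertices, so the in- or the
    -- out-neighborhood of `v` in it has at least `8 ^ j`.
    have hex : ∃ b, 8 ^ j ≤ (T.sel b true Y [v] 1).length := by
      by_contra hcon
      push Not at hcon
      have hsub : l ⊆ T.sel true true Y [v] 1 ++ T.sel false true Y [v] 1 := by
        intro y hy
        have hyY : y ∈ Y := by rw [hvl]; exact List.mem_cons_of_mem _ hy
        have hne : y ≠ v := by
          rintro rfl
          rw [hvl] at hYn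
          exact (List.nodup_cons.1 hYn).1 hy
        rw [List.mem_append, hsel, hsel]
        rcases T.total y v hne with h | h
        · exact Or.inl ⟨hyY, h⟩
        · exact Or.inr ⟨hyY, h⟩
      have hln : l.Nodup := (List.nodup_cons.1 (hvl ▸ hYn)).2
      have := (hln.subperm hsub).length_le
      rw [List.length_append] at this
      have := hcon true
      have := hcon false
      omega
    obtain ⟨b, hb⟩ := hex
    have hZf := mem_fam_sel (b := b) (c := true) hYf hvf (by simp : 1 ≤ [v].length)
    set Z := T.sel b true Y [v] 1 with hZ
    have hZl : Z.length ≤ 2 ^ d := by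
      have := (fam_sub hX2 hd (search_spec R d) hZf).2
      rw [pow_succ] at hd; omega
    have hs := search_spec (T := T) R d Z hZl
    have h1 := ih d Z (hYn.filter _) hZl hb
    have hSf : T.search R d Z ∈ T.fam R d X R := fam_mono hR (mem_fam_search hZf)
    have hvf' : [v] ∈ T.fam R d X R := fam_mono (Nat.zero_le _) hvf
    have hdir : ∀ y ∈ T.search R d Z, T.Dir b y v := fun y hy => ((hsel b y).1 (hs.2 hy)).2
    cases b
    · have := le_length_search hX2 hvf' hSf (List.pairwise_singleton _ _) hs.1 (by simpa using hdir)
      rw [List.length_singleton] at this; omega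
    · have := le_length_search hX2 hSf hvf' hs.1 (List.pairwise_singleton _ _) (by simpa using hdir)
      rw [List.length_singleton] at this; omega

/-- The search finds a transitive set with at least `|X| ^ ε` vertices. -/
theorem rpow_le_length_search {h : ℕ} {G : Tournament (Fin h)} {ctr : Fin h → Option (Fin h)}
    {part : Fin h → Fin h} (hG : G.IsStarData ctr part) (hh : 0 < h) (hfree : T.Free G) {R : ℕ}
    (hR : roundBound h ≤ R) : ∀ (d : ℕ) (X : List V), X.Nodup → X.length ≤ 2 ^ d →
      (X.length : ℝ) ^ ehCoeff h ≤ (T.search R d X).length := by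
  classical
  have hε := ehCoeff_pos h
  have hsmall : ∀ (d : ℕ) (X : List V), X.length ≤ 1 →
      (X.length : ℝ) ^ ehCoeff h ≤ (T.search R d X).length := by
    intro d X hX
    rw [search_of_length_le_one hX]
    rcases Nat.le_one_iff_eq_zero_or_eq_one.1 hX with h | h
    · rw [h, Nat.cast_zero, Real.zero_rpow hε.ne']
    · rw [h]; simp
  intro d
  induction d with
  | zero => exact fun X _ hX => hsmall 0 X (by simpa using hX)
  | succ d ih =>
    intro X hXn hd
    rcases Nat.lt_or_ge X.length 2 with hX | hX
    · exact hsmall _ X (by omega)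
    rcases le_total ((X.length : ℝ) ^ ehCoeff h) 2 with h1 | h1
    · refine h1.trans ?_
      exact_mod_cast two_le_length_search hX hXn
    set L := 2 ^ (lossExp h + h + 5) with hL
    rcases le_total ((X.length : ℝ) ^ ehCoeff h) L with h2 | h2
    -- Otherwise `X.length ^ ε < 2 ^ (3 * L * ε) ≤ 2`, against the present case.
    · have h3 : 8 ^ L ≤ X.length := by
        by_contra hcon
        push Not at hcon
        have h4 : (X.length : ℝ) < (2 : ℝ) ^ (3 * L) := by
          rw [pow_mul]; norm_num; exact_mod_cast hcon
        have h5 : (X.length : ℝ) ^ ehCoeff h < ((2 : ℝ) ^ (3 * L)) ^ ehCoeff h :=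
          Real.rpow_lt_rpow (Nat.cast_nonneg _) h4 hε
        rw [← Real.rpow_natCast, ← Real.rpow_mul (by norm_num)] at h5
        have h6 : (2 : ℝ) ^ (((3 * L : ℕ) : ℝ) * ehCoeff h) ≤ 2 ^ (1 : ℝ) := by
          apply Real.rpow_le_rpow_of_exponent_le (by norm_num)
          rw [mul_comm]
          exact ehCoeff_mul_three hh
        rw [Real.rpow_one] at h6
        linarith
      have hR2 : 2 ≤ R := le_trans (by unfold roundBound; omega) hR
      have := log_le_length_search (T := T) hR2 L (d + 1) X hXn hd h3
      refine h2.trans ?_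
      exact_mod_cast (Nat.le_succ _).trans this
    · refine (definableFamily_fam hX hd ih).rpow_le hG hh hfree hR hε (ehCoeff_mul_chainExp hh)
        (Y := (X.take (X.length / 2)).toFinset) ?_ ?_ ?_ (by exact_mod_cast h2)
      · intro x hx
        rw [List.mem_toFinset] at hx ⊢
        exact List.take_subset _ _ hx
      · exact ⟨_, mem_fam_half 0, hXn.sublist (List.take_sublist _ _), rfl⟩
      -- Rounding down to half the size leaves at least a third, as `X` has two or more elements.
      · rw [List.toFinset_card_of_nodup (hXn.sublist (List.take_sublist _ _)), List.length_take]
        omega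

end Search

end Tournament

/-! ### Coloring by repeated search -/

namespace Tournament

/-- Positions increase along every edge, but their sum is invariant under the rotation of a cycle.
-/
theorem isTransitive_of_pairwise {V : Type*} {T : Tournament V} [DecidableEq V] {S : List V} (hS : S.Pairwise T.Adj) :
    T.IsTransitive {v | v ∈ S} := by
  rintro k v ⟨hk, -, hv⟩ hvS
  obtain ⟨f, -, -, hf⟩ := isChain_of_pairwise hS
  have h1 : ∀ i, f (v i) < f (v (finRotate k i)) := fun i =>
    (hf _ (List.mem_toFinset.2 (hvS i)) _ (List.mem_toFinset.2 (hvS _))).1 (hv i)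
  have h2 : ∑ i, f (v i) < ∑ i, f (v (finRotate k i)) :=
    Finset.sum_lt_sum_of_nonempty ⟨⟨0, by omega⟩, Finset.mem_univ _⟩ fun i _ => h1 i
  rw [Equiv.sum_comp (finRotate k) fun i => f (v i)] at h2
  exact lt_irrefl _ h2

section Coloring

variable {V : Type*} {T : Tournament V} [DecidableRel T.Adj] [DecidableEq V]

variable (T) in
/-- The color classes: remove the set found by the search, and repeat. -/
def classes (R d : ℕ) : ℕ → List V → List (List V)
  | 0, _ => []
  | k + 1, X => if X = [] then [] else
      T.search R d X :: classes R d k (X.filter fun x => x ∉ T.search R d X)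

theorem classes_nil (R d k : ℕ) : T.classes R d k [] = [] := by
  cases k <;> simp [classes]

theorem length_filter_notMem {X S : List V} (hX : X.Nodup) (hS : S.Nodup) (h : S ⊆ X) :
    (X.filter fun x => x ∉ S).length + S.length = X.length := by
  rw [← List.toFinset_card_of_nodup (hX.filter _), ← List.toFinset_card_of_nodup hS,
    ← List.toFinset_card_of_nodup hX, List.toFinset_filter]
  have : (X.toFinset.filter fun x => decide (x ∉ S) = true) = X.toFinset \ S.toFinset := by
    ext x; simp
  rw [this]
  exact Finset.card_sdiff_add_card_eq_card fun x hx =>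
    List.mem_toFinset.2 (h (List.mem_toFinset.1 hx))

/-- Every nonempty set loses at least one vertex per class, so `X.length` repetitions exhaust `X`.
-/
theorem classes_spec {R d : ℕ} (hpos : ∀ X : List V, X.Nodup → X.length ≤ 2 ^ d → X ≠ [] →
      T.search R d X ≠ []) : ∀ (k : ℕ) (X : List V), X.Nodup → X.length ≤ 2 ^ d → X.length ≤ k →
    (∀ S ∈ T.classes R d k X, S.Pairwise T.Adj) ∧ ∀ x ∈ X, ∃ S ∈ T.classes R d k X, x ∈ S := by
  intro k
  induction k with
  | zero =>
    intro X _ _ hk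
    have : X = [] := List.length_eq_zero_iff.1 (by omega)
    subst this
    simp [classes]
  | succ k ih =>
    intro X hXn hXd hk
    by_cases hX : X = []
    · subst hX; simp [classes]
    have hs := search_spec (T := T) R d X hXd
    have hlen := length_filter_notMem hXn (nodup_of_pairwise hs.1) hs.2
    have hS := List.length_pos_iff.2 (hpos X hXn hXd hX)
    obtain ⟨h1, h2⟩ := ih (X.filter fun x => x ∉ T.search R d X) (hXn.filter _) (by omega)
      (by omega)
    rw [classes, if_neg hX]
    refine ⟨fun S hS => ?_, fun x hx => ?_⟩
    · rcases List.mem_cons.1 hS with rfl | hS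
      · exact hs.1
      · exact h1 S hS
    · by_cases hxS : x ∈ T.search R d X
      · exact ⟨_, List.mem_cons_self, hxS⟩
      · obtain ⟨S, hS, hxS'⟩ := h2 x (List.mem_filter.2 ⟨hx, by simpa using hxS⟩)
        exact ⟨S, List.mem_cons_of_mem _ hS, hxS'⟩

/-- One step of the induction on the number of colors, with the potential `r ^ (1 - ε) / (1 - ε)`:
by Bernoulli's inequality for the exponent `1 - ε`, removing at least `r ^ ε` vertices lowers it by
at least `1`. -/
theorem one_add_rpow_le {ε r s : ℝ} (hε : 0 < ε) (hε1 : ε ≤ 1 / 4) (hr : 0 < r) (hsr : s ≤ r)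
    (hs : r ^ ε ≤ s) : 1 + (r - s) ^ (1 - ε) / (1 - ε) ≤ r ^ (1 - ε) / (1 - ε) := by
  have h0 : 0 < 1 - ε := by linarith
  have h1 : (1 + -(s / r)) ^ (1 - ε) ≤ 1 + (1 - ε) * -(s / r) :=
    rpow_one_add_le_one_add_mul_self (by
      have : s / r ≤ 1 := (div_le_one hr).2 hsr
      linarith) h0.le (by linarith)
  have h2 : r - s = r * (1 + -(s / r)) := by field_simp; ring
  have h3 : 0 ≤ 1 + -(s / r) := by
    have : s / r ≤ 1 := (div_le_one hr).2 hsr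
    linarith
  rw [h2, Real.mul_rpow hr.le h3]
  have h4 : r ^ (1 - ε) * r ^ ε = r := by
    rw [← Real.rpow_add hr]; simp
  have hp : 0 < r ^ (1 - ε) := Real.rpow_pos_of_pos hr _
  have h5 : 1 ≤ r ^ (1 - ε) * (s / r) := by
    rw [mul_div_assoc', le_div_iff₀ hr, one_mul]
    calc r = r ^ (1 - ε) * r ^ ε := h4.symm
      _ ≤ _ := by gcongr
  rw [← sub_nonneg]
  have h6 : r ^ (1 - ε) * (1 + -(s / r)) ^ (1 - ε) ≤ r ^ (1 - ε) * (1 + (1 - ε) * -(s / r)) := by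
    gcongr
  have h7 : r ^ (1 - ε) * (1 + (1 - ε) * -(s / r)) / (1 - ε) =
      r ^ (1 - ε) / (1 - ε) - r ^ (1 - ε) * (s / r) := by
    field_simp; ring
  have h8 := div_le_div_of_nonneg_right h6 h0.le
  linarith

theorem length_classes_le {R d : ℕ} {ε : ℝ} (hε : 0 < ε) (hε1 : ε ≤ 1 / 4)
    (hF : ∀ X : List V, X.Nodup → X.length ≤ 2 ^ d →
      (X.length : ℝ) ^ ε ≤ (T.search R d X).length) : ∀ (k : ℕ) (X : List V), X.Nodup →
    X.length ≤ 2 ^ d →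
    ((T.classes R d k X).length : ℝ) ≤ (X.length : ℝ) ^ (1 - ε) / (1 - ε) := by
  have h0 : 0 < 1 - ε := by linarith
  intro k
  induction k with
  | zero =>
    intro X _ _
    simp only [classes, List.length_nil, Nat.cast_zero]
    positivity
  | succ k ih =>
    intro X hXn hXd
    by_cases hX : X = []
    · subst hX; simp only [classes, if_pos, List.length_nil, Nat.cast_zero]
      positivity
    have hs := search_spec (T := T) R d X hXd
    have hlen := length_filter_notMem hXn (nodup_of_pairwise hs.1) hs.2
    rw [classes, if_neg hX, List.length_cons]
    have h1 := ih (X.filter fun x => x ∉ T.search R d X) (hXn.filter _) (by omega)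
    have hr : (0 : ℝ) < X.length := by exact_mod_cast List.length_pos_iff.2 hX
    have h2 := one_add_rpow_le hε hε1 hr
      (by exact_mod_cast length_search_le (T := T) (R := R) hXd) (hF X hXn hXd)
    have h3 : ((X.filter fun x => x ∉ T.search R d X).length : ℝ) =
        X.length - (T.search R d X).length := by
      rw [← hlen]; push_cast; ring
    rw [h3] at h1
    push_cast
    linarith

theorem length_classes_le_log {R d : ℕ} {ε : ℝ} (hε : 0 < ε) (hε1 : ε ≤ 1 / 4)
    (hF : ∀ X : List V, X.Nodup → X.length ≤ 2 ^ d →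
      (X.length : ℝ) ^ ε ≤ (T.search R d X).length) (k : ℕ) {X : List V} (hXn : X.Nodup)
    (hXd : X.length ≤ 2 ^ d) (hX : 2 ≤ X.length) :
    ((T.classes R d k X).length : ℝ) ≤ (X.length : ℝ) ^ (1 - ε) * Real.logb 2 X.length := by
  have h0 : 0 < 1 - ε := by linarith
  rcases hX.eq_or_lt with h2 | h3
  -- For two vertices the factor `1 / (1 - ε)` cannot be absorbed by the logarithm, which is `1`;
  -- but here the first class has more than one vertex and so contains everything.
  · have hone : (T.classes R d k X).length ≤ 1 := by
      cases k with
      | zero => simp [classes]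
      | succ k =>
        have hs := search_spec (T := T) R d X hXd
        have hlen := length_filter_notMem hXn (nodup_of_pairwise hs.1) hs.2
        have h1 : (1 : ℝ) < (T.search R d X).length :=
          lt_of_lt_of_le (Real.one_lt_rpow (by exact_mod_cast hX) hε) (hF X hXn hXd)
        have h1' : 1 < (T.search R d X).length := by exact_mod_cast h1
        have h3 : (X.filter fun x => x ∉ T.search R d X) = [] :=
          List.length_eq_zero_iff.1 (by omega)
        rw [classes]
        split_ifs
        · simp
        · rw [h3, classes_nil]; simp
    rw [← h2]
    have h4 : (1 : ℝ) ≤ (2 : ℝ) ^ (1 - ε) := Real.one_le_rpow (by norm_num) h0.le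
    have h5 : Real.logb 2 ((2 : ℕ) : ℝ) = 1 := Real.logb_self_eq_one (by norm_num)
    rw [h5]
    have : ((T.classes R d k X).length : ℝ) ≤ 1 := by exact_mod_cast hone
    push_cast
    linarith
  · refine (length_classes_le hε hε1 hF k X hXn hXd).trans ?_
    rw [div_eq_mul_inv]
    have h3' : (3 : ℝ) ≤ X.length := by exact_mod_cast h3
    gcongr
    -- From three vertices on the logarithm exceeds `4 / 3`, because `2 ^ 4 < 3 ^ 3`.
    have h4 : (4 / 3 : ℝ) ≤ Real.logb 2 X.length := by
      rw [Real.le_logb_iff_rpow_le (by norm_num) (by linarith)]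
      refine le_trans ?_ h3'
      have h5 : ((2 : ℝ) ^ (4 / 3 : ℝ)) ^ 3 = 16 := by
        rw [← Real.rpow_natCast, ← Real.rpow_mul (by norm_num)]
        norm_num
      by_contra hcon
      push Not at hcon
      have : (3 : ℝ) ^ 3 < ((2 : ℝ) ^ (4 / 3 : ℝ)) ^ 3 := by gcongr
      rw [h5] at this
      norm_num at this
    refine le_trans ?_ h4
    rw [inv_eq_one_div, div_le_div_iff₀ h0 (by norm_num)]
    linarith

/-- The coloring that is found by repeated search. -/
theorem exists_coloring {h : ℕ} {G : Tournament (Fin h)} {ctr : Fin h → Option (Fin h)}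
    {part : Fin h → Fin h} (hG : G.IsStarData ctr part) (hh : 0 < h) (hfree : T.Free G) {R : ℕ}
    (hR : roundBound h ≤ R) {d : ℕ} {X : List V} (hXn : X.Nodup) (hX : ∀ v, v ∈ X)
    (hXd : X.length ≤ 2 ^ d) : ∃ c : V → Fin (T.classes R d X.length X).length,
      (∀ v, (c v : ℕ) = (T.classes R d X.length X).findIdx fun S => v ∈ S) ∧
      T.IsProperColoring c ∧
      (2 ≤ X.length → ((T.classes R d X.length X).length : ℝ) ≤
        (X.length : ℝ) ^ (1 - ehCoeff h) * Real.logb 2 X.length) ∧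
      ((T.classes R d X.length X).headD []).Nodup ∧
      (∀ v, v ∈ (T.classes R d X.length X).headD [] ↔ (c v : ℕ) = 0) ∧
      T.IsTransitive {v | v ∈ (T.classes R d X.length X).headD []} ∧
      (X.length : ℝ) ^ ehCoeff h ≤ ((T.classes R d X.length X).headD []).length := by
  have hε := ehCoeff_pos h
  have hF := rpow_le_length_search hG hh hfree hR d
  have hpos : ∀ X : List V, X.Nodup → X.length ≤ 2 ^ d → X ≠ [] → T.search R d X ≠ [] := by
    intro X hXn hXd hX h1
    have h2 := hF X hXn hXd
    have h3 : (0 : ℝ) < X.length := by exact_mod_cast List.length_pos_iff.2 hX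
    have := Real.rpow_pos_of_pos h3 (ehCoeff h)
    rw [h1] at h2
    simp only [List.length_nil, Nat.cast_zero] at h2
    linarith
  obtain ⟨hp, hcov⟩ := classes_spec hpos X.length X hXn hXd le_rfl
  have hlen := length_classes_le_log hε ehCoeff_le_half hF X.length hXn hXd
  have hhead : X ≠ [] → ∃ l, T.classes R d X.length X = T.search R d X :: l := by
    intro hX
    obtain ⟨k, hk⟩ : ∃ k, X.length = k + 1 :=
      ⟨X.length - 1, by have := List.length_pos_iff.2 hX; omega⟩
    rw [hk, classes, if_neg hX]
    exact ⟨_, rfl⟩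
  have hheadp : ((T.classes R d X.length X).headD []).Pairwise T.Adj := by
    cases hcl : T.classes R d X.length X with
    | nil => exact List.Pairwise.nil
    | cons S l => exact hp S (hcl ▸ List.mem_cons_self)
  refine ⟨fun v => ⟨(T.classes R d X.length X).findIdx fun S => v ∈ S, ?_⟩, fun v => rfl, ?_,
    hlen, nodup_of_pairwise hheadp, ?_, isTransitive_of_pairwise hheadp, ?_⟩
  · obtain ⟨S, hS, hv⟩ := hcov v (hX v)
    exact List.findIdx_lt_length_of_exists ⟨S, hS, by simpa using hv⟩
  · intro k v hv heq
    have hk : 0 < k := lt_of_lt_of_le (by norm_num) hv.1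
    have hlt : ∀ i, ((T.classes R d X.length X).findIdx fun S => v i ∈ S) <
        (T.classes R d X.length X).length := fun i => by
      obtain ⟨S, hS, hvi⟩ := hcov _ (hX (v i))
      exact List.findIdx_lt_length_of_exists ⟨S, hS, by simpa using hvi⟩
    refine isTransitive_of_pairwise (hp _ (List.getElem_mem (hlt ⟨0, hk⟩))) k v hv fun i => ?_
    have h1 := Fin.mk.inj (heq ⟨0, hk⟩ i)
    have h2 := List.findIdx_getElem (w := hlt i)
    simp only [h1]
    simpa using h2
  · intro v
    obtain ⟨l, hl⟩ := hhead (List.ne_nil_of_mem (hX v))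
    simp only [hl, List.headD_cons, List.findIdx_cons]
    by_cases hv : v ∈ T.search R d X <;> simp [hv]
  · by_cases hX0 : X = []
    · subst hX0
      simp [Real.zero_rpow hε.ne']
    · obtain ⟨l, hl⟩ := hhead hX0
      rw [hl]
      exact hF X hXn hXd

end Coloring

theorem Free.of_equiv {V W W' : Type*} {T : Tournament V} {H : Tournament W} {G : Tournament W'}
    (hT : T.Free H) (θ : W ≃ W') (hθ : ∀ v w, G.Adj (θ v) (θ w) ↔ H.Adj v w) : T.Free G :=
  ⟨fun f => hT.false ⟨⟨fun w => f (θ w), f.injective.comp θ.injective⟩, by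
    intro a b
    exact f.map_rel_iff.trans (hθ a b)⟩⟩

/-- The empty tournament embeds into every tournament, so freeness excludes `h = 0`. -/
theorem Free.card_pos {V W : Type*} [Fintype W] {T : Tournament V} {H : Tournament W}
    (hT : T.Free H) : 0 < Fintype.card W := by
  rw [Fintype.card_pos_iff]
  by_contra hcon
  rw [not_nonempty_iff] at hcon
  exact hT.false ⟨⟨fun w => isEmptyElim w, fun w => isEmptyElim w⟩, fun {w} => isEmptyElim w⟩

/-- A tournament without a given constellation has a proper coloring with few colors, and a large
transitive set. -/
theorem exists_coloring_and_transitive {W V : Type*} [Fintype W] [Fintype V] {H : Tournament W}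
    {T : Tournament V} (hH : H.IsConstellation) (hT : T.Free H) :
    (2 ≤ Fintype.card V →
        ∃ (k : ℕ) (c : V → Fin k), T.IsProperColoring c ∧
          (k : ℝ) ≤ (Fintype.card V : ℝ) ^ (1 - ehCoeff (Fintype.card W)) *
            Real.logb 2 (Fintype.card V)) ∧
      ∃ S : Finset V, T.IsTransitive (S : Set V) ∧
        (Fintype.card V : ℝ) ^ ehCoeff (Fintype.card W) ≤ (S.card : ℝ) := by
  classical
  obtain ⟨G, ctr, part, θ, hG, hθ⟩ := hH.exists_isStarData
  obtain ⟨X, hXn, hXm, hXl⟩ : ∃ X : List V, X.Nodup ∧ (∀ v, v ∈ X) ∧ X.length = Fintype.card V :=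
    ⟨Finset.univ.toList, Finset.nodup_toList _, fun v => by simp, by simp⟩
  -- For mere existence any sufficient recursion depth will do, here the number of vertices.
  obtain ⟨c, -, h1, h2, h3, -, h4, h5⟩ := exists_coloring (T := T) hG hT.card_pos
    (hT.of_equiv θ hθ) le_rfl hXn hXm (Nat.lt_two_pow_self (n := X.length)).le
  rw [← hXl]
  refine ⟨fun hn => ⟨_, c, h1, h2 hn⟩,
    ((T.classes (roundBound (Fintype.card W)) X.length X.length X).headD []).toFinset, ?_,
    h5.trans_eq ?_⟩
  · rwa [List.coe_toFinset]
  · rw [List.toFinset_card_of_nodup h3]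

end Tournament

/-! ### The program -/

namespace Machine

/-- Evaluation in at most `T` steps. -/
def Ev (P : Program) (env : List Data) (e : Expr) (v : Data) (T : ℕ) : Prop :=
  ∃ t ≤ T, Eval P env e v t

/-- The function number `f`, applied to `a`, has the value `v`, computed in at most `T` steps. -/
def Calls (P : Program) (f : ℕ) (a v : Data) (T : ℕ) : Prop :=
  ∃ body, P[f]? = some body ∧ Ev P [a] body v T

section Combinators

variable {P : Program} {env : List Data}

theorem Ev.mono {e : Expr} {v : Data} {S T : ℕ} (h : Ev P env e v S) (hST : S ≤ T) :
    Ev P env e v T :=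
  let ⟨t, ht, h⟩ := h; ⟨t, ht.trans hST, h⟩

theorem Calls.mono {f : ℕ} {a v : Data} {S T : ℕ} (h : Calls P f a v S) (hST : S ≤ T) :
    Calls P f a v T :=
  let ⟨b, hb, h⟩ := h; ⟨b, hb, h.mono hST⟩

theorem Ev.var (i : ℕ) : Ev P env (.var i) (env.getD i .nil) 1 := ⟨1, le_rfl, .var _ _⟩

theorem Ev.nil : Ev P env .nil .nil 1 := ⟨1, le_rfl, .nil _⟩

theorem Ev.cons {a b : Expr} {u v : Data} {S T : ℕ} (ha : Ev P env a u S) (hb : Ev P env b v T) :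
    Ev P env (.cons a b) (.cons u v) (S + T + 1) :=
  let ⟨s, hs, ha⟩ := ha; let ⟨t, ht, hb⟩ := hb; ⟨s + t + 1, by omega, .cons ha hb⟩

theorem Ev.head {a : Expr} {u : Data} {S : ℕ} (ha : Ev P env a u S) :
    Ev P env (.head a) u.head (S + 1) :=
  let ⟨s, hs, ha⟩ := ha; ⟨s + 1, by omega, .head ha⟩

theorem Ev.tail {a : Expr} {u : Data} {S : ℕ} (ha : Ev P env a u S) :
    Ev P env (.tail a) u.tail (S + 1) :=
  let ⟨s, hs, ha⟩ := ha; ⟨s + 1, by omega, .tail ha⟩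

theorem Ev.iteTrue {c a b : Expr} {x y v : Data} {S T : ℕ} (hc : Ev P env c (.cons x y) S)
    (ha : Ev P env a v T) : Ev P env (.ite c a b) v (S + T + 1) :=
  let ⟨s, hs, hc⟩ := hc; let ⟨t, ht, ha⟩ := ha; ⟨s + t + 1, by omega, .iteTrue hc ha⟩

theorem Ev.iteFalse {c a b : Expr} {v : Data} {S T : ℕ} (hc : Ev P env c .nil S)
    (hb : Ev P env b v T) : Ev P env (.ite c a b) v (S + T + 1) :=
  let ⟨s, hs, hc⟩ := hc; let ⟨t, ht, hb⟩ := hb; ⟨s + t + 1, by omega, .iteFalse hc hb⟩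

theorem Ev.letIn {a b : Expr} {u v : Data} {S T : ℕ} (ha : Ev P env a u S)
    (hb : Ev P (u :: env) b v T) : Ev P env (.letIn a b) v (S + T + 1) :=
  let ⟨s, hs, ha⟩ := ha; let ⟨t, ht, hb⟩ := hb; ⟨s + t + 1, by omega, .letIn ha hb⟩

theorem Ev.call {f : ℕ} {a : Expr} {u v : Data} {S T : ℕ} (ha : Ev P env a u S)
    (hf : Calls P f u v T) : Ev P env (.call f a) v (S + T + 1) :=
  let ⟨s, hs, ha⟩ := ha; let ⟨_, hb, t, ht, h⟩ := hf; ⟨s + t + 1, by omega, .call hb ha h⟩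

/-- Truth values as data. -/
def encodeBool : Bool → Data
  | true => .cons .nil .nil
  | false => .nil

theorem Ev.ite {c a b : Expr} {p : Bool} {v w : Data} {S T : ℕ}
    (hc : Ev P env c (encodeBool p) S) (ha : p = true → Ev P env a v T)
    (hb : p = false → Ev P env b w T) :
    Ev P env (.ite c a b) (bif p then v else w) (S + T + 1) := by
  cases p
  · exact .iteFalse hc (hb rfl)
  · exact .iteTrue hc (ha rfl)

end Combinators

/-! #### The functions of the program -/

namespace Expr

/-- The first component of the argument. -/
abbrev fst : Expr := .head (.var 0)

/-- The second component of the argument. -/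
abbrev snd : Expr := .tail (.var 0)

/-- The list with a single element. -/
abbrev single (a : Expr) : Expr := .cons a .nil

/-- The truth value `true`. -/
abbrev tt : Expr := .cons .nil .nil

/-- The function number `self`, which concatenates the values of the function number `f` at the
pairs of a fixed first component and an element of a list. -/
abbrev loop (self f : ℕ) : Expr :=
  .ite snd (.call 1 (.cons (.call f (.cons fst (.head snd))) (.call self (.cons fst (.tail snd)))))
    .nil

end Expr

open Machine.Expr in
/-- The program. -/
def prog : Program :=
  [ -- 0: main
    .letIn (.call 39 (.cons snd .nil))
      (.letIn (.call 35 (.cons (.cons (.tail (.var 1))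
          (.call 40 (.call 40 (.call 40 (.call 40 (.head (.var 1))))))) (.var 0)))
        (.cons (.call 38 (.cons (.var 0) (.var 1))) (.head (.var 0)))),
    -- 1: concatenation
    .ite fst (.cons (.head fst) (.call 1 (.cons (.tail fst) snd))) snd,
    -- 2: equality of numbers
    .ite fst (.ite snd (.call 2 (.cons (.tail fst) (.tail snd))) .nil) (.ite snd .nil tt),
    -- 3: membership
    .ite snd (.ite (.call 2 (.cons fst (.head snd))) tt (.call 3 (.cons fst (.tail snd)))) .nil,
    -- 4: the element of a list at a given position
    .ite snd (.call 4 (.cons (.tail fst) (.tail snd))) (.head fst),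
    -- 5: adjacency
    .call 3 (.cons (.tail snd) (.call 4 (.cons fst (.head snd)))),
    -- 6, 7: neighbors in a list
    .letIn (.head (.tail fst)) (.letIn (.tail (.tail (.head (.var 1))))
      (.ite (.ite (.var 1)
          (.call 5 (.cons (.head (.head (.var 2))) (.cons (.var 0) (.tail (.var 2)))))
          (.call 5 (.cons (.head (.head (.var 2))) (.cons (.tail (.var 2)) (.var 0)))))
        (single (.tail (.var 2))) .nil)),
    loop 7 6,
    -- 8: comparison of lengths
    .ite fst (.ite snd (.call 8 (.cons (.tail fst) (.tail snd))) .nil) tt,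
    -- 9, 10: selection by degree
    .letIn (.tail fst)
      (.ite (.call 8 (.cons (.tail (.head (.var 0))) (.call 7 (.cons (.cons (.head (.head (.var 1)))
          (.cons (.head (.tail (.var 0))) (.tail (.var 1)))) (.head (.head (.var 0)))))))
        (.ite (.tail (.tail (.var 0))) (single (.tail (.var 1))) .nil)
        (.ite (.tail (.tail (.var 0))) .nil (single (.tail (.var 1))))),
    loop 10 9,
    -- 11, 12: selections with given sets
    .letIn (.cons (.tail (.tail fst)) snd) (.letIn (.head (.tail (.head (.var 1))))
      (.cons (.call 10 (.cons (.cons (.head (.head (.var 2))) (.cons (.var 1) (.cons tt tt)))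
        (.var 0)))
      (.cons (.call 10 (.cons (.cons (.head (.head (.var 2))) (.cons (.var 1) (.cons tt .nil)))
        (.var 0)))
      (.cons (.call 10 (.cons (.cons (.head (.head (.var 2))) (.cons (.var 1) (.cons .nil tt)))
        (.var 0)))
      (.cons (.call 10 (.cons (.cons (.head (.head (.var 2))) (.cons (.var 1) (.cons .nil .nil)))
        (.var 0))) .nil))))),
    loop 12 11,
    -- 13: the tails of a list
    .ite (.var 0) (.cons (.var 0) (.call 13 (.tail (.var 0)))) tt,
    -- 14, 15, 16, 17: all selections
    .call 12 (.cons (.cons (.head fst) (.cons (.tail fst) snd)) (.call 13 snd)),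
    loop 15 14,
    .call 15 (.cons (.cons (.head fst) snd) (.tail fst)),
    loop 17 16,
    -- 18, 19: the search in all sets of the family
    single (.call 32 (.cons fst snd)),
    loop 19 18,
    -- 20, 21: the rounds
    .call 1 (.cons snd (.call 1 (.cons (.call 19 (.cons fst snd))
      (.call 17 (.cons (.cons (.head fst) snd) snd))))),
    .ite (.head snd)
      (.call 21 (.cons fst (.cons (.tail (.head snd)) (.call 20 (.cons fst (.tail snd))))))
      (.tail snd),
    -- 22: half of a list
    .ite (.tail snd) (.cons (.head fst) (.call 22 (.cons (.tail fst) (.tail (.tail snd))))) .nil,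
    -- 23, 24: the singletons
    single (single snd),
    loop 24 23,
    -- 25, 26: ordered transitive sets
    .ite snd (.ite (.call 5 (.cons (.head fst) (.cons (.tail fst) (.head snd))))
      (.call 25 (.cons fst (.tail snd))) .nil) tt,
    .ite snd (.ite (.call 25 (.cons (.cons fst (.head snd)) (.tail snd)))
      (.call 26 (.cons fst (.tail snd))) .nil) tt,
    -- 27, 28, 29, 30: the candidates
    .letIn (.call 1 (.cons (.tail fst) snd))
      (.ite (.call 26 (.cons (.head (.head (.var 1))) (.var 0))) (single (.var 0)) .nil),
    loop 28 27,
    .call 28 (.cons (.cons (.head fst) snd) (.tail fst)),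
    loop 30 29,
    -- 31: a longest list
    .ite (.var 0) (.letIn (.call 31 (.tail (.var 0)))
      (.ite (.call 8 (.cons (.var 0) (.head (.var 1)))) (.head (.var 1)) (.var 0))) .nil,
    -- 32: the search
    .ite (.tail snd)
      (.letIn (.call 21 (.cons fst (.cons (.tail fst)
          (.cons (.call 22 (.cons snd snd)) (.call 24 (.cons .nil snd))))))
        (.call 31 (.call 30 (.cons (.cons (.head (.head (.var 1))) (.var 0)) (.var 0))))) snd,
    -- 33, 34: the difference
    .ite (.call 3 (.cons snd fst)) .nil (single snd),
    loop 34 33,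
    -- 35: the color classes
    .ite snd (.letIn (.call 32 (.cons fst snd))
      (.cons (.var 0) (.call 35 (.cons (.head (.var 1))
        (.call 34 (.cons (.var 0) (.tail (.var 1)))))))) .nil,
    -- 36, 37, 38: the colors
    .ite snd (.ite (.call 3 (.cons fst (.head snd))) .nil
      (.cons .nil (.call 36 (.cons fst (.tail snd))))) .nil,
    single (.call 36 (.cons snd fst)),
    loop 38 37,
    -- 39: the vertices
    .ite fst (.cons snd (.call 39 (.cons (.tail fst) (.cons .nil snd)))) .nil,
    -- 40: a list of exponential length
    .ite (.var 0) (.letIn (.call 40 (.tail (.var 0))) (.call 1 (.cons (.var 0) (.var 0)))) tt ]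

/-! #### Lists -/

theorem calls_append (a b : List Data) :
    Calls prog 1 (.cons (encodeList a) (encodeList b)) (encodeList (a ++ b))
      (20 * a.length + 20) := by
  induction a with
  | nil =>
    exact ⟨_, rfl, (Ev.iteFalse (Ev.var 0).head (Ev.var 0).tail).mono (by simp)⟩
  | cons x a ih =>
    exact ⟨_, rfl, (Ev.iteTrue (Ev.var 0).head (.cons (Ev.var 0).head.head
      (.call (.cons (Ev.var 0).head.tail (Ev.var 0).tail) ih))).mono
        (by simp only [List.length_cons]; omega)⟩

/-- The cost of a loop over at most `l` elements, at which the function takes at most `B` steps and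
has a list of length at most `K` as its value. -/
def loopCost (l B K : ℕ) : ℕ := (l + 1) * (B + 20 * K + 60)

/-- All maps and filters over lists in the program are instances of this loop. The context `ctx` is
passed on unchanged, and concatenation costs `20` steps per element of a value. -/
theorem calls_loop {self f : ℕ} (hself : prog[self]? = some (Expr.loop self f)) {α : Type*}
    (enc : α → Data) (g : α → List Data) (ctx : Data) {B K : ℕ} : ∀ (l : List α) {m : ℕ},
    l.length ≤ m → (∀ x ∈ l, Calls prog f (.cons ctx (enc x)) (encodeList (g x)) B) →
    (∀ x ∈ l, (g x).length ≤ K) →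
    Calls prog self (.cons ctx (encodeList (l.map enc))) (encodeList (l.flatMap g))
      (loopCost m B K) := by
  intro l
  induction l with
  | nil =>
    intro m _ _ _
    refine ⟨_, hself, (Ev.iteFalse (Ev.var 0).tail .nil).mono ?_⟩
    unfold loopCost
    nlinarith [Nat.zero_le (m * (B + 20 * K + 60))]
  | cons x l ih =>
    intro m hm hf hK
    obtain ⟨m, rfl⟩ : ∃ m', m = m' + 1 := ⟨m - 1, by rw [List.length_cons] at hm; omega⟩
    have h1 := ih (m := m) (by simpa using hm) (fun y hy => hf y (List.mem_cons_of_mem _ hy))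
      fun y hy => hK y (List.mem_cons_of_mem _ hy)
    rw [List.flatMap_cons]
    refine ⟨_, hself, (Ev.iteTrue (Ev.var 0).tail (.call (.cons
      (.call (.cons (Ev.var 0).head (Ev.var 0).tail.head) (hf x List.mem_cons_self))
      (.call (.cons (Ev.var 0).head (Ev.var 0).tail.tail) h1)) (calls_append _ _))).mono ?_⟩
    have := hK x List.mem_cons_self
    unfold loopCost
    nlinarith

theorem calls_eq (a : ℕ) : ∀ b : ℕ, Calls prog 2 (.cons (encodeNat a) (encodeNat b))
    (encodeBool (decide (a = b))) (20 * (a + 1)) := by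
  induction a with
  | zero =>
    intro b
    cases b with
    | zero => exact ⟨_, rfl, (Ev.iteFalse (Ev.var 0).head (.iteFalse (Ev.var 0).tail
        (.cons .nil .nil))).mono (by omega)⟩
    | succ b => exact ⟨_, rfl, (Ev.iteFalse (Ev.var 0).head (.iteTrue (Ev.var 0).tail
        .nil)).mono (by omega)⟩
  | succ a ih =>
    intro b
    cases b with
    | zero => exact ⟨_, rfl, (Ev.iteTrue (Ev.var 0).head (.iteFalse (Ev.var 0).tail
        .nil)).mono (by omega)⟩
    | succ b =>
      have h : decide (a + 1 = b + 1) = decide (a = b) := by simp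
      rw [h]
      exact ⟨_, rfl, (Ev.iteTrue (Ev.var 0).head (.iteTrue (Ev.var 0).tail (.call
        (.cons (Ev.var 0).head.tail (Ev.var 0).tail.tail) (ih b)))).mono (by omega)⟩

theorem calls_le (s : List Data) : ∀ t : List Data,
    Calls prog 8 (.cons (encodeList s) (encodeList t))
      (encodeBool (decide (s.length ≤ t.length))) (20 * (s.length + 1)) := by
  induction s with
  | nil => exact fun t => ⟨_, rfl, (Ev.iteFalse (Ev.var 0).head (.cons .nil .nil)).mono (by simp)⟩
  | cons x s ih =>
    intro t
    cases t with
    | nil => exact ⟨_, rfl, (Ev.iteTrue (Ev.var 0).head (.iteFalse (Ev.var 0).tail .nil)).mono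
        (by simp only [List.length_cons]; omega)⟩
    | cons y t =>
      have h : decide ((x :: s).length ≤ (y :: t).length) = decide (s.length ≤ t.length) := by simp
      rw [h]
      exact ⟨_, rfl, (Ev.iteTrue (Ev.var 0).head (.iteTrue (Ev.var 0).tail (.call
        (.cons (Ev.var 0).head.tail (Ev.var 0).tail.tail) (ih t)))).mono
          (by simp only [List.length_cons]; omega)⟩

/-- Positions past the end also agree, as the head of `nil` is `nil`. -/
theorem calls_nth (x : ℕ) : ∀ l : List Data, Calls prog 4 (.cons (encodeList l) (encodeNat x))
    (l.getD x .nil) (20 * (x + 1)) := by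
  induction x with
  | zero =>
    intro l
    cases l with
    | nil => exact ⟨_, rfl, (Ev.iteFalse (Ev.var 0).tail (Ev.var 0).head.head).mono (by omega)⟩
    | cons y l => exact ⟨_, rfl, (Ev.iteFalse (Ev.var 0).tail (Ev.var 0).head.head).mono (by omega)⟩
  | succ x ih =>
    intro l
    cases l with
    | nil => exact ⟨_, rfl, (Ev.iteTrue (Ev.var 0).tail (.call
        (.cons (Ev.var 0).head.tail (Ev.var 0).tail.tail) (ih []))).mono (by omega)⟩
    | cons y l => exact ⟨_, rfl, (Ev.iteTrue (Ev.var 0).tail (.call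
        (.cons (Ev.var 0).head.tail (Ev.var 0).tail.tail) (ih l))).mono (by omega)⟩

theorem flatMap_single {α : Type*} (p : α → Bool) (enc : α → Data) (l : List α) :
    (l.flatMap fun x => bif p x then [enc x] else []) = (l.filter p).map enc := by
  induction l with
  | nil => rfl
  | cons x l ih =>
    rw [List.flatMap_cons, ih, List.filter_cons]
    cases p x <;> simp

/-! ### Lists of vertices: membership, adjacency, selections by degree. -/

section Vertices

variable {n : ℕ}

/-- Vertices as data. -/
abbrev encodeVertex (v : Fin n) : Data := encodeNat v

theorem encodeFins_eq (l : List (Fin n)) : encodeFins l = encodeList (l.map encodeVertex) := by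
  induction l with
  | nil => rfl
  | cons x l ih =>
    rw [List.map_cons, encodeList, ← ih]; rfl

/-- The cost of a membership test. -/
def memCost (n : ℕ) : ℕ := (n + 1) * (20 * (n + 1) + 40)

theorem calls_mem (y : Fin n) : ∀ (l : List (Fin n)) {m : ℕ}, l.length ≤ m →
    Calls prog 3 (.cons (encodeVertex y) (encodeFins l)) (encodeBool (decide (y ∈ l)))
      ((m + 1) * (20 * (n + 1) + 40)) := by
  intro l
  induction l with
  | nil => exact fun _ => ⟨_, rfl, (Ev.iteFalse (Ev.var 0).tail .nil).mono (by nlinarith)⟩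
  | cons x l ih =>
    intro m hm
    obtain ⟨m, rfl⟩ : ∃ m', m = m' + 1 := ⟨m - 1, by rw [List.length_cons] at hm; omega⟩
    have h1 := ih (m := m) (by simpa using hm)
    have hv : encodeBool (decide (y ∈ x :: l)) =
        bif decide ((y : ℕ) = x) then encodeBool true else encodeBool (decide (y ∈ l)) := by
      by_cases h : y = x
      · simp [h]
      · have h' : (y : ℕ) ≠ x := fun h' => h (Fin.ext h')
        simp [h, h']
    rw [hv]
    refine ⟨_, rfl, (Ev.iteTrue (Ev.var 0).tail (.ite (.call
      (.cons (Ev.var 0).head (Ev.var 0).tail.head) (calls_eq y x))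
      (fun _ => (Ev.cons .nil .nil).mono (Nat.le_add_left _ _)) fun _ => ((Ev.call
        (.cons (Ev.var 0).head (Ev.var 0).tail.tail) h1).mono (Nat.le_add_right _ 3)))).mono ?_⟩
    have := y.2
    nlinarith

variable {T : Tournament (Fin n)} [DecidableRel T.Adj] {adj : Fin n → List (Fin n)}

/-- The cost of an adjacency test. -/
def edgeCost (n : ℕ) : ℕ := memCost n + 20 * (n + 1) + 20

theorem calls_edge (hadj : IsAdjacencyLists T adj) (x y : Fin n) :
    Calls prog 5 (.cons (encodeAdj adj) (.cons (encodeVertex x) (encodeVertex y)))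
      (encodeBool (decide (T.Adj x y))) (edgeCost n) := by
  have h1 : (List.ofFn fun v => encodeFins (adj v)).getD x .nil = encodeFins (adj x) := by
    simp [List.getD_eq_getElem?_getD]
  have h2 := calls_nth x (List.ofFn fun v => encodeFins (adj v))
  rw [h1] at h2
  have h3 : (adj x).length ≤ n := by
    simpa using (hadj x).1.length_le_card
  have h4 := calls_mem y (adj x) h3
  have h5 : decide (y ∈ adj x) = decide (T.Adj x y) := by
    simp [(hadj x).2 y]
  rw [h5] at h4
  refine ⟨_, rfl, (Ev.call (.cons (Ev.var 0).tail.tail (.call (.cons (Ev.var 0).head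
    (Ev.var 0).tail.head) h2)) h4).mono ?_⟩
  have := x.2
  unfold edgeCost memCost
  omega

/-- The cost of the neighbors in a list. -/
def nbrsCost (n : ℕ) : ℕ := loopCost n (edgeCost n + 50) 1

theorem calls_nbrs (hadj : IsAdjacencyLists T adj) (b : Bool) (y : Fin n) {Z : List (Fin n)}
    (hZ : Z.length ≤ n) :
    Calls prog 7 (.cons (.cons (encodeAdj adj) (.cons (encodeBool b) (encodeVertex y)))
      (encodeFins Z)) (encodeFins (T.nbrs b y Z)) (nbrsCost n) := by
  have h := calls_loop (self := 7) (f := 6) rfl encodeVertex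
    (fun z => bif decide (T.Dir b y z) then [encodeVertex z] else [])
    (.cons (encodeAdj adj) (.cons (encodeBool b) (encodeVertex y))) (B := edgeCost n + 50) (K := 1)
    Z hZ ?_ ?_
  · rw [flatMap_single] at h
    rwa [encodeFins_eq, encodeFins_eq]
  · intro z _
    have h1 : Calls prog 6 (.cons (.cons (encodeAdj adj) (.cons (encodeBool b) (encodeVertex y)))
        (encodeVertex z)) (bif decide (T.Dir b y z) then .cons (encodeVertex z) .nil else .nil)
        (edgeCost n + 50) := by
      cases b
      · exact ⟨_, rfl, (Ev.letIn (Ev.var 0).head.tail.head (.letIn (Ev.var 1).head.tail.tail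
          (.ite (p := decide (T.Dir false y z)) (.iteFalse (Ev.var 1) (.call (.cons
            (Ev.var 2).head.head (.cons (Ev.var 2).tail (Ev.var 0))) (calls_edge hadj z y)))
            (fun _ => .cons (Ev.var 2).tail .nil)
            (fun _ => Ev.nil.mono (by omega))))).mono (by omega)⟩
      · exact ⟨_, rfl, (Ev.letIn (Ev.var 0).head.tail.head (.letIn (Ev.var 1).head.tail.tail
          (.ite (p := decide (T.Dir true y z)) (.iteTrue (Ev.var 1) (.call (.cons
            (Ev.var 2).head.head (.cons (Ev.var 0) (Ev.var 2).tail)) (calls_edge hadj y z)))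
            (fun _ => .cons (Ev.var 2).tail .nil)
            (fun _ => Ev.nil.mono (by omega))))).mono (by omega)⟩
    cases hd : decide (T.Dir b y z) <;> rw [hd] at h1 <;> exact h1
  · intro z _
    cases decide (T.Dir b y z) <;> simp

/-- The cost of a selection. -/
def selCost (n : ℕ) : ℕ := loopCost n (nbrsCost n + 20 * (n + 1) + 100) 1

theorem calls_sel (hadj : IsAdjacencyLists T adj) (b c : Bool) {Y Z s : List (Fin n)}
    (hY : Y.length ≤ n) (hZ : Z.length ≤ n) (hs : s.length ≤ n) :
    Calls prog 10 (.cons (.cons (encodeAdj adj) (.cons (.cons (encodeFins Z) (encodeFins s))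
      (.cons (encodeBool b) (encodeBool c)))) (encodeFins Y))
      (encodeFins (T.sel b c Y Z s.length)) (selCost n) := by
  have h := calls_loop (self := 10) (f := 9) rfl encodeVertex
    (fun y => bif decide (s.length ≤ (T.nbrs b y Z).length) == c then [encodeVertex y] else [])
    (.cons (encodeAdj adj) (.cons (.cons (encodeFins Z) (encodeFins s))
      (.cons (encodeBool b) (encodeBool c)))) (B := nbrsCost n + 20 * (n + 1) + 100) (K := 1)
    Y hY ?_ ?_
  · rw [flatMap_single] at h
    rwa [encodeFins_eq Y, encodeFins_eq (T.sel _ _ _ _ _)]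
  · intro y _
    have h1 := calls_le (s.map encodeVertex) ((T.nbrs b y Z).map encodeVertex)
    rw [List.length_map, List.length_map, ← encodeFins_eq, ← encodeFins_eq] at h1
    have h2 : Calls prog 9 (.cons (.cons (encodeAdj adj) (.cons (.cons (encodeFins Z)
        (encodeFins s)) (.cons (encodeBool b) (encodeBool c)))) (encodeVertex y))
        (bif decide (s.length ≤ (T.nbrs b y Z).length) then
            (bif c then .cons (encodeVertex y) .nil else .nil)
          else (bif c then .nil else .cons (encodeVertex y) .nil))
        (nbrsCost n + 20 * (n + 1) + 100) :=
      ⟨_, rfl, (Ev.letIn (Ev.var 0).head.tail (.ite (p := decide (s.length ≤ _)) (T := 8) (.call (.cons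
        (Ev.var 0).head.tail (.call (.cons (.cons (Ev.var 1).head.head (.cons (Ev.var 0).tail.head
          (Ev.var 1).tail)) (Ev.var 0).head.head) (calls_nbrs hadj b y hZ))) h1)
          (fun _ => .ite (Ev.var 0).tail.tail (fun _ => .cons (Ev.var 1).tail .nil)
            fun _ => Ev.nil.mono (by omega : 1 ≤ 4))
          (fun _ => .ite (Ev.var 0).tail.tail (fun _ => Ev.nil.mono (by omega : 1 ≤ 4))
            fun _ => .cons (Ev.var 1).tail .nil))).mono (by omega)⟩
    cases hd : decide (s.length ≤ (T.nbrs b y Z).length) <;> rw [hd] at h2 <;> cases c <;> exact h2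
  · intro y _
    cases decide (s.length ≤ (T.nbrs b y Z).length) == c <;> simp

theorem calls_sels (hadj : IsAdjacencyLists T adj) {Y Z s : List (Fin n)}
    (hY : Y.length ≤ n) (hZ : Z.length ≤ n) (hs : s.length ≤ n) :
    Calls prog 11 (.cons (.cons (encodeAdj adj) (.cons (encodeFins Y) (encodeFins Z)))
      (encodeFins s)) (encodeList ((T.sels Y Z s.length).map encodeFins))
      (4 * selCost n + 120) :=
  ⟨_, rfl, (Ev.letIn (.cons (Ev.var 0).head.tail.tail (Ev.var 0).tail)
    (.letIn (Ev.var 1).head.tail.head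
    (.cons (.call (.cons (.cons (Ev.var 2).head.head (.cons (Ev.var 1)
      (.cons (.cons .nil .nil) (.cons .nil .nil)))) (Ev.var 0)) (calls_sel hadj true true hY hZ hs))
    (.cons (.call (.cons (.cons (Ev.var 2).head.head (.cons (Ev.var 1)
      (.cons (.cons .nil .nil) .nil))) (Ev.var 0)) (calls_sel hadj true false hY hZ hs))
    (.cons (.call (.cons (.cons (Ev.var 2).head.head (.cons (Ev.var 1)
      (.cons .nil (.cons .nil .nil)))) (Ev.var 0)) (calls_sel hadj false true hY hZ hs))
    (.cons (.call (.cons (.cons (Ev.var 2).head.head (.cons (Ev.var 1)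
      (.cons .nil .nil))) (Ev.var 0)) (calls_sel hadj false false hY hZ hs))
    .nil)))))).mono (by omega)⟩

/-- The tails of a list serve as the unary thresholds from `0` to its length. -/
theorem calls_tails (l : List (Fin n)) : Calls prog 13 (encodeFins l)
    (encodeList (l.tails.map encodeFins)) (10 * (l.length + 1)) := by
  induction l with
  | nil => exact ⟨_, rfl, (Ev.iteFalse (Ev.var 0) (.cons .nil .nil)).mono (by simp)⟩
  | cons x l ih =>
    rw [List.tails, List.map_cons]
    exact ⟨_, rfl, (Ev.iteTrue (Ev.var 0) (.cons (Ev.var 0) (.call (Ev.var 0).tail ih))).mono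
      (by simp only [List.length_cons]; omega)⟩

/-- The cost of all selections from one set by degrees to another set. -/
def selAllCost (n : ℕ) : ℕ := loopCost (n + 1) (4 * selCost n + 120) 4 + 10 * (n + 1) + 40

theorem calls_selAll (hadj : IsAdjacencyLists T adj) {Y Z : List (Fin n)}
    (hY : Y.length ≤ n) (hZ : Z.length ≤ n) :
    Calls prog 14 (.cons (.cons (encodeAdj adj) (encodeFins Y)) (encodeFins Z))
      (encodeList ((T.selAll Y Z).map encodeFins)) (selAllCost n) := by
  have h := calls_loop (self := 12) (f := 11) rfl encodeFins
    (fun s => (T.sels Y Z s.length).map encodeFins)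
    (.cons (encodeAdj adj) (.cons (encodeFins Y) (encodeFins Z))) (m := n + 1)
    (B := 4 * selCost n + 120) (K := 4) Z.tails (by simpa using hZ)
    (fun s hs => calls_sels hadj hY hZ ((List.mem_tails _ _).1 hs |>.length_le.trans hZ))
    (fun s _ => by simp [Tournament.sels])
  rw [← List.map_flatMap] at h
  refine ⟨_, rfl, (Ev.call (.cons (.cons (Ev.var 0).head.head (.cons (Ev.var 0).head.tail
    (Ev.var 0).tail)) (.call (Ev.var 0).tail (calls_tails Z))) h).mono ?_⟩
  unfold selAllCost
  omega

theorem length_selAll (Y Z : List (Fin n)) : (T.selAll Y Z).length = 4 * (Z.length + 1) := by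
  rw [Tournament.selAll, List.length_flatMap]
  simp [Tournament.sels, mul_comm]

/-- The cost of all selections in a family of at most `s` sets. -/
def roundCost (n s : ℕ) : ℕ :=
  loopCost s (loopCost s (selAllCost n) (4 * (n + 1)) + 30) (s * (4 * (n + 1)))

theorem length_flatMap_le {α β : Type*} (l : List α) (g : α → List β) {K m : ℕ}
    (hl : l.length ≤ m) (h : ∀ x ∈ l, (g x).length ≤ K) : (l.flatMap g).length ≤ m * K := by
  rw [List.length_flatMap]
  refine (List.sum_le_card_nsmul _ K ?_).trans ?_
  · simpa using h
  · simpa using Nat.mul_le_mul_right K hl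

theorem length_flatMap_selAll {fam : List (List (Fin n))} {s : ℕ} (hs : fam.length ≤ s)
    (hfam : ∀ Y ∈ fam, Y.length ≤ n) (Y : List (Fin n)) :
    (fam.flatMap fun Z => T.selAll Y Z).length ≤ s * (4 * (n + 1)) :=
  length_flatMap_le _ _ hs fun Z hZ => by
    rw [length_selAll]
    have := hfam Z hZ
    omega

theorem calls_round (hadj : IsAdjacencyLists T adj) {fam : List (List (Fin n))} {s : ℕ}
    (hs : fam.length ≤ s) (hfam : ∀ Y ∈ fam, Y.length ≤ n) :
    Calls prog 17 (.cons (.cons (encodeAdj adj) (encodeList (fam.map encodeFins)))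
      (encodeList (fam.map encodeFins)))
      (encodeList ((fam.flatMap fun Y => fam.flatMap fun Z => T.selAll Y Z).map encodeFins))
      (roundCost n s) := by
  have h := calls_loop (self := 17) (f := 16) rfl encodeFins
    (fun Y => (fam.flatMap fun Z => T.selAll Y Z).map encodeFins)
    (.cons (encodeAdj adj) (encodeList (fam.map encodeFins))) (m := s)
    (B := loopCost s (selAllCost n) (4 * (n + 1)) + 30) (K := s * (4 * (n + 1))) fam hs
    (fun Y hY => ?_) fun Y _ => by
      rw [List.length_map]; exact length_flatMap_selAll hs hfam Y
  · rw [← List.map_flatMap] at h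
    exact h
  · have h1 := calls_loop (self := 15) (f := 14) rfl encodeFins
      (fun Z => (T.selAll Y Z).map encodeFins)
      (.cons (encodeAdj adj) (encodeFins Y)) (m := s)
      (B := selAllCost n) (K := 4 * (n + 1)) fam hs
      (fun Z hZ => calls_selAll hadj (hfam Y hY) (hfam Z hZ)) fun Z hZ => by
        rw [List.length_map, length_selAll]
        have := hfam Z hZ
        omega
    rw [← List.map_flatMap] at h1
    exact ⟨_, rfl, (Ev.call (.cons (.cons (Ev.var 0).head.head (Ev.var 0).tail)
      (Ev.var 0).head.tail) h1).mono (by omega)⟩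

end Vertices

/-! ### The cost of one level of the search. -/

/-- A bound for the number of sets after `r` rounds. -/
def famSize (n : ℕ) : ℕ → ℕ
  | 0 => n + 1
  | r + 1 => 2 * famSize n r + famSize n r * (famSize n r * (4 * (n + 1)))

/-- The cost of one round, when the recursive calls take at most `B` steps. -/
def stepCost (n s B : ℕ) : ℕ := roundCost n s + loopCost s (B + 10) 1 + 40 * s + 100

/-- The cost of a test for an ordered transitive set. -/
def sortedCost (n : ℕ) : ℕ := (2 * n + 1) * ((2 * n + 1) * (edgeCost n + 40) + 30)

/-- The cost of the candidates in a family of at most `s` sets. -/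
def candsCost (n s : ℕ) : ℕ := loopCost s (loopCost s (sortedCost n + 20 * n + 60) 1 + 30) s

/-- The cost of one level of the search, when the recursive calls take at most `B` steps. -/
def levelCost (n R B : ℕ) : ℕ :=
  (R + 1) * (stepCost n (famSize n R) B + 40) + 20 * (n + 1) + loopCost n 10 1 +
    (famSize n R * famSize n R + 1) * (20 * (2 * n + 1) + 40) + candsCost n (famSize n R) + 100

/-- The cost of the search with recursion depth `d`. -/
def searchCost (n R : ℕ) : ℕ → ℕ
  | 0 => 20
  | d + 1 => levelCost n R (searchCost n R d)

theorem famSize_mono (n : ℕ) : Monotone (famSize n) :=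
  monotone_nat_of_le_succ fun r => by simp only [famSize]; omega

/-- The list `Y` is only a counter: two of its cells are consumed for every element that is copied
from `X`. -/
theorem calls_half : ∀ (Y X : List Data), Y.length ≤ X.length → Calls prog 22
    (.cons (encodeList X) (encodeList Y)) (encodeList (X.take (Y.length / 2)))
    (20 * (Y.length + 1))
  | [], X, _ => by
    rw [List.length_nil, Nat.zero_div, List.take_zero]
    exact ⟨_, rfl, (Ev.iteFalse (Ev.var 0).tail.tail .nil).mono (by omega)⟩
  | [y], X, _ => by
    rw [List.length_singleton, show 1 / 2 = 0 from rfl, List.take_zero]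
    exact ⟨_, rfl, (Ev.iteFalse (Ev.var 0).tail.tail .nil).mono (by omega)⟩
  | y :: y' :: Y, X, h => by
    cases X with
    | nil => simp at h
    | cons x X =>
      have h1 := calls_half Y X (by simp only [List.length_cons] at h; omega)
      have h2 : (y :: y' :: Y).length / 2 = Y.length / 2 + 1 := by
        simp only [List.length_cons]; omega
      rw [h2, List.take_succ_cons]
      exact ⟨_, rfl, (Ev.iteTrue (Ev.var 0).tail.tail (.cons (Ev.var 0).head.head (.call (.cons
        (Ev.var 0).head.tail (Ev.var 0).tail.tail.tail) h1))).mono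
          (by simp only [List.length_cons]; omega)⟩

section Vertices

variable {n : ℕ}

theorem calls_singletons (X : List (Fin n)) (hX : X.length ≤ n) :
    Calls prog 24 (.cons .nil (encodeFins X)) (encodeList ((X.map fun x => [x]).map encodeFins))
      (loopCost n 10 1) := by
  have h := calls_loop (self := 24) (f := 23) rfl encodeVertex
    (fun x => [encodeFins [x]]) .nil (B := 10) (K := 1) X hX
    (fun x _ => ⟨_, rfl, (Ev.cons (.cons (Ev.var 0).tail .nil) .nil).mono (by omega)⟩)
    (fun _ _ => le_rfl)
  rw [← List.map_eq_flatMap] at h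
  rwa [encodeFins_eq X, List.map_map]

variable {T : Tournament (Fin n)} [DecidableRel T.Adj] {adj : Fin n → List (Fin n)}

theorem calls_step (hadj : IsAdjacencyLists T adj) {F : List (Fin n) → List (Fin n)}
    {g : Data} {fam : List (List (Fin n))} {s B : ℕ} (hs : fam.length ≤ s)
    (hfam : ∀ Y ∈ fam, Y.length ≤ n) (hF : ∀ Y ∈ fam,
      Calls prog 32 (.cons (.cons (encodeAdj adj) g) (encodeFins Y)) (encodeFins (F Y)) B) :
    Calls prog 20 (.cons (.cons (encodeAdj adj) g) (encodeList (fam.map encodeFins)))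
      (encodeList ((T.step F fam).map encodeFins)) (stepCost n s B) := by
  have h1 := calls_loop (self := 19) (f := 18) rfl encodeFins
    (fun Y => [encodeFins (F Y)]) (.cons (encodeAdj adj) g) (B := B + 10) (K := 1) fam hs
    (fun Y hY => ⟨_, rfl, (Ev.cons (.call (.cons (Ev.var 0).head (Ev.var 0).tail) (hF Y hY))
      .nil).mono (by omega)⟩) (fun _ _ => le_rfl)
  rw [← List.map_eq_flatMap] at h1
  have h2 := calls_round hadj hs hfam
  rw [Tournament.step, List.map_append, List.map_append, List.map_map]
  refine ⟨_, rfl, (Ev.call (.cons (Ev.var 0).tail (.call (.cons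
    (.call (.cons (Ev.var 0).head (Ev.var 0).tail) h1)
    (.call (.cons (.cons (Ev.var 0).head.head (Ev.var 0).tail) (Ev.var 0).tail) h2))
    (calls_append _ _))) (calls_append _ _)).mono ?_⟩
  simp only [List.length_map]
  unfold stepCost
  omega

theorem length_step_le {F : List (Fin n) → List (Fin n)} {fam : List (List (Fin n))} {s : ℕ}
    (hs : fam.length ≤ s) (hfam : ∀ Y ∈ fam, Y.length ≤ n) :
    (T.step F fam).length ≤ 2 * s + s * (s * (4 * (n + 1))) := by
  rw [Tournament.step, List.length_append, List.length_append, List.length_map]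
  have := length_flatMap_le fam (fun Y => fam.flatMap fun Z => T.selAll Y Z) hs
    fun Y _ => length_flatMap_selAll hs hfam Y
  omega

/-- The list `l` is the unary counter of the rounds. -/
theorem calls_rounds (hadj : IsAdjacencyLists T adj) {F : List (Fin n) → List (Fin n)}
    {g : Data} {s B : ℕ} : ∀ (l : List Data) (fam : List (List (Fin n))),
    (∀ j ≤ l.length, ((T.step F)^[j] fam).length ≤ s ∧ ∀ Y ∈ (T.step F)^[j] fam, Y.length ≤ n ∧
      Calls prog 32 (.cons (.cons (encodeAdj adj) g) (encodeFins Y)) (encodeFins (F Y)) B) →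
    Calls prog 21 (.cons (.cons (encodeAdj adj) g) (.cons (encodeList l)
      (encodeList (fam.map encodeFins))))
      (encodeList (((T.step F)^[l.length] fam).map encodeFins))
      ((l.length + 1) * (stepCost n s B + 40)) := by
  intro l
  induction l with
  | nil =>
    intro fam _
    exact ⟨_, rfl, (Ev.iteFalse (Ev.var 0).tail.head (Ev.var 0).tail.tail).mono
      (by rw [List.length_nil]; omega)⟩
  | cons x l ih =>
    intro fam h
    have h0 := h 0 (Nat.zero_le _)
    have h1 := calls_step hadj h0.1 (fun Y hY => (h0.2 Y hY).1) fun Y hY => (h0.2 Y hY).2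
    have h2 := ih (T.step F fam) fun j hj => by
      rw [← Function.iterate_succ_apply]
      exact h (j + 1) (by rw [List.length_cons]; omega)
    rw [List.length_cons, Function.iterate_succ_apply]
    refine ⟨_, rfl, (Ev.iteTrue (Ev.var 0).tail.head (.call (.cons (Ev.var 0).head (.cons
      (Ev.var 0).tail.head.tail (.call (.cons (Ev.var 0).head (Ev.var 0).tail.tail) h1))) h2)).mono
        ?_⟩
    rw [Nat.add_mul (l.length + 1)]
    omega

theorem calls_forall_adj (hadj : IsAdjacencyLists T adj) (x : Fin n) : ∀ (l : List (Fin n)) {m : ℕ},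
    l.length ≤ m → Calls prog 25 (.cons (.cons (encodeAdj adj) (encodeVertex x)) (encodeFins l))
      (encodeBool (decide (∀ y ∈ l, T.Adj x y))) ((m + 1) * (edgeCost n + 40)) := by
  intro l
  induction l with
  | nil =>
    intro m _
    simp only [List.not_mem_nil, false_imp_iff, implies_true, decide_true]
    exact ⟨_, rfl, (Ev.iteFalse (Ev.var 0).tail (.cons .nil .nil)).mono (by nlinarith)⟩
  | cons y l ih =>
    intro m hm
    obtain ⟨m, rfl⟩ : ∃ m', m = m' + 1 := ⟨m - 1, by rw [List.length_cons] at hm; omega⟩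
    have h1 := ih (m := m) (by simpa using hm)
    have hv : encodeBool (decide (∀ z ∈ y :: l, T.Adj x z)) = bif decide (T.Adj x y) then
        encodeBool (decide (∀ z ∈ l, T.Adj x z)) else .nil := by
      by_cases h : T.Adj x y <;> simp [h, encodeBool]
    rw [hv]
    refine ⟨_, rfl, (Ev.iteTrue (Ev.var 0).tail (.ite (.call (.cons (Ev.var 0).head.head
      (.cons (Ev.var 0).head.tail (Ev.var 0).tail.head)) (calls_edge hadj x y))
      (fun _ => .call (.cons (Ev.var 0).head (Ev.var 0).tail.tail) h1)
      (fun _ => Ev.nil.mono (by omega)))).mono ?_⟩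
    rw [Nat.add_mul (m + 1)]
    omega

theorem calls_sorted (hadj : IsAdjacencyLists T adj) {k : ℕ} : ∀ (l : List (Fin n)) {m : ℕ},
    l.length ≤ m → m ≤ k → Calls prog 26 (.cons (encodeAdj adj) (encodeFins l))
      (encodeBool (decide (l.Pairwise T.Adj))) ((m + 1) * ((k + 1) * (edgeCost n + 40) + 30)) := by
  intro l
  induction l with
  | nil =>
    intro m _ _
    have h : decide (([] : List (Fin n)).Pairwise T.Adj) = true := by simp
    rw [h]
    exact ⟨_, rfl, (Ev.iteFalse (Ev.var 0).tail (.cons .nil .nil)).mono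
      ((by omega : _ ≤ (k + 1) * (edgeCost n + 40) + 30).trans
        (Nat.le_mul_of_pos_left _ (Nat.succ_pos m)))⟩
  | cons y l ih =>
    intro m hm hk
    obtain ⟨m, rfl⟩ : ∃ m', m = m' + 1 := ⟨m - 1, by rw [List.length_cons] at hm; omega⟩
    rw [List.length_cons] at hm
    have h1 := ih (m := m) (by omega) (by omega)
    have hv : encodeBool (decide ((y :: l).Pairwise T.Adj)) = bif decide (∀ z ∈ l, T.Adj y z) then
        encodeBool (decide (l.Pairwise T.Adj)) else .nil := by
      simp only [List.pairwise_cons, Bool.decide_and]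
      cases decide (∀ z ∈ l, T.Adj y z) <;> rfl
    rw [hv]
    refine ⟨_, rfl, (Ev.iteTrue (Ev.var 0).tail (.ite (.call (.cons (.cons (Ev.var 0).head
      (Ev.var 0).tail.head) (Ev.var 0).tail.tail)
      (calls_forall_adj hadj y l (m := k) (by omega)))
      (fun _ => .call (.cons (Ev.var 0).head (Ev.var 0).tail.tail) h1)
      (fun _ => Ev.nil.mono (by omega)))).mono ?_⟩
    rw [Nat.add_mul (m + 1)]
    omega

theorem calls_cands (hadj : IsAdjacencyLists T adj) {fam : List (List (Fin n))} {s : ℕ}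
    (hs : fam.length ≤ s) (hfam : ∀ Y ∈ fam, Y.length ≤ n) :
    Calls prog 30 (.cons (.cons (encodeAdj adj) (encodeList (fam.map encodeFins)))
      (encodeList (fam.map encodeFins))) (encodeList ((T.cands fam).map encodeFins))
      (candsCost n s) := by
  have h1 : ∀ Y ∈ fam, ∀ Z ∈ fam, Calls prog 27
      (.cons (.cons (encodeAdj adj) (encodeFins Y)) (encodeFins Z))
      (encodeList ((if (Y ++ Z).Pairwise T.Adj then [Y ++ Z] else []).map encodeFins))
      (sortedCost n + 20 * n + 60) := by
    intro Y hY Z hZ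
    have hv : encodeList ((if (Y ++ Z).Pairwise T.Adj then [Y ++ Z] else []).map encodeFins) =
        bif decide ((Y ++ Z).Pairwise T.Adj) then .cons (encodeFins (Y ++ Z)) .nil else .nil := by
      by_cases h : (Y ++ Z).Pairwise T.Adj
      · rw [if_pos h, decide_eq_true h]; rfl
      · rw [if_neg h, decide_eq_false h]; rfl
    have h2 := calls_append (Y.map encodeVertex) (Z.map encodeVertex)
    rw [← List.map_append, ← encodeFins_eq, ← encodeFins_eq, ← encodeFins_eq, List.length_map] at h2
    rw [hv]
    have hYn := hfam Y hY
    have hZn := hfam Z hZ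
    refine ⟨_, rfl, (Ev.letIn (.call (.cons (Ev.var 0).head.tail (Ev.var 0).tail) h2)
      (.ite (.call (.cons (Ev.var 1).head.head (Ev.var 0))
        (calls_sorted hadj (k := 2 * n) (Y ++ Z) (m := 2 * n) (by rw [List.length_append]; omega)
          le_rfl)) (fun _ => .cons (Ev.var 0) .nil)
          (fun _ => Ev.nil.mono (by omega)))).mono ?_⟩
    unfold sortedCost
    omega
  have h2 := calls_loop (self := 30) (f := 29) rfl encodeFins
    (fun Y => (fam.flatMap fun Z => if (Y ++ Z).Pairwise T.Adj then [Y ++ Z] else []).map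
      encodeFins)
    (.cons (encodeAdj adj) (encodeList (fam.map encodeFins))) (m := s)
    (B := loopCost s (sortedCost n + 20 * n + 60) 1 + 30) (K := s) fam hs
    (fun Y hY => ?_) fun Y _ => by
      rw [List.length_map]
      exact (length_flatMap_le (K := 1) _ _ hs fun Z _ => by split_ifs <;> simp).trans (by simp)
  · rw [← List.map_flatMap] at h2
    exact h2
  · have h3 := calls_loop (self := 28) (f := 27) rfl encodeFins
      (fun Z => (if (Y ++ Z).Pairwise T.Adj then [Y ++ Z] else []).map encodeFins)
      (.cons (encodeAdj adj) (encodeFins Y)) (m := s) (K := 1) fam hs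
      (fun Z hZ => h1 Y hY Z hZ) fun Z hZ => by
        rw [List.length_map]; split_ifs <;> simp
    rw [← List.map_flatMap] at h3
    exact ⟨_, rfl, (Ev.call (.cons (.cons (Ev.var 0).head.head (Ev.var 0).tail)
      (Ev.var 0).head.tail) h3).mono (by omega)⟩

theorem length_longest_le {l : List (List (Fin n))} {k : ℕ} (h : ∀ Y ∈ l, Y.length ≤ k) :
    (Tournament.longest l).length ≤ k := by
  by_cases hl : l = []
  · subst hl; simp [Tournament.longest]
  · exact h _ (Tournament.longest_mem hl)

theorem calls_longest {k : ℕ} : ∀ (l : List (List (Fin n))) {m : ℕ}, l.length ≤ m →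
    (∀ Y ∈ l, Y.length ≤ k) → Calls prog 31 (encodeList (l.map encodeFins))
      (encodeFins (Tournament.longest l)) ((m + 1) * (20 * (k + 1) + 40)) := by
  intro l
  induction l with
  | nil => exact fun _ _ => ⟨_, rfl, (Ev.iteFalse (Ev.var 0) .nil).mono (by nlinarith)⟩
  | cons x l ih =>
    intro m hm hk
    obtain ⟨m, rfl⟩ : ∃ m', m = m' + 1 := ⟨m - 1, by rw [List.length_cons] at hm; omega⟩
    have hk' : ∀ Y ∈ l, Y.length ≤ k := fun Y hY => hk Y (List.mem_cons_of_mem _ hY)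
    have h1 := ih (m := m) (by simpa using hm) hk'
    have h2 := length_longest_le hk'
    have h3 := calls_le ((Tournament.longest l).map encodeVertex) (x.map encodeVertex)
    rw [List.length_map, List.length_map, ← encodeFins_eq, ← encodeFins_eq] at h3
    have hv : encodeFins (Tournament.longest (x :: l)) =
        bif decide ((Tournament.longest l).length ≤ x.length) then encodeFins x else
          encodeFins (Tournament.longest l) := by
      rw [Tournament.longest]
      by_cases h : (Tournament.longest l).length ≤ x.length <;> simp [h]
    rw [hv]
    refine ⟨_, rfl, (Ev.iteTrue (Ev.var 0) (.letIn (.call (Ev.var 0).tail h1)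
      (.ite (.call (.cons (Ev.var 0) (Ev.var 1).head) h3) (fun _ => (Ev.var 1).head)
        fun _ => (Ev.var 0).mono (by omega)))).mono ?_⟩
    rw [Nat.add_mul (m + 1)]
    omega

theorem length_cands_le {fam : List (List (Fin n))} {s : ℕ} (hs : fam.length ≤ s) :
    (T.cands fam).length ≤ s * s :=
  length_flatMap_le _ _ hs fun Y _ =>
    (length_flatMap_le (K := 1) _ _ hs fun Z _ => by split_ifs <;> simp).trans (by simp)

/-- The program receives no recursion depth; it stops on lists with at most one element. The depth
`d` only measures the cost and applies because the sets are halved. The list `g` carries the number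
of rounds in unary. -/
theorem calls_search (hadj : IsAdjacencyLists T adj) (g : List Data) : ∀ (d : ℕ) (X : List (Fin n)),
    X.length ≤ 2 ^ d → X.length ≤ n →
    Calls prog 32 (.cons (.cons (encodeAdj adj) (encodeList g)) (encodeFins X))
      (encodeFins (T.search g.length d X)) (searchCost n g.length d) := by
  have hone : ∀ (d : ℕ) (X : List (Fin n)), X.length ≤ 1 →
      Calls prog 32 (.cons (.cons (encodeAdj adj) (encodeList g)) (encodeFins X))
        (encodeFins (T.search g.length d X)) (searchCost n g.length d) := by
    intro d X hX
    rw [Tournament.search_of_length_le_one hX]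
    have h : 20 ≤ searchCost n g.length d := by
      cases d
      · exact le_rfl
      · simp only [searchCost, levelCost]; omega
    match X, hX with
    | [], _ => exact ⟨_, rfl, (Ev.iteFalse (Ev.var 0).tail.tail (Ev.var 0).tail).mono (by omega)⟩
    | [x], _ => exact ⟨_, rfl, (Ev.iteFalse (Ev.var 0).tail.tail (Ev.var 0).tail).mono (by omega)⟩
  intro d
  induction d with
  | zero => exact fun X hX _ => hone 0 X (by simpa using hX)
  | succ d ih =>
    intro X hX hXn
    rcases Nat.lt_or_ge X.length 2 with h | h
    · exact hone _ X (by omega)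
    set R := g.length with hR
    have hsub : ∀ {r Y}, Y ∈ T.fam R d X r → Y.length ≤ X.length / 2 := fun hY =>
      (Tournament.fam_sub h hX (Tournament.search_spec R d) hY).2
    have hsize : ∀ r, (T.fam R d X r).length ≤ famSize n r := by
      intro r
      induction r with
      | zero =>
        change (Tournament.start X).length ≤ _
        simp only [Tournament.start, famSize, List.length_cons, List.length_map]
        omega
      | succ r ihr =>
        rw [Tournament.fam_succ]
        exact length_step_le ihr fun Y hY => by have := hsub hY; omega
    have h1 := calls_rounds hadj (F := T.search R d) (g := encodeList g) (s := famSize n R)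
      (B := searchCost n R d) g (Tournament.start X) fun j hj =>
        ⟨(hsize j).trans (famSize_mono n hj), fun Y hY => by
          have h1 := hsub hY
          rw [pow_succ] at hX
          exact ⟨by omega, ih Y (by omega) (by omega)⟩⟩
    have h2 : T.search R (d + 1) X = Tournament.longest (T.cands (T.fam R d X R)) :=
      Tournament.search_succ h
    have h3 := calls_half (X.map encodeVertex) (X.map encodeVertex) le_rfl
    rw [← List.map_take, List.length_map, ← encodeFins_eq, ← encodeFins_eq] at h3
    have h4 := calls_singletons X hXn
    have hfn : ∀ Y ∈ T.fam R d X R, Y.length ≤ n := fun Y hY => by have := hsub hY; omega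
    have h5 := calls_cands hadj (hsize R) hfn
    have h6 := calls_longest (k := 2 * n) (T.cands (T.fam R d X R)) (length_cands_le (hsize R))
      fun Y hY => by
        obtain ⟨-, Y₁, hY₁, Y₂, hY₂, rfl⟩ := Tournament.mem_cands.1 hY
        have := hfn _ hY₁
        have := hfn _ hY₂
        rw [List.length_append]; omega
    rw [h2]
    obtain ⟨x, y, l, rfl⟩ : ∃ x y l, X = x :: y :: l := by
      match X, h with
      | x :: y :: l, _ => exact ⟨x, y, l, rfl⟩
    refine ⟨_, rfl, (Ev.iteTrue (Ev.var 0).tail.tail (.letIn (.call (.cons (Ev.var 0).head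
      (.cons (Ev.var 0).head.tail (.cons (.call (.cons (Ev.var 0).tail (Ev.var 0).tail) h3)
        (.call (.cons .nil (Ev.var 0).tail) h4)))) h1)
      (.call (.call (.cons (.cons (Ev.var 1).head.head (Ev.var 0)) (Ev.var 0)) h5) h6))).mono ?_⟩
    simp only [searchCost, levelCost, ← hR]
    omega

end Vertices

/-- Only the length of the list matters. Applied four times to the adjacency lists of the
constellation, whose number is `h`, this gives the counter of the rounds. -/
theorem calls_grow (l : List Data) : ∃ r : List Data, r.length = 2 ^ l.length ∧
    Calls prog 40 (encodeList l) (encodeList r) (60 * 2 ^ l.length) := by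
  induction l with
  | nil => exact ⟨[.nil], rfl, _, rfl, (Ev.iteFalse (Ev.var 0) (.cons .nil .nil)).mono (by simp)⟩
  | cons x l ih =>
    obtain ⟨r, hr, h⟩ := ih
    refine ⟨r ++ r, by simp [hr, pow_succ, mul_two], _, rfl, (Ev.iteTrue (Ev.var 0) (.letIn
      (.call (Ev.var 0).tail h) (.call (.cons (Ev.var 0) (Ev.var 0)) (calls_append r r)))).mono ?_⟩
    have : 0 < 2 ^ l.length := by positivity
    rw [List.length_cons, hr, pow_succ]
    omega

theorem calls_numbers (l : List Data) : ∀ k : ℕ,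
    Calls prog 39 (.cons (encodeList l) (encodeNat k))
      (encodeList ((List.range' k l.length).map encodeNat)) (20 * (l.length + 1)) := by
  induction l with
  | nil => exact fun k => ⟨_, rfl, (Ev.iteFalse (Ev.var 0).head .nil).mono (by simp)⟩
  | cons x l ih =>
    intro k
    refine ⟨_, rfl, (Ev.iteTrue (Ev.var 0).head (.cons (Ev.var 0).tail (.call
      (.cons (Ev.var 0).head.tail (.cons .nil (Ev.var 0).tail)) (ih (k + 1))))).mono ?_⟩
    rw [List.length_cons]
    omega

/-! ### Color classes, colors and the main function. -/

section Vertices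

variable {n : ℕ}

theorem calls_vertices (adj : Fin n → List (Fin n)) :
    Calls prog 39 (.cons (encodeAdj adj) .nil) (encodeFins (List.finRange n))
      (20 * (n + 1)) := by
  have h := calls_numbers (List.ofFn fun v => encodeFins (adj v)) 0
  have h1 : (List.range' 0 n).map encodeNat = (List.finRange n).map encodeVertex := by
    rw [← List.range_eq_range', ← List.map_coe_finRange_eq_range, List.map_map]
    rfl
  rw [List.length_ofFn, h1, ← encodeFins_eq] at h
  exact h

/-- The cost of the difference of two sets. -/
def diffCost (n : ℕ) : ℕ := loopCost n (memCost n + 30) 1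

theorem calls_diff {S X : List (Fin n)} (hS : S.length ≤ n) (hX : X.length ≤ n) :
    Calls prog 34 (.cons (encodeFins S) (encodeFins X))
      (encodeFins (X.filter fun x => x ∉ S)) (diffCost n) := by
  have h := calls_loop (self := 34) (f := 33) rfl encodeVertex
    (fun x => bif decide (x ∉ S) then [encodeVertex x] else []) (encodeFins S)
    (B := memCost n + 30) (K := 1) X hX ?_ ?_
  · rw [flatMap_single] at h
    rwa [encodeFins_eq X, encodeFins_eq (X.filter _)]
  · intro x _
    have h1 : Calls prog 33 (.cons (encodeFins S) (encodeVertex x))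
        (bif decide (x ∈ S) then .nil else .cons (encodeVertex x) .nil) (memCost n + 30) :=
      ⟨_, rfl, (Ev.ite (T := 4) (.call (.cons (Ev.var 0).tail (Ev.var 0).head) (calls_mem x S hS))
        (fun _ => Ev.nil.mono (by omega)) (fun _ => .cons (Ev.var 0).tail .nil)).mono (by
          unfold memCost; omega)⟩
    by_cases hx : x ∈ S
    · simp only [hx, decide_true, cond_true] at h1
      simpa [hx, encodeList] using h1
    · simp only [hx, decide_false, cond_false] at h1
      simpa [hx, encodeList] using h1
  · intro x _
    cases decide (x ∉ S) <;> simp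

/-- The cost of the color of a vertex. -/
def indexCost (n : ℕ) : ℕ := (n + 1) * (memCost n + 40)

theorem calls_index (x : Fin n) : ∀ (l : List (List (Fin n))) {m : ℕ}, l.length ≤ m →
    (∀ S ∈ l, S.length ≤ n) →
    Calls prog 36 (.cons (encodeVertex x) (encodeList (l.map encodeFins)))
      (encodeNat (l.findIdx fun S => x ∈ S)) ((m + 1) * (memCost n + 40)) := by
  intro l
  induction l with
  | nil => exact fun _ _ => ⟨_, rfl, (Ev.iteFalse (Ev.var 0).tail .nil).mono (by nlinarith)⟩
  | cons S l ih =>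
    intro m hm hS
    obtain ⟨m, rfl⟩ : ∃ m', m = m' + 1 := ⟨m - 1, by rw [List.length_cons] at hm; omega⟩
    have h1 := ih (m := m) (by simpa using hm) fun S hS' => hS S (List.mem_cons_of_mem _ hS')
    have h2 := calls_mem x S (hS S List.mem_cons_self)
    have hv : encodeNat ((S :: l).findIdx fun S => x ∈ S) = bif decide (x ∈ S) then .nil else
        .cons .nil (encodeNat (l.findIdx fun S => x ∈ S)) := by
      rw [List.findIdx_cons]
      cases decide (x ∈ S) <;> rfl
    rw [hv]
    refine ⟨_, rfl, (Ev.iteTrue (Ev.var 0).tail (.ite (T := (m + 1) * (memCost n + 40) + 10)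
      (.call (.cons (Ev.var 0).head (Ev.var 0).tail.head) h2) (fun _ => Ev.nil.mono (by omega))
      (fun _ => (Ev.cons .nil (.call (.cons (Ev.var 0).head (Ev.var 0).tail.tail) h1)).mono
        (by omega)))).mono ?_⟩
    rw [Nat.add_mul (m + 1)]
    unfold memCost
    omega

theorem calls_colors {l : List (List (Fin n))} (hl : l.length ≤ n) (hS : ∀ S ∈ l, S.length ≤ n)
    {X : List (Fin n)} (hX : X.length ≤ n) :
    Calls prog 38 (.cons (encodeList (l.map encodeFins)) (encodeFins X))
      (encodeList (X.map fun x => encodeNat (l.findIdx fun S => x ∈ S)))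
      (loopCost n (indexCost n + 10) 1) := by
  have h := calls_loop (self := 38) (f := 37) rfl encodeVertex
    (fun x => [encodeNat (l.findIdx fun S => x ∈ S)]) (encodeList (l.map encodeFins))
    (B := indexCost n + 10) (K := 1) X hX
    (fun x _ => ⟨_, rfl, (Ev.cons (.call (.cons (Ev.var 0).tail (Ev.var 0).head)
      (calls_index x l hl hS)) .nil).mono (by unfold indexCost; omega)⟩) (fun _ _ => le_rfl)
  rw [← List.map_eq_flatMap, ← encodeFins_eq] at h
  exact h

variable {T : Tournament (Fin n)} [DecidableRel T.Adj] {adj : Fin n → List (Fin n)}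

theorem length_classes_le_fuel (R d : ℕ) : ∀ (k : ℕ) (X : List (Fin n)),
    (T.classes R d k X).length ≤ k := by
  intro k
  induction k with
  | zero => intro X; simp [Tournament.classes]
  | succ k ih =>
    intro X
    rw [Tournament.classes]
    split_ifs
    · simp
    · have := ih (X.filter fun x => x ∉ T.search R d X)
      rw [List.length_cons]; omega

/-- As in the search, the number `k` belongs to the analysis alone: the program stops when no vertex
is left, and `hpos` ensures progress. -/
theorem calls_classes (hadj : IsAdjacencyLists T adj) (g : List Data) {d : ℕ}
    (hpos : ∀ X : List (Fin n), X.Nodup → X.length ≤ 2 ^ d → X ≠ [] →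
      T.search g.length d X ≠ []) : ∀ (k : ℕ) (X : List (Fin n)), X.Nodup → X.length ≤ 2 ^ d →
    X.length ≤ n → X.length ≤ k →
    Calls prog 35 (.cons (.cons (encodeAdj adj) (encodeList g)) (encodeFins X))
      (encodeList ((T.classes g.length d k X).map encodeFins))
      ((k + 1) * (searchCost n g.length d + diffCost n + 40)) := by
  intro k
  induction k with
  | zero =>
    intro X _ _ _ hk
    have : X = [] := List.length_eq_zero_iff.1 (by omega)
    subst this
    exact ⟨_, rfl, (Ev.iteFalse (Ev.var 0).tail .nil).mono (by omega)⟩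
  | succ k ih =>
    intro X hXn hXd hXN hk
    by_cases hX : X = []
    · subst hX
      rw [Tournament.classes, if_pos rfl]
      exact ⟨_, rfl, (Ev.iteFalse (Ev.var 0).tail .nil).mono (by nlinarith)⟩
    have hs := Tournament.search_spec (T := T) g.length d X hXd
    have hlen := Tournament.length_filter_notMem hXn (Tournament.nodup_of_pairwise hs.1) hs.2
    have hS := List.length_pos_iff.2 (hpos X hXn hXd hX)
    have h1 := ih (X.filter fun x => x ∉ T.search g.length d X) (hXn.filter _) (by omega)
      (by omega) (by omega)
    have h2 := calls_search hadj g d X hXd hXN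
    have h3 := calls_diff (S := T.search g.length d X) (X := X) (by omega) hXN
    rw [Tournament.classes, if_neg hX]
    obtain ⟨x, l, hxl⟩ : ∃ x l, X = x :: l := by
      match X, hX with
      | x :: l, _ => exact ⟨x, l, rfl⟩
    have htail : ∃ a b, encodeFins X = .cons a b := by
      rw [encodeFins_eq, hxl]; exact ⟨_, _, rfl⟩
    obtain ⟨a, b, hab⟩ := htail
    have hc : Ev prog [.cons (.cons (encodeAdj adj) (encodeList g)) (encodeFins X)]
        (.tail (.var 0)) (.cons a b) 2 := by
      rw [← hab]; exact (Ev.var 0).tail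
    refine ⟨_, rfl, (Ev.iteTrue hc (.letIn (.call (.cons (Ev.var 0).head (Ev.var 0).tail) h2)
      (.cons (Ev.var 0) (.call (.cons (Ev.var 1).head (.call (.cons (Ev.var 0) (Ev.var 1).tail) h3))
        h1)))).mono ?_⟩
    rw [Nat.add_mul (k + 1)]
    omega

/-- The cost of the program. -/
def mainCost (h n R d : ℕ) : ℕ :=
  60 * (2 ^ h + 2 ^ 2 ^ h + 2 ^ 2 ^ 2 ^ h + 2 ^ 2 ^ 2 ^ 2 ^ h) + 20 * (n + 1) +
    (n + 1) * (searchCost n R d + diffCost n + 40) + loopCost n (indexCost n + 10) 1 + 60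

theorem runs_prog {h : ℕ} (adjH : Fin h → List (Fin h)) (hadj : IsAdjacencyLists T adj) {R d : ℕ}
    (hR : R = 2 ^ 2 ^ 2 ^ 2 ^ h)
    (hpos : ∀ X : List (Fin n), X.Nodup → X.length ≤ 2 ^ d → X ≠ [] → T.search R d X ≠ [])
    (hn : n ≤ 2 ^ d) {cls : List (List (Fin n))} (hcls : T.classes R d n (List.finRange n) = cls)
    {k : ℕ} (c : Fin n → Fin k) (hc : ∀ v, (c v : ℕ) = cls.findIdx fun S => v ∈ S) :
    ∃ t ≤ mainCost h n R d, prog.Runs (.cons (encodeAdj adjH) (encodeAdj adj))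
      (.cons (encodeColoring c) (encodeFins (cls.headD []))) t := by
  obtain ⟨g₁, hg₁, h1⟩ := calls_grow (List.ofFn fun v => encodeFins (adjH v))
  obtain ⟨g₂, hg₂, h2⟩ := calls_grow g₁
  obtain ⟨g₃, hg₃, h3⟩ := calls_grow g₂
  obtain ⟨g, hg, h4⟩ := calls_grow g₃
  rw [List.length_ofFn] at hg₁ h1
  rw [hg₁] at hg₂ h2
  rw [hg₂] at hg₃ h3
  rw [hg₃] at hg h4
  obtain rfl : g.length = R := hg.trans hR.symm
  have hl : (List.finRange n).length = n := List.length_finRange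
  have h5 := calls_vertices adj
  have h6 := calls_classes hadj g hpos n (List.finRange n) (List.nodup_finRange n)
    (by rwa [hl]) hl.le hl.le
  have hspec := Tournament.classes_spec hpos n (List.finRange n) (List.nodup_finRange n)
    (by rwa [hl]) hl.le
  have hlen := length_classes_le_fuel (T := T) g.length d n (List.finRange n)
  rw [hcls] at h6 hspec hlen
  have h7 := calls_colors hlen (fun S hS => by
    simpa using (Tournament.nodup_of_pairwise (hspec.1 S hS)).length_le_card) hl.le
  have h8 : encodeList ((List.finRange n).map fun x => encodeNat (cls.findIdx fun S => x ∈ S)) =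
      encodeColoring c := by
    rw [encodeColoring, encodeFins_eq, List.ofFn_eq_map, List.map_map]
    congr 1
    apply List.map_congr_left
    intro v _
    exact (congrArg encodeNat (hc v)).symm
  rw [h8] at h7
  have h9 : (encodeList (cls.map encodeFins)).head = encodeFins (cls.headD []) := by
    cases cls <;> rfl
  obtain ⟨t, ht, hev⟩ : Ev prog [.cons (encodeAdj adjH) (encodeAdj adj)] _ _ _ :=
    Ev.letIn (.call (.cons (Ev.var 0).tail .nil) h5)
      (.letIn (.call (.cons (.cons (Ev.var 1).tail (.call (.call (.call (.call (Ev.var 1).head h1) h2)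
        h3) h4)) (Ev.var 0)) h6)
      (.cons (.call (.cons (Ev.var 0) (Ev.var 1)) h7) (Ev.var 0).head))
  refine ⟨t, ht.trans ?_, _, rfl, ?_⟩
  · unfold mainCost
    omega
  · rw [← h9]
    exact hev

end Vertices

/-! #### The running time -/

/-- Functions that are bounded by a polynomial. -/
def PolyBounded (f : ℕ → ℕ) : Prop := ∃ c, ∀ n, f n ≤ (n + 2) ^ c

namespace PolyBounded

theorem const (k : ℕ) : PolyBounded fun _ => k :=
  ⟨k, fun n => Nat.lt_two_pow_self.le.trans (Nat.pow_le_pow_left (by omega) k)⟩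

theorem id : PolyBounded fun n => n := ⟨1, fun n => by simp⟩

theorem add {f g : ℕ → ℕ} (hf : PolyBounded f) (hg : PolyBounded g) :
    PolyBounded fun n => f n + g n := by
  obtain ⟨a, ha⟩ := hf
  obtain ⟨b, hb⟩ := hg
  refine ⟨a + b + 1, fun n => ?_⟩
  have h1 : (n + 2) ^ a ≤ (n + 2) ^ (a + b) := Nat.pow_le_pow_right (by omega) (by omega)
  have h2 : (n + 2) ^ b ≤ (n + 2) ^ (a + b) := Nat.pow_le_pow_right (by omega) (by omega)
  have h3 := ha n
  have h4 := hb n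
  rw [pow_succ]
  nlinarith

theorem mul {f g : ℕ → ℕ} (hf : PolyBounded f) (hg : PolyBounded g) :
    PolyBounded fun n => f n * g n := by
  obtain ⟨a, ha⟩ := hf
  obtain ⟨b, hb⟩ := hg
  exact ⟨a + b, fun n => by rw [pow_add]; exact Nat.mul_le_mul (ha n) (hb n)⟩

theorem loopCost {l B K : ℕ → ℕ} (hl : PolyBounded l) (hB : PolyBounded B) (hK : PolyBounded K) :
    PolyBounded fun n => Machine.loopCost (l n) (B n) (K n) :=
  (hl.add (const 1)).mul ((hB.add ((const 20).mul hK)).add (const 60))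

theorem memCost : PolyBounded Machine.memCost :=
  (id.add (const 1)).mul (((const 20).mul (id.add (const 1))).add (const 40))

theorem edgeCost : PolyBounded Machine.edgeCost :=
  (memCost.add ((const 20).mul (id.add (const 1)))).add (const 20)

theorem nbrsCost : PolyBounded Machine.nbrsCost :=
  loopCost id (edgeCost.add (const 50)) (const 1)

theorem selCost : PolyBounded Machine.selCost :=
  loopCost id ((nbrsCost.add ((const 20).mul (id.add (const 1)))).add (const 100)) (const 1)

theorem selAllCost : PolyBounded Machine.selAllCost :=
  ((loopCost (id.add (const 1)) (((const 4).mul selCost).add (const 120)) (const 4)).add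
    ((const 10).mul (id.add (const 1)))).add (const 40)

theorem roundCost {s : ℕ → ℕ} (hs : PolyBounded s) :
    PolyBounded fun n => Machine.roundCost n (s n) :=
  have h4 := (const 4).mul (id.add (const 1))
  loopCost hs ((loopCost hs selAllCost h4).add (const 30)) (hs.mul h4)

theorem famSize (r : ℕ) : PolyBounded fun n => Machine.famSize n r := by
  induction r with
  | zero => exact id.add (const 1)
  | succ r ih =>
    exact ((const 2).mul ih).add (ih.mul (ih.mul ((const 4).mul (id.add (const 1)))))

theorem candsCost {s : ℕ → ℕ} (hs : PolyBounded s) :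
    PolyBounded fun n => Machine.candsCost n (s n) :=
  have h2 := ((const 2).mul id).add (const 1)
  loopCost hs ((loopCost hs (((h2.mul ((h2.mul (edgeCost.add (const 40))).add (const 30))).add
    ((const 20).mul id)).add (const 60)) (const 1)).add (const 30)) hs

theorem levelCost (R : ℕ) {B : ℕ → ℕ} (hB : PolyBounded B) :
    PolyBounded fun n => Machine.levelCost n R (B n) :=
  have hs := famSize R
  have hstep := (((roundCost hs).add (loopCost hs (hB.add (const 10)) (const 1))).add
    ((const 40).mul hs)).add (const 100)
  ((((((const (R + 1)).mul (hstep.add (const 40))).add ((const 20).mul (id.add (const 1)))).add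
    (loopCost id (const 10) (const 1))).add (((hs.mul hs).add (const 1)).mul
      (((const 20).mul (((const 2).mul id).add (const 1))).add (const 40)))).add
    (candsCost hs)).add (const 100)

theorem diffCost : PolyBounded Machine.diffCost := loopCost id (memCost.add (const 30)) (const 1)

theorem indexCost : PolyBounded Machine.indexCost :=
  (id.add (const 1)).mul (memCost.add (const 40))

end PolyBounded

/-- The cost of a level is affine in the cost `B` of a recursive call. Adding `1` on both sides
turns the recursion into a multiplicative one. -/
theorem levelCost_le (n R B : ℕ) :
    levelCost n R B + 1 ≤ (levelCost n R 0 + (R + 1) * (famSize n R + 1) + 1) * (B + 1) := by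
  have h : levelCost n R B = levelCost n R 0 + (R + 1) * (famSize n R + 1) * B := by
    unfold levelCost stepCost loopCost
    ring
  rw [h]
  nlinarith [Nat.zero_le (levelCost n R 0 * B), Nat.zero_le ((R + 1) * (famSize n R + 1))]

theorem searchCost_le (n R d : ℕ) : searchCost n R d + 1 ≤
    21 * (levelCost n R 0 + (R + 1) * (famSize n R + 1) + 1) ^ d := by
  induction d with
  | zero => simp [searchCost]
  | succ d ih =>
    rw [searchCost, pow_succ]
    refine (levelCost_le n R _).trans ?_
    calc _ ≤ (levelCost n R 0 + (R + 1) * (famSize n R + 1) + 1) *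
          (21 * (levelCost n R 0 + (R + 1) * (famSize n R + 1) + 1) ^ d) :=
          Nat.mul_le_mul_left _ ih
      _ = _ := by ring

/-- For fixed `h` and `R` the factor per level is polynomial in `n`, so depth `d` contributes an
exponent linear in `d`. -/
theorem exists_mainCost_le (h R : ℕ) :
    ∃ q c : ℕ, ∀ n d, mainCost h n R d ≤ (n + 2) ^ (q + c * d) := by
  obtain ⟨c, hc⟩ := ((PolyBounded.levelCost R (PolyBounded.const 0)).add
    ((PolyBounded.const (R + 1)).mul ((PolyBounded.famSize R).add (PolyBounded.const 1)))).add
      (PolyBounded.const 1)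
  have h1 := PolyBounded.id.add (PolyBounded.const 1)
  obtain ⟨q, hq⟩ := ((((PolyBounded.const
    (60 * (2 ^ h + 2 ^ 2 ^ h + 2 ^ 2 ^ 2 ^ h + 2 ^ 2 ^ 2 ^ 2 ^ h))).add
      ((PolyBounded.const 20).mul h1)).add
      (h1.mul (((PolyBounded.const 21).add PolyBounded.diffCost).add (PolyBounded.const 40)))).add
      (PolyBounded.loopCost PolyBounded.id (PolyBounded.indexCost.add (PolyBounded.const 10))
        (PolyBounded.const 1))).add (PolyBounded.const 60)
  refine ⟨q, c, fun n d => ?_⟩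
  rw [pow_add, pow_mul]
  have h2 := searchCost_le n R d
  have h3 := Nat.pow_le_pow_left (hc n) d
  have h4 : 1 ≤ (levelCost n R 0 + (R + 1) * (famSize n R + 1) + 1) ^ d :=
    Nat.one_le_pow _ _ (by omega)
  refine le_trans ?_ (Nat.mul_le_mul (hq n) h3)
  set A := (levelCost n R 0 + (R + 1) * (famSize n R + 1) + 1) ^ d
  have h5 : searchCost n R d + diffCost n + 40 ≤ (21 + diffCost n + 40) * A := by
    nlinarith
  have h6 : (n + 1) * (searchCost n R d + diffCost n + 40) ≤
      (n + 1) * (21 + diffCost n + 40) * A := by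
    rw [mul_assoc]; exact Nat.mul_le_mul_left _ h5
  have h7 : ∀ x : ℕ, x ≤ x * A := fun x => Nat.le_mul_of_pos_right x h4
  unfold mainCost
  simp only [Nat.add_mul _ _ A]
  have h8 := h7 (60 * (2 ^ h + 2 ^ 2 ^ h + 2 ^ 2 ^ 2 ^ h + 2 ^ 2 ^ 2 ^ 2 ^ h))
  have h9 := h7 (20 * (n + 1))
  have h10 := h7 (loopCost n (indexCost n + 10) 1)
  exact Nat.add_le_add (Nat.add_le_add (Nat.add_le_add (Nat.add_le_add h8 h9) h6) h10) (h7 60)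

theorem pow_le_exp_logb {n q c d : ℕ} (hn : 2 ≤ n) (hd : d ≤ Nat.log 2 n + 1) :
    ((n + 2 : ℕ) : ℝ) ^ (q + c * d) ≤
      Real.exp ((2 * q + 4 * c + 1 : ℕ) * Real.logb 2 n ^ 2) := by
  have hn' : (2 : ℝ) ≤ n := by exact_mod_cast hn
  set L := Real.logb 2 n with hL
  have hL1 : 1 ≤ L := by
    rw [hL, Real.le_logb_iff_rpow_le (by norm_num) (by linarith), Real.rpow_one]
    exact hn'
  have hdL : (d : ℝ) ≤ 2 * L := by
    have h1 : ((Nat.log 2 n : ℕ) : ℝ) ≤ L := by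
      rw [hL, Real.le_logb_iff_rpow_le (by norm_num) (by linarith), Real.rpow_natCast]
      exact_mod_cast Nat.pow_log_le_self 2 (by omega)
    have h2 : (d : ℝ) ≤ (Nat.log 2 n : ℕ) + 1 := by exact_mod_cast hd
    linarith
  have hnL : (n : ℝ) = Real.exp (Real.log 2 * L) := by
    rw [hL, Real.logb, mul_div_cancel₀ _ (Real.log_pos (by norm_num)).ne', Real.exp_log (by linarith)]
  -- This is `n + 2 ≤ n ^ 2`, true from `n = 2` on.
  have h1 : ((n + 2 : ℕ) : ℝ) ≤ Real.exp (2 * (Real.log 2 * L)) := by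
    rw [two_mul, Real.exp_add, ← hnL]
    push_cast
    nlinarith
  calc ((n + 2 : ℕ) : ℝ) ^ (q + c * d) ≤ Real.exp (2 * (Real.log 2 * L)) ^ (q + c * d) := by gcongr
    _ = Real.exp ((q + c * d : ℕ) * (2 * (Real.log 2 * L))) := (Real.exp_nat_mul _ _).symm
    _ ≤ _ := by
      apply Real.exp_le_exp.2
      push_cast
      have h2 : Real.log 2 ≤ 1 := by linarith [Real.log_two_lt_d9]
      have h3 : 0 ≤ Real.log 2 := Real.log_nonneg (by norm_num)
      have hq : (0 : ℝ) ≤ q := Nat.cast_nonneg q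
      have hc : (0 : ℝ) ≤ c := Nat.cast_nonneg c
      have h4 : (q + c * d : ℝ) ≤ q * L + c * (2 * L) := by
        have := mul_le_mul_of_nonneg_left hdL hc
        nlinarith
      have h5 : Real.log 2 * L ≤ L := by nlinarith
      calc (q + c * d : ℝ) * (2 * (Real.log 2 * L)) ≤ (q * L + c * (2 * L)) * (2 * L) := by
            gcongr
        _ ≤ _ := by nlinarith [sq_nonneg L]

end Machine

theorem theorem1 :
    -- existence, for arbitrary finite vertex sets
    (∀ {W V : Type*} [Fintype W] [Fintype V] (H : Tournament W) (T : Tournament V),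
      H.IsConstellation → T.Free H →
      (2 ≤ Fintype.card V →
        ∃ (k : ℕ) (c : V → Fin k), T.IsProperColoring c ∧
          (k : ℝ) ≤ (Fintype.card V : ℝ) ^ (1 - ehCoeff (Fintype.card W)) *
            Real.logb 2 (Fintype.card V)) ∧
      ∃ S : Finset V, T.IsTransitive (S : Set V) ∧
        (Fintype.card V : ℝ) ^ ehCoeff (Fintype.card W) ≤ (S.card : ℝ)) ∧
    -- one algorithm, whose input consists of the constellation and of the tournament
    (∃ P : Machine.Program, ∀ (h : ℕ) (H : Tournament (Fin h)), H.IsConstellation →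
      ∃ C : ℝ, 0 < C ∧
        ∀ (n : ℕ) (T : Tournament (Fin n)), T.Free H →
        ∀ (adjH : Fin h → List (Fin h)) (adjT : Fin n → List (Fin n)),
          Machine.IsAdjacencyLists H adjH → Machine.IsAdjacencyLists T adjT →
        ∃ (k : ℕ) (c : Fin n → Fin k) (S : List (Fin n)) (t : ℕ),
          P.Runs (.cons (Machine.encodeAdj adjH) (Machine.encodeAdj adjT))
            (.cons (Machine.encodeColoring c) (Machine.encodeFins S)) t ∧
          -- the coloring
          T.IsProperColoring c ∧
          (2 ≤ n → (k : ℝ) ≤ (n : ℝ) ^ (1 - ehCoeff h) * Real.logb 2 n) ∧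
          -- the transitive subtournament, which is the first color class
          S.Nodup ∧ (∀ v, v ∈ S ↔ (c v : ℕ) = 0) ∧
          T.IsTransitive {v | v ∈ S} ∧
          (n : ℝ) ^ ehCoeff h ≤ (S.length : ℝ) ∧
          -- the running time
          (2 ≤ n → (t : ℝ) ≤ Real.exp (C * Real.logb 2 n ^ 2))) := by
  refine ⟨fun H T hH hT => Tournament.exists_coloring_and_transitive hH hT, Machine.prog, ?_⟩
  intro h H hH
  obtain ⟨q, c, hqc⟩ := Machine.exists_mainCost_le h (2 ^ 2 ^ 2 ^ 2 ^ h)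
  refine ⟨(2 * q + 4 * c + 1 : ℕ), by positivity, fun n T hT adjH adjT _ hadj => ?_⟩
  classical
  obtain ⟨G, ctr, part, θ, hG, hθ⟩ := hH.exists_isStarData
  have hcard : Fintype.card (Fin h) = h := Fintype.card_fin h
  have hpos : 0 < h := hcard ▸ hT.card_pos
  set R := 2 ^ 2 ^ 2 ^ 2 ^ h with hR
  -- A logarithmic depth suffices because the sets are halved; it makes the exponent of the running
  -- time quadratic in the logarithm.
  set d := Nat.log 2 n + 1 with hd
  have hl : (List.finRange n).length = n := List.length_finRange
  have hnd : n ≤ 2 ^ d := (Nat.lt_pow_succ_log_self (by norm_num) n).le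
  have hRh : Tournament.roundBound (Fintype.card (Fin h)) ≤ R := by
    rw [hcard]; exact Tournament.roundBound_le hpos
  obtain ⟨col, hcol, h1, h2, h3, h4, h5, h6⟩ := Tournament.exists_coloring (T := T) hG hT.card_pos
    (hT.of_equiv θ hθ) hRh (List.nodup_finRange n) (fun v => List.mem_finRange v)
    (hl.le.trans hnd)
  have hsearch : ∀ X : List (Fin n), X.Nodup → X.length ≤ 2 ^ d → X ≠ [] →
      T.search R d X ≠ [] := fun X hXn hXd hX hnil => by
    have h7 := Tournament.rpow_le_length_search (T := T) hG hT.card_pos (hT.of_equiv θ hθ) hRh d X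
      hXn hXd
    have h8 : (0 : ℝ) < X.length := by exact_mod_cast List.length_pos_iff.2 hX
    have := Real.rpow_pos_of_pos h8 (ehCoeff (Fintype.card (Fin h)))
    rw [hnil, List.length_nil, Nat.cast_zero] at h7
    linarith
  rw [hcard] at h2 h6
  rw [hl] at h2 h6
  obtain ⟨t, ht, hrun⟩ := Machine.runs_prog adjH hadj hR hsearch hnd (by rw [hl]) col hcol
  refine ⟨_, col, _, t, hrun, h1, fun hn => ?_, h3, h4, h5, h6.trans_eq ?_, fun hn => ?_⟩
  · rw [hl]; exact h2 hn
  · rw [hl]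
  · refine le_trans ?_ (Machine.pow_le_exp_logb hn le_rfl)
    exact_mod_cast ht.trans (hqc n d)
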